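/- The unbiased Maker-Breaker Hamiltonicity game is played on the edge set of the complete graph $K_n$: two players, Maker and Breaker, alternately claim one unclaimed edge of $K_n$ each, until all edges are claimed. Maker wins if, at the end, the edges that he has claimed contain all edges of some Hamiltonian cycle of $K_n$ (a cycle through all $n$ vertices); otherwise Breaker wins. We say that Maker wins the game as first (respectively, second) player if he has a winning strategy when Maker (respectively, Breaker) makes the first move. Theorem. For every integer $n \ge 0$, Maker wins the Hamiltonicity game on $E(K_n)$ as first player if and only if $n \ge 8$, and he wins it as second player if and only if $n \ge 8$. -/

import Mathlib

namespace MakerBreaker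

/-- A positional game: a hypergraph on a finite board `X` with a family of winning sets. -/
structure PositionalGame (X : Type*) [Finite X] where
  /-- the family of winning sets -/
  winningSets : Set (Set X)

/-- The two players. -/
inductive Player where
  | maker
  | breaker

/-- The opponent of a player. -/
def Player.opponent : Player → Player
  | .maker => .breaker
  | .breaker => .maker

/-- The player who makes move number `k` (counted from `0`), when `first` starts. -/
def toMove (first : Player) (k : ℕ) : Player :=
  if Even k then first else first.opponent

/-- The set of elements claimed by `player` in the course of the moves `h` (in chronological
order), when `first` starts. -/
def claimed {X : Type*} (first player : Player) (h : List X) : Set X :=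
  {x | ∃ k, h[k]? = some x ∧ toMove first k = player}

/-- A complete play: only unclaimed elements are claimed, until the whole board is claimed. -/
def IsPlay {X : Type*} (p : List X) : Prop :=
  p.Nodup ∧ ∀ x, x ∈ p

/-- A strategy: it chooses an unclaimed element, whenever there is one, in reaction to the list
of all previous moves of both players. -/
def Strategy (X : Type*) : Type _ :=
  ∀ h : List X, (∃ x, x ∉ h) → {x : X // x ∉ h}

/-- In the play `p`, started by `first`, all moves of `player` are made according to `σ`. -/
def Strategy.Follows {X : Type*} (σ : Strategy X) (first player : Player) (p : List X) : Prop :=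
  ∀ (h : List X) (x : X), h ++ [x] <+: p → toMove first h.length = player →
    ∃ hne : ∃ y, y ∉ h, (σ h hne : X) = x

/-- Maker wins the Maker-Breaker game `G` started by `first`: he has a strategy such that, however
Breaker plays, he claims all elements of some winning set. -/
def MakerWins {X : Type*} [Finite X] (G : PositionalGame X) (first : Player) : Prop :=
  ∃ σ : Strategy X, ∀ p : List X, IsPlay p → σ.Follows first .maker p →
    ∃ S ∈ G.winningSets, S ⊆ claimed first .maker p

/-- The Hamiltonicity game on the edge set of `K_n`: the winning sets are the edge sets of the
Hamiltonian cycles of `K_n`. -/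
def hamiltonicityGame (n : ℕ) : PositionalGame (SimpleGraph.completeGraph (Fin n)).edgeSet where
  winningSets := {S | ∃ (v : Fin n) (c : (SimpleGraph.completeGraph (Fin n)).Walk v v),
    c.IsHamiltonianCycle ∧ S = {e | e.val ∈ c.edges}}

end MakerBreaker

namespace MakerBreaker

/-- The player who owns `M` and moves second on the set `F` of free elements can end up owning a
set with the property `P`. Passing is allowed. -/
inductive SecondWins {X : Type*} (P : Set X → Prop) : Set X → Set X → Prop
  | done {M F : Set X} (h : P M) : SecondWins P M F
  | step {M F : Set X} (N : X → Set X) (hF : F.Nonempty)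
      (hN : ∀ x ∈ F, N x ⊆ F \ {x} ∧ (N x).Subsingleton)
      (h : ∀ x ∈ F, SecondWins P (M ∪ N x) ((F \ {x}) \ N x)) : SecondWins P M F

namespace SecondWins

variable {X : Type*} {P Q : Set X → Prop} {M M' F F' : Set X}

theorem mono (hP : Monotone P) (h : SecondWins P M F) (hM : M ⊆ M') (hF : F ⊆ M' ∪ F') :
    SecondWins P M' F' := by
  induction h generalizing M' F' with
  | done h => exact .done (hP hM h)
  | @step M F N hne hN h ih =>
    obtain ⟨x₀, hx₀⟩ := hne
    have key : ∀ x ∈ F, ∀ x', (x' = x ∨ x' ∉ F) →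
        SecondWins P (M' ∪ (N x ∩ F')) ((F' \ {x'}) \ (N x ∩ F')) := by
      intro x hx x' hx'
      refine ih x hx ?_ ?_
      · rintro z (hz | hz)
        · exact .inl (hM hz)
        · rcases hF ((hN x hx).1 hz).1 with h | h
          exacts [.inl h, .inr ⟨hz, h⟩]
      · rintro z ⟨⟨hz, hzx⟩, hzN⟩
        rcases hF hz with h | h
        · exact .inl (.inl h)
        · refine .inr ⟨⟨h, ?_⟩, fun h => hzN h.1⟩
          rintro rfl
          rcases hx' with rfl | h'
          exacts [hzx rfl, h' hz]
    rcases F'.eq_empty_or_nonempty with rfl | hF'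
    · simpa using ih x₀ hx₀ (M' := M') (F' := ∅)
        (Set.union_subset hM fun z hz => by simpa using hF ((hN x₀ hx₀).1 hz).1)
        (fun z hz => by simpa using hF hz.1.1)
    · classical
      refine .step (fun x => if x ∈ F then N x ∩ F' else N x₀ ∩ F') hF' ?_ ?_
      · intro x hx
        split_ifs with hxF
        · exact ⟨fun z hz => ⟨hz.2, ((hN x hxF).1 hz.1).2⟩, (hN x hxF).2.anti Set.inter_subset_left⟩
        · refine ⟨fun z hz => ⟨hz.2, ?_⟩, (hN x₀ hx₀).2.anti Set.inter_subset_left⟩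
          rintro rfl
          exact hxF ((hN x₀ hx₀).1 hz.1).1
      · intro x hx
        split_ifs with hxF
        · exact key x hxF x (.inl rfl)
        · exact key x₀ hx₀ x (.inr hxF)

/-- It suffices to have, against every move `x`, a reply which wins on what remains. -/
theorem of_reply (hP : Monotone P) (hF : F.Nonempty)
    (h : ∀ x ∈ F, ∃ Y : Set X, Y.Subsingleton ∧ Y ⊆ M ∪ F ∧ x ∉ Y ∧
      SecondWins P (M ∪ Y) (F \ {x})) : SecondWins P M F := by
  choose! Y hY hYF hxY hw using h
  refine .step (fun x => Y x ∩ F) hF (fun x hx => ⟨fun z hz => ⟨hz.2, ?_⟩,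
    (hY x hx).anti Set.inter_subset_left⟩) fun x hx => (hw x hx).mono hP ?_ ?_
  · rintro rfl
    exact hxY z hx hz.1
  · rintro z (hz | hz)
    · exact .inl hz
    · rcases hYF x hx hz with h | h
      exacts [.inl h, .inr ⟨hz, h⟩]
  · intro z hz
    by_cases h : z ∈ Y x
    · exact .inl (.inr ⟨h, hz.1⟩)
    · exact .inr ⟨hz, fun h' => h h'.1⟩

theorem imp (hPQ : ∀ S, P S → Q S) (h : SecondWins P M F) : SecondWins Q M F := by
  induction h with
  | done h => exact .done (hPQ _ h)
  | step N hF hN _ ih => exact .step N hF hN ih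

theorem map {Y : Type*} {R : Set Y → Prop} (hR : Monotone R) (f : X → Y)
    (hf : F.InjOn f) (hPR : ∀ S, P S → R (f '' S)) (h : SecondWins P M F) :
    SecondWins R (f '' M) (f '' F) := by
  induction h with
  | done h => exact .done (hPR _ h)
  | @step M F N hF hN _ ih =>
    refine of_reply hR (hF.image f) ?_
    rintro _ ⟨x, hx, rfl⟩
    refine ⟨f '' N x, (hN x hx).2.image f, ?_, ?_,
      (ih x hx (hf.mono fun z hz => hz.1.1)).mono hR (Set.image_union ..).subset ?_⟩
    · rintro _ ⟨z, hz, rfl⟩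
      exact .inr ⟨z, ((hN x hx).1 hz).1, rfl⟩
    · rintro ⟨z, hz, h⟩
      exact ((hN x hx).1 hz).2 (hf ((hN x hx).1 hz).1 hx h)
    · rintro _ ⟨z, hz, rfl⟩
      exact .inr ⟨⟨z, hz.1.1, rfl⟩, fun h => hz.1.2 (hf hz.1.1 hx h)⟩

theorem and_of_left (hP : Monotone P) (hQ : Monotone Q) (h : P M) (h' : SecondWins Q M' F') :
    SecondWins (fun S => P S ∧ Q S) (M ∪ M') F' := by
  induction h' with
  | done h' => exact .done ⟨hP Set.subset_union_left h, hQ Set.subset_union_right h'⟩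
  | step N hF hN _ ih => exact .step N hF hN fun x hx => by simpa [Set.union_assoc] using ih x hx

/-- Two games on disjoint boards can be played simultaneously. -/
theorem and (hP : Monotone P) (hQ : Monotone Q) (h : SecondWins P M F)
    (h' : SecondWins Q M' F') (hd : Disjoint F F') :
    SecondWins (fun S => P S ∧ Q S) (M ∪ M') (F ∪ F') := by
  have hPQ : Monotone fun S => P S ∧ Q S := fun S T hST hS => ⟨hP hST hS.1, hQ hST hS.2⟩
  have hcomm : ∀ {S T}, SecondWins (fun S => Q S ∧ P S) S T → SecondWins (fun S => P S ∧ Q S) S T :=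
    imp fun _ => And.symm
  induction h generalizing M' F' with
  | @done M F h =>
    exact (and_of_left hP hQ h h').mono hPQ subset_rfl fun z hz => .inr (.inr hz)
  | @step M F N hF hN hs ih =>
    induction h' with
    | @done M' F' h' =>
      exact (hcomm (and_of_left hQ hP h' (.step N hF hN hs))).mono hPQ
        (Set.union_comm ..).subset fun z hz => .inr (.inl hz)
    | @step M' F' N' hF' hN' hs' ih' =>
      refine of_reply hPQ (hF.mono Set.subset_union_left) ?_
      rintro x (hx | hx)
      · refine ⟨N x, (hN x hx).2, fun z hz => .inr (.inl ((hN x hx).1 hz).1),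
          fun h => ((hN x hx).1 h).2 rfl,
          (ih x hx (.step N' hF' hN' hs') (hd.mono_left fun z hz => hz.1.1)).mono hPQ ?_ ?_⟩
        · rintro z ((h | h) | h)
          exacts [.inl (.inl h), .inr h, .inl (.inr h)]
        · rintro z (h | h)
          · exact .inr ⟨.inl h.1.1, h.1.2⟩
          · exact .inr ⟨.inr h, fun hzx => hd.ne_of_mem hx h (by simpa using hzx.symm)⟩
      · refine ⟨N' x, (hN' x hx).2, fun z hz => .inr (.inr ((hN' x hx).1 hz).1),
          fun h => ((hN' x hx).1 h).2 rfl,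
          (ih' x hx (hd.mono_right fun z hz => hz.1.1)).mono hPQ ?_ ?_⟩
        · rintro z (h | (h | h))
          exacts [.inl (.inl h), .inl (.inr h), .inr h]
        · rintro z (h | h)
          · exact .inr ⟨.inl h, fun hzx => hd.ne_of_mem h hx (by simpa using hzx)⟩
          · exact .inr ⟨.inr h.1.1, h.1.2⟩

theorem of_isEmpty (h : SecondWins P M ∅) : P M := by
  cases h with
  | done h => exact h
  | step N hF => exact absurd hF (by simp)

/-- Having the move is at least as good as moving second. -/
theorem extra_move (hP : Monotone P) (h : SecondWins P M F) {x : X} :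
    SecondWins P (insert x M) (F \ {x}) :=
  h.mono hP (Set.subset_insert ..) fun z hz => by
    by_cases hzx : z = x
    · exact .inl (.inl hzx)
    · exact .inr ⟨hz, hzx⟩

end SecondWins

theorem claimed_append {X : Type*} (first player : Player) (h : List X) (x : X) :
    claimed first player (h ++ [x]) =
      claimed first player h ∪ {y | y = x ∧ toMove first h.length = player} := by
  ext y
  constructor
  · rintro ⟨k, hk, hp⟩
    rcases lt_trichotomy k h.length with hlt | rfl | hgt
    · exact .inl ⟨k, by rwa [List.getElem?_append_left hlt] at hk, hp⟩
    · refine .inr ⟨?_, hp⟩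
      simpa using hk.symm
    · rw [List.getElem?_eq_none (by simp; omega)] at hk
      simp at hk
  · rintro (⟨k, hk, hp⟩ | ⟨rfl, hp⟩)
    · have hlt : k < h.length := (List.getElem?_eq_some_iff.1 hk).1
      exact ⟨k, by rwa [List.getElem?_append_left hlt], hp⟩
    · exact ⟨h.length, by simp, hp⟩

theorem claimed_nil {X : Type*} (first player : Player) : claimed first player ([] : List X) = ∅ := by
  ext; simp [claimed]

theorem toMove_succ_eq_maker (first : Player) (k : ℕ) :
    toMove first (k + 1) = .maker ↔ toMove first k = .breaker := by
  rcases first <;> by_cases h : Even k <;> simp [toMove, h, Nat.even_add_one, Player.opponent]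

theorem toMove_succ_eq_breaker (first : Player) (k : ℕ) :
    toMove first (k + 1) = .breaker ↔ toMove first k = .maker := by
  rcases first <;> by_cases h : Even k <;> simp [toMove, h, Nat.even_add_one, Player.opponent]

theorem ne_maker_iff (p : Player) : p ≠ .maker ↔ p = .breaker := by cases p <;> simp

section

variable {X : Type*} {P : Set X → Prop}

/-- The situation of the player who claims `M` when he is to move and the elements of `F` are free. -/
def FirstWins (P : Set X → Prop) (M F : Set X) : Prop :=
  (F = ∅ ∧ P M) ∨ ∃ y ∈ F, SecondWins P (insert y M) (F \ {y})

theorem SecondWins.firstWins (hP : Monotone P) {M F : Set X} (h : SecondWins P M F) :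
    FirstWins P M F := by
  rcases F.eq_empty_or_nonempty with rfl | ⟨y, hy⟩
  · exact .inl ⟨rfl, h.of_isEmpty⟩
  · exact .inr ⟨y, hy, h.extra_move hP⟩

theorem SecondWins.firstWins_diff (hP : Monotone P) {M F : Set X} (h : SecondWins P M F) {x : X}
    (hx : x ∈ F) : FirstWins P M (F \ {x}) := by
  cases h with
  | done h => exact (SecondWins.done h).firstWins hP
  | step N hF hN h =>
    have h := h x hx
    rcases (hN x hx).2.eq_empty_or_singleton with h0 | ⟨y, hy⟩
    · rw [h0] at h
      simp only [Set.union_empty, Set.sdiff_empty] at h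
      exact h.firstWins hP
    · rw [hy] at h
      refine .inr ⟨y, (hN x hx).1 (by simp [hy]), ?_⟩
      rwa [Set.insert_eq, Set.union_comm]

theorem setOf_notMem_append (h : List X) (x : X) : {z | z ∉ h ++ [x]} = {z | z ∉ h} \ {x} := by
  ext z; simp

open Classical in
/-- The strategy of claiming an element which leaves a won position, if there is one. -/
noncomputable def winningStrategy (P : Set X → Prop) (first player : Player) : Strategy X :=
  fun h hne =>
    if hy : ∃ y, y ∉ h ∧ SecondWins P (insert y (claimed first player h)) ({z | z ∉ h} \ {y}) then
      ⟨hy.choose, hy.choose_spec.1⟩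
    else ⟨hne.choose, hne.choose_spec⟩

theorem makerWins_of_secondWins [Finite X] {G : PositionalGame X} (hP : Monotone P)
    (hw : SecondWins P ∅ Set.univ) (hG : ∀ S, P S → ∃ W ∈ G.winningSets, W ⊆ S) (first : Player) :
    MakerWins G first := by
  refine ⟨winningStrategy P first .maker, fun p hp hf => ?_⟩
  have key : ∀ h : List X, h <+: p →
      (toMove first h.length = .breaker → SecondWins P (claimed first .maker h) {z | z ∉ h}) ∧
      (toMove first h.length = .maker → FirstWins P (claimed first .maker h) {z | z ∉ h}) := by
    intro h
    induction h using List.reverseRecOn with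
    | nil =>
      have : SecondWins P (claimed first .maker []) {z | z ∉ ([] : List X)} := by
        simpa [claimed_nil] using hw
      exact fun _ => ⟨fun _ => this, fun _ => this.firstWins hP⟩
    | append_singleton h x ih =>
      intro hpre
      have ih := ih ((List.prefix_append h [x]).trans hpre)
      have hx : x ∉ h := by
        have := hp.1.sublist hpre.sublist
        rw [List.nodup_append] at this
        exact fun hx => this.2.2 x hx x (by simp) rfl
      rw [List.length_append, List.length_singleton, toMove_succ_eq_breaker, toMove_succ_eq_maker,
        claimed_append, setOf_notMem_append]
      refine ⟨fun hm => ?_, fun hb => ?_⟩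
      · rcases ih.2 hm with ⟨h0, -⟩ | hex
        · exact absurd h0 (Set.Nonempty.ne_empty ⟨x, hx⟩)
        · obtain ⟨hne, hσ⟩ := hf h x hpre hm
          have hy : ∃ y, y ∉ h ∧
              SecondWins P (insert y (claimed first .maker h)) ({z | z ∉ h} \ {y}) := hex
          rw [winningStrategy, dif_pos hy] at hσ
          have := hy.choose_spec.2
          rw [show hy.choose = x from hσ] at this
          simpa only [hm, and_true, Set.ofPred_eq_eq_singleton, Set.union_singleton] using this
      · simpa [hb] using (ih.1 hb).firstWins_diff hP hx
  have hfin : {z | z ∉ p} = ∅ := by ext z; simp [hp.2 z]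
  have hk := key p (List.prefix_refl p)
  rw [hfin] at hk
  apply hG
  by_cases hm : toMove first p.length = .maker
  · rcases hk.2 hm with ⟨-, h⟩ | ⟨y, hy, -⟩
    exacts [h, hy.elim]
  · exact (hk.1 ((ne_maker_iff _).1 hm)).of_isEmpty

theorem not_makerWins_of_secondWins [Finite X] {G : PositionalGame X} (hP : Monotone P)
    (hw : SecondWins P ∅ Set.univ) (hG : ∀ S, P S → ∀ W ∈ G.winningSets, ¬ W ⊆ Sᶜ)
    (first : Player) : ¬ MakerWins G first := by
  rintro ⟨σ, hσ⟩
  have key : ∀ (k : ℕ) (h : List X), {z | z ∉ h}.ncard = k → h.Nodup → σ.Follows first .maker h →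
      ((toMove first h.length = .maker → SecondWins P (claimed first .breaker h) {z | z ∉ h}) ∧
      (toMove first h.length = .breaker → FirstWins P (claimed first .breaker h) {z | z ∉ h})) →
      ∃ p, IsPlay p ∧ σ.Follows first .maker p ∧ P (claimed first .breaker p) := by
    intro k
    induction k with
    | zero =>
      intro h hk hnd hfol hwin
      have hfin : {z | z ∉ h} = ∅ := (Set.ncard_eq_zero).1 hk
      refine ⟨h, ⟨hnd, fun z => by_contra fun hz => ?_⟩, hfol, ?_⟩
      · exact (Set.eq_empty_iff_forall_notMem.1 hfin) z hz
      · rw [hfin] at hwin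
        by_cases hm : toMove first h.length = .maker
        · exact (hwin.1 hm).of_isEmpty
        · rcases hwin.2 ((ne_maker_iff _).1 hm) with ⟨-, h⟩ | ⟨y, hy, -⟩
          exacts [h, hy.elim]
    | succ k ih =>
      intro h hk hnd hfol hwin
      have hnext : ∀ x, x ∉ h → {z | z ∉ h ++ [x]}.ncard = k ∧ (h ++ [x]).Nodup := by
        intro x hx
        refine ⟨?_, ?_⟩
        · rw [setOf_notMem_append, Set.ncard_sdiff_singleton_of_mem (by exact hx), hk]; rfl
        · exact List.nodup_append.2 ⟨hnd, by simp, by rintro a ha b hb rfl; simp at hb; exact hx (hb ▸ ha)⟩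
      have hfollow : ∀ x, (toMove first h.length = .maker → ∃ hne : ∃ y, y ∉ h, (σ h hne : X) = x) →
          σ.Follows first .maker (h ++ [x]) := by
        intro x hx h' y hpre hm
        rcases List.prefix_concat_iff.1 hpre with heq | hpre'
        · obtain ⟨rfl, hxy⟩ := List.append_inj' heq rfl
          simp only [List.cons.injEq, and_true] at hxy
          subst hxy
          exact hx hm
        · exact hfol h' y hpre' hm
      have hne : {z | z ∉ h}.Nonempty := by
        rw [← Set.ncard_pos, hk]; omega
      by_cases hm : toMove first h.length = .maker
      · have hx := (σ h hne).2
        refine ih (h ++ [(σ h hne : X)]) (hnext _ hx).1 (hnext _ hx).2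
          (hfollow _ fun _ => ⟨hne, rfl⟩) ?_
        rw [List.length_append, List.length_singleton, toMove_succ_eq_breaker, toMove_succ_eq_maker,
          claimed_append, setOf_notMem_append]
        refine ⟨fun hb => by simp [hb] at hm, fun _ => ?_⟩
        simpa [hm] using (hwin.1 hm).firstWins_diff hP hx
      · have hb := (ne_maker_iff _).1 hm
        rcases hwin.2 hb with ⟨h0, -⟩ | ⟨y, hy, hyw⟩
        · exact absurd h0 hne.ne_empty
        · refine ih (h ++ [y]) (hnext _ hy).1 (hnext _ hy).2 (hfollow _ fun h => absurd h hm) ?_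
          rw [List.length_append, List.length_singleton, toMove_succ_eq_breaker,
            toMove_succ_eq_maker, claimed_append, setOf_notMem_append]
          refine ⟨fun _ => ?_, fun h => absurd h hm⟩
          simpa only [hb, and_true, Set.ofPred_eq_eq_singleton, Set.union_singleton] using hyw
  obtain ⟨p, hp, hfol, hPp⟩ := key _ [] rfl List.nodup_nil
    (fun h x hpre => by simp at hpre) (by
      have : SecondWins P (claimed first .breaker []) {z | z ∉ ([] : List X)} := by
        simpa [claimed_nil] using hw
      exact ⟨fun _ => this, fun _ => this.firstWins hP⟩)
  obtain ⟨W, hW, hWc⟩ := hσ p hp hfol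
  refine hG _ hPp W hW (hWc.trans ?_)
  rintro z ⟨k, hk, hm⟩ ⟨k', hk', hb⟩
  obtain ⟨hlt, hk⟩ := List.getElem?_eq_some_iff.1 hk
  obtain ⟨hlt', hk'⟩ := List.getElem?_eq_some_iff.1 hk'
  have := (hp.1.getElem_inj_iff (hi := hlt) (hj := hlt')).1 (hk.trans hk'.symm)
  subst this
  simp [hm] at hb

end

/-- The edge set `S` contains the edges of a Hamiltonian cycle, given as a cyclic list. -/
def HasHam {V : Type*} (S : Set (Sym2 V)) : Prop :=
  ∃ l : List V, l.Nodup ∧ (∀ v, v ∈ l) ∧ Cycle.Chain (fun a b => s(a, b) ∈ S) (l : Cycle V)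

/-- The board: all edges of the complete graph. -/
def edges (V : Type*) : Set (Sym2 V) := {e | ¬ e.IsDiag}

theorem hasHam_mono {V : Type*} : Monotone (HasHam (V := V)) := by
  rintro S T hST ⟨l, h1, h2, h3⟩
  exact ⟨l, h1, h2, h3.imp fun a b h => hST h⟩

theorem SecondWins.comap {X Y : Type*} {P : Set Y → Prop}
    (f : X → Y) (hf : Function.Injective f) {M F : Set X} (h : SecondWins P (f '' M) (f '' F)) :
    SecondWins (fun S => P (f '' S)) M F := by
  generalize hM : f '' M = M₀, hF : f '' F = F₀ at h
  induction h generalizing M F with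
  | done h => subst hM; exact .done h
  | step N hne hN h ih =>
    subst hM hF
    refine .step (fun x => f ⁻¹' N (f x)) (Set.image_nonempty.1 hne) ?_ ?_
    · intro x hx
      obtain ⟨h1, h2⟩ := hN (f x) ⟨x, hx, rfl⟩
      refine ⟨fun z hz => ?_, h2.preimage hf⟩
      obtain ⟨⟨w, hw, hwz⟩, hne⟩ := h1 hz
      exact ⟨hf hwz ▸ hw, fun h => hne (congrArg f h)⟩
    · intro x hx
      have hsub : N (f x) ⊆ f '' F := fun z hz => ((hN (f x) ⟨x, hx, rfl⟩).1 hz).1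
      have himg : f '' (f ⁻¹' N (f x)) = N (f x) :=
        Set.image_preimage_eq_of_subset (hsub.trans (Set.image_subset_range ..))
      refine ih (f x) ⟨x, hx, rfl⟩ ?_ ?_
      · rw [Set.image_union, himg]
      · rw [Set.image_sdiff hf, Set.image_sdiff hf, himg, Set.image_singleton]

section

variable {n : ℕ}

theorem image_val_univ :
    (Subtype.val '' (Set.univ : Set (SimpleGraph.completeGraph (Fin n)).edgeSet)) =
      edges (Fin n) := by
  ext e
  induction e with
  | _ a b => simp [edges]

theorem exists_winningSet_of_hasHam (hn : 3 ≤ n)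
    {S : Set (SimpleGraph.completeGraph (Fin n)).edgeSet} (h : HasHam (Subtype.val '' S)) :
    ∃ W ∈ (hamiltonicityGame n).winningSets, W ⊆ S := by
  obtain ⟨l, hnd, hall, hch⟩ := h
  have hlen : l.length = n := by
    have := List.toFinset_card_of_nodup hnd
    rw [← this, show l.toFinset = Finset.univ by ext; simp [hall]]; simp
  obtain _ | ⟨a, t⟩ := l
  · simp at hlen; omega
  rw [Cycle.chain_coe_cons] at hch
  set G : SimpleGraph (Fin n) := SimpleGraph.fromEdgeSet (Subtype.val '' S) with hG
  have hch' : (a :: (t ++ [a])).IsChain G.Adj := by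
    refine hch.imp fun x y hxy => ?_
    rw [hG, SimpleGraph.fromEdgeSet_adj]
    refine ⟨hxy, ?_⟩
    obtain ⟨⟨e, he⟩, -, rfl⟩ := hxy
    exact ((SimpleGraph.mem_edgeSet _).1 he).ne
  obtain ⟨c, hc⟩ : ∃ c : G.Walk a a, c.support = a :: (t ++ [a]) := by
    have hne : a :: (t ++ [a]) ≠ [] := List.cons_ne_nil _ _
    obtain ⟨u, w, c, hu, hw, hc⟩ : ∃ u w, ∃ c : G.Walk u w, u = (a :: (t ++ [a])).head hne ∧
        w = (a :: (t ++ [a])).getLast hne ∧ c.support = a :: (t ++ [a]) :=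
      ⟨_, _, .ofSupport _ hne hch', rfl, rfl, SimpleGraph.Walk.support_ofSupport ..⟩
    have hu : u = a := hu
    have hw : w = a := by simpa using hw
    subst hu hw
    exact ⟨c, hc⟩
  have hclen : c.length = n := by
    have := c.length_support
    rw [hc] at this
    simp at this hlen
    omega
  have hnd' : (t ++ [a]).Nodup := (List.perm_append_singleton a t).nodup_iff.2 hnd
  have hnil : ¬ c.Nil := by
    intro h
    have := SimpleGraph.Walk.length_eq_zero_iff.2 h
    omega
  have htail : c.tail.support = t ++ [a] := by
    rw [SimpleGraph.Walk.support_tail_of_not_nil _ hnil, hc]; rfl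
  have hham : c.IsHamiltonianCycle := by
    rw [SimpleGraph.Walk.isHamiltonianCycle_isCycle_and_isHamiltonian_tail,
      SimpleGraph.Walk.isCycle_iff_isPath_tail_and_le_length]
    have hp : c.tail.IsPath := by
      rw [SimpleGraph.Walk.isPath_def, htail]; exact hnd'
    refine ⟨⟨hp, by omega⟩, hp.isHamiltonian_of_mem fun w => ?_⟩
    rw [htail]
    simpa [or_comm] using hall w
  have hle : G ≤ SimpleGraph.completeGraph (Fin n) := le_top
  refine ⟨_, ⟨a, c.mapLe hle, hham.map (f := SimpleGraph.Hom.ofLE hle) Function.bijective_id, rfl⟩, ?_⟩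
  intro e he
  have he : e.val ∈ c.edges := by simpa using he
  have := c.edges_subset_edgeSet he
  rw [hG, SimpleGraph.edgeSet_fromEdgeSet] at this
  obtain ⟨e', he', hee⟩ := this.1
  rwa [← Subtype.ext hee]

theorem isChain_support {V : Type*} {G : SimpleGraph V} {u v : V} (w : G.Walk u v)
    {S : Set (Sym2 V)} (h : ∀ e ∈ w.edges, e ∈ S) :
    w.support.IsChain fun a b => s(a, b) ∈ S := by
  induction w with
  | nil => simp
  | cons hadj p ih =>
    have ih := ih fun e he => h e (by simp [he])
    cases p with
    | nil => simpa using h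
    | cons h' q => simpa [SimpleGraph.Walk.support_cons, List.isChain_cons_cons] using ⟨h _ (by simp), by simpa using ih⟩

theorem hasHam_of_isHamiltonianCycle {v : Fin n}
    {c : (SimpleGraph.completeGraph (Fin n)).Walk v v} (hc : c.IsHamiltonianCycle)
    {S : Set (Sym2 (Fin n))} (hS : ∀ e ∈ c.edges, e ∈ S) : HasHam S := by
  have hch := isChain_support c hS
  rw [SimpleGraph.Walk.isHamiltonianCycle_iff_isCycle_and_support_count_tail_eq_one] at hc
  obtain ⟨hcyc, hcount⟩ := hc
  obtain ⟨t, ht⟩ : ∃ t, c.support = v :: (t ++ [v]) := by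
    have hne : c.support.tail ≠ [] := by
      intro h
      have := hcount v
      rw [h] at this
      simp at this
    refine ⟨c.support.tail.dropLast, ?_⟩
    conv_lhs => rw [← SimpleGraph.Walk.cons_tail_support]
    congr 1
    conv_lhs => rw [← List.dropLast_append_getLast hne]
    congr 2
    rw [List.getLast_tail]
    simp
  rw [ht] at hch hcount
  have hperm := List.perm_append_singleton v t
  refine ⟨v :: t, hperm.nodup_iff.1 ?_, fun w => hperm.mem_iff.1 ?_, ?_⟩
  · exact List.nodup_iff_count_le_one.2 fun a => (hcount a).le
  · exact List.count_pos_iff.1 (by rw [show t ++ [v] = (v :: (t ++ [v])).tail from rfl, hcount]; simp)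
  · rwa [Cycle.chain_coe_cons]

theorem makerWins_of_hasHam (hn : 3 ≤ n) (h : SecondWins HasHam ∅ (edges (Fin n)))
    (first : Player) : MakerWins (hamiltonicityGame n) first := by
  refine makerWins_of_secondWins (P := fun S => HasHam (Subtype.val '' S))
    (fun S T hST => hasHam_mono (Set.image_mono hST)) ?_
    (fun S => exists_winningSet_of_hasHam hn) first
  exact SecondWins.comap _ Subtype.val_injective (by rwa [Set.image_empty, image_val_univ])

/-- Breaker's goal. -/
def NoHam {V : Type*} (S : Set (Sym2 V)) : Prop := ¬ HasHam (edges V \ S)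

theorem noHam_mono {V : Type*} : Monotone (NoHam (V := V)) := fun _ _ hST h h' =>
  h (hasHam_mono (fun _ hx => ⟨hx.1, fun hS => hx.2 (hST hS)⟩) h')

theorem not_makerWins_of_noHam (h : SecondWins NoHam ∅ (edges (Fin n)))
    (first : Player) : ¬ MakerWins (hamiltonicityGame n) first := by
  refine not_makerWins_of_secondWins (P := fun S => NoHam (Subtype.val '' S))
    (fun S T hST => noHam_mono (Set.image_mono hST)) ?_ ?_ first
  · exact SecondWins.comap _ Subtype.val_injective (by rwa [Set.image_empty, image_val_univ])
  · rintro S hS W ⟨v, c, hc, rfl⟩ hW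
    refine hS (hasHam_of_isHamiltonianCycle hc fun e he => ?_)
    have hmem := c.edges_subset_edgeSet he
    refine ⟨?_, ?_⟩
    · rw [← image_val_univ]; exact ⟨⟨e, hmem⟩, trivial, rfl⟩
    · rintro ⟨e', he', hee⟩
      exact hW (a := e') (by rw [← hee] at he; exact he) he'

end

/-- Conditions under which two sets of vertices contain neighbours on every cycle. -/
def Meeting {W : Type*} (A B : Set W) : Prop :=
  (∃ x, (∀ w, w ≠ x → w ∈ A ∨ w ∈ B) ∧ A.Nonempty ∧ B.Nonempty) ∨
  ∃ x y, (∀ w, w ≠ x → w ≠ y → w ∈ A ∨ w ∈ B) ∧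
    ∃ a, a ∈ A ∧ a ∈ B ∧ (∃ a' ∈ A, a' ≠ a) ∧ ∃ b' ∈ B, b' ≠ a

theorem Meeting.mono {W : Type*} {A B A' B' : Set W} (hA : A ⊆ A') (hB : B ⊆ B')
    (h : Meeting A B) : Meeting A' B' := by
  rcases h with ⟨x, h1, h2, h3⟩ | ⟨x, y, h1, a, ha, hb, ⟨a', ha', hne⟩, b', hb', hne'⟩
  · exact .inl ⟨x, fun w hw => (h1 w hw).imp (@hA w) (@hB w), h2.mono hA, h3.mono hB⟩
  · exact .inr ⟨x, y, fun w hw hw' => (h1 w hw hw').imp (@hA w) (@hB w), a, hA ha, hB hb,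
      ⟨a', hA ha', hne⟩, b', hB hb', hne'⟩

/-- Neither `p` in `A` and `q` in `B` nor conversely. -/
def Apart {W : Type*} (A B : Set W) (p q : W) : Prop := ¬ (p ∈ A ∧ q ∈ B) ∧ ¬ (p ∈ B ∧ q ∈ A)

theorem Apart.mem_left {W : Type*} {A B : Set W} {l : List W} {p : W}
    (hc : (p :: l).IsChain (Apart A B)) (hcov : ∀ w ∈ l, w ∈ A ∨ w ∈ B) (hp : p ∈ A) :
    ∀ w ∈ l, w ∈ A ∧ w ∉ B := by
  induction l generalizing p with
  | nil => simp
  | cons q l ih =>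
    rw [List.isChain_cons_cons] at hc
    have hqB : q ∉ B := fun h => hc.1.1 ⟨hp, h⟩
    have hqA : q ∈ A := (hcov q (by simp)).resolve_right hqB
    intro w hw
    rcases List.mem_cons.1 hw with rfl | hw
    · exact ⟨hqA, hqB⟩
    · exact ih hc.2 (fun w hw => hcov w (by simp [hw])) hqA w hw

theorem Apart.symm {W : Type*} {A B : Set W} {p q : W} (h : Apart A B p q) : Apart B A p q :=
  ⟨h.2, h.1⟩

theorem Apart.monochromatic {W : Type*} {A B : Set W} {l : List W} (hl : 2 ≤ l.length)
    (hc : l.IsChain (Apart A B)) (hcov : ∀ w ∈ l, w ∈ A ∨ w ∈ B) :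
    (∀ w ∈ l, w ∉ B) ∨ ∀ w ∈ l, w ∉ A := by
  have main : ∀ {A B : Set W} {p q : W} {l : List W}, (p :: q :: l).IsChain (Apart A B) →
      (∀ w ∈ p :: q :: l, w ∈ A ∨ w ∈ B) → p ∈ A → ∀ w ∈ p :: q :: l, w ∉ B := by
    intro A B p q l hc hcov hp w hw
    have := Apart.mem_left hc (fun w hw => hcov w (by simp [hw])) hp
    rcases List.mem_cons.1 hw with rfl | hw
    · exact fun hB => (List.isChain_cons_cons.1 hc).1.2 ⟨hB, (this q (by simp)).1⟩
    · exact (this w hw).2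
  match l, hl with
  | p :: q :: l, _ =>
    rcases hcov p (by simp) with hp | hp
    · exact .inl (main hc hcov hp)
    · exact .inr (main (hc.imp fun _ _ => Apart.symm) (fun w hw => (hcov w hw).symm) hp)

theorem exists_rotation {W : Type*} {l : List W} {x : W} (hx : x ∈ l) :
    ∃ t, (l : Cycle W) = ((x :: t : List W) : Cycle W) ∧ l.Perm (x :: t) := by
  obtain ⟨s, t, rfl⟩ := List.append_of_mem hx
  refine ⟨t ++ s, ?_, ?_⟩
  · rw [Cycle.coe_eq_coe]
    exact List.isRotated_append
  · exact List.perm_append_comm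

theorem not_chain_of_cover {W : Type*} {A B : Set W} {l : List W}
    (hnd : l.Nodup) (hall : ∀ w, w ∈ l) (hlen : 5 ≤ l.length) {x : W}
    (hcov : ∀ w, w ≠ x → w ∈ A ∨ w ∈ B) {a b : W} (ha : a ∈ A) (hb : b ∈ B) :
    ¬ Cycle.Chain (Apart A B) (l : Cycle W) := by
  intro hc
  obtain ⟨t, ht, hperm⟩ := exists_rotation (hall x)
  rw [ht, Cycle.chain_coe_cons] at hc
  have hnd' := hperm.nodup_iff.1 hnd
  have hlen' := hperm.length_eq
  have hmem : ∀ w, w = x ∨ w ∈ t := fun w => by simpa using hperm.mem_iff.1 (hall w)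
  simp only [List.length_cons] at hlen'
  by_cases hx : x ∈ A ∨ x ∈ B
  · have hcov' : ∀ w ∈ x :: t, w ∈ A ∨ w ∈ B := fun w _ => by
      by_cases h : w = x
      exacts [h ▸ hx, hcov w h]
    rcases Apart.monochromatic (by simp; omega)
      (hc.prefix (l₁ := x :: t) ⟨[x], by simp⟩) hcov' with h | h
    · exact h b (by simpa using hmem b) hb
    · exact h a (by simpa using hmem a) ha
  · have hmem' : ∀ w, (w ∈ A ∨ w ∈ B) → w ∈ t := fun w hw =>
      (hmem w).resolve_left (by rintro rfl; exact hx hw)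
    rcases Apart.monochromatic (l := t) (by omega)
      (hc.infix ⟨[x], [x], by simp⟩) (fun w hw => hcov w (by
        rintro rfl; exact (List.nodup_cons.1 hnd').1 hw)) with h | h
    · exact h b (hmem' b (.inr hb)) hb
    · exact h a (hmem' a (.inl ha)) ha

theorem Meeting.not_chain {W : Type*} {A B : Set W} (h : Meeting A B) {l : List W}
    (hnd : l.Nodup) (hall : ∀ w, w ∈ l) (hlen : 5 ≤ l.length) :
    ¬ Cycle.Chain (Apart A B) (l : Cycle W) := by
  rcases h with ⟨x, hcov, ⟨a, ha⟩, b, hb⟩ | ⟨x, y, hcov, a, haA, haB, ⟨a', ha', hne⟩, b', hb', hne'⟩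
  · exact not_chain_of_cover hnd hall hlen hcov ha hb
  by_cases hx : x ∈ A ∨ x ∈ B
  · refine not_chain_of_cover (x := y) hnd hall hlen (fun w hw => ?_) haA haB
    by_cases h : w = x
    exacts [h ▸ hx, hcov w h hw]
  by_cases hy : y ∈ A ∨ y ∈ B
  · refine not_chain_of_cover (x := x) hnd hall hlen (fun w hw => ?_) haA haB
    by_cases h : w = y
    exacts [h ▸ hy, hcov w hw h]
  by_cases hxy : x = y
  · subst hxy
    exact not_chain_of_cover hnd hall hlen (fun w hw => hcov w hw hw) haA haB
  intro hc
  obtain ⟨t, ht, hperm⟩ := exists_rotation (hall x)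
  rw [ht, Cycle.chain_coe_cons] at hc
  have hnd' := hperm.nodup_iff.1 hnd
  have hlen' := hperm.length_eq
  have hmem : ∀ w, w = x ∨ w ∈ t := fun w => by simpa using hperm.mem_iff.1 (hall w)
  obtain ⟨s, r, rfl⟩ := List.append_of_mem ((hmem y).resolve_left (Ne.symm hxy))
  simp only [List.length_cons, List.length_append] at hlen'
  rw [List.nodup_cons, List.nodup_middle, List.nodup_cons] at hnd'
  have hcovs : ∀ w ∈ s, w ∈ A ∨ w ∈ B := fun w hw => hcov w
    (by rintro rfl; exact hnd'.1 (by simp [hw])) (by rintro rfl; exact hnd'.2.1 (by simp [hw]))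
  have hcovr : ∀ w ∈ r, w ∈ A ∨ w ∈ B := fun w hw => hcov w
    (by rintro rfl; exact hnd'.1 (by simp [hw])) (by rintro rfl; exact hnd'.2.1 (by simp [hw]))
  have hsr : ∀ w, (w ∈ A ∨ w ∈ B) → w ∈ s ∨ w ∈ r := by
    intro w hw
    have h1 : w ≠ x := by rintro rfl; exact hx hw
    have h2 : w ≠ y := by rintro rfl; exact hy hw
    simpa [h1, h2] using hmem w
  have hcs : s.IsChain (Apart A B) := hc.infix ⟨[x], y :: r ++ [x], by simp⟩
  have hcr : r.IsChain (Apart A B) := hc.infix ⟨x :: s ++ [y], [x], by simp⟩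
  have aux : ∀ s r : List W, s.IsChain (Apart A B) → r.IsChain (Apart A B) →
      (∀ w ∈ s, w ∈ A ∨ w ∈ B) → (∀ w ∈ r, w ∈ A ∨ w ∈ B) →
      (∀ w, (w ∈ A ∨ w ∈ B) → w ∈ s ∨ w ∈ r) → 3 ≤ s.length + r.length → a ∈ s → False := by
    intro s r hcs hcr hcovs hcovr hsr hlen has
    by_cases hs : 2 ≤ s.length
    · rcases Apart.monochromatic hs hcs hcovs with h | h
      exacts [h a has haB, h a has haA]
    · obtain ⟨c, rfl⟩ : ∃ c, s = [c] := by
        rw [← List.length_eq_one_iff]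
        have := List.length_pos_of_mem has
        omega
      obtain rfl : a = c := by simpa using has
      simp only [List.length_singleton] at hlen
      have ha'r : a' ∈ r := (hsr a' (.inl ha')).resolve_left (by simpa using hne)
      have hb'r : b' ∈ r := (hsr b' (.inr hb')).resolve_left (by simpa using hne')
      rcases Apart.monochromatic (by omega) hcr hcovr with h | h
      exacts [h b' hb'r hb', h a' ha'r ha']
  rcases hsr a (.inl haA) with h | h
  · exact aux s r hcs hcr hcovs hcovr hsr (by omega) h
  · exact aux r s hcr hcs hcovr hcovs (fun w hw => (hsr w hw).symm) (by omega) h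

/-- A cyclic list which is not a cyclic chain has a cut at a bad pair. -/
theorem exists_cut {W : Type*} {R : W → W → Prop} {l : List W} (hl : 2 ≤ l.length)
    (h : ¬ Cycle.Chain R (l : Cycle W)) :
    ∃ a t b, (l : Cycle W) = ((a :: (t ++ [b]) : List W) : Cycle W) ∧
      l.Perm (a :: (t ++ [b])) ∧ ¬ R b a := by
  match l, hl with
  | p :: q :: l, _ =>
    rw [Cycle.chain_coe_cons] at h
    have : ∀ m : List W, ∀ p, ¬ (p :: m).IsChain R → ∃ s r c d, p :: m = s ++ c :: d :: r ∧ ¬ R c d := by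
      intro m
      induction m with
      | nil => intro p h; simp at h
      | cons q m ih =>
        intro p h
        rw [List.isChain_cons_cons, not_and_or] at h
        rcases h with h | h
        · exact ⟨[], m, p, q, rfl, h⟩
        · obtain ⟨s, r, c, d, heq, hR⟩ := ih q h
          exact ⟨p :: s, r, c, d, by rw [heq]; rfl, hR⟩
    obtain ⟨s, r, c, d, heq, hR⟩ := this _ _ h
    rcases r.eq_nil_or_concat with rfl | ⟨r, e, rfl⟩
    · have h1 : p :: q :: l ++ [p] = s ++ [c] ++ [d] := by simpa using heq
      obtain ⟨h2, h3⟩ := List.append_inj' h1 rfl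
      simp only [List.cons.injEq, and_true] at h3
      subst h3
      match s, h2 with
      | [], h2 => simp at h2
      | p' :: s, h2 =>
        simp only [List.cons_append, List.cons.injEq] at h2
        obtain ⟨rfl, h2⟩ := h2
        exact ⟨p, s, c, by rw [h2], by rw [h2], hR⟩
    · have h1 : p :: q :: l ++ [p] = (s ++ c :: d :: r) ++ [e] := by simpa using heq
      obtain ⟨h2, -⟩ := List.append_inj' h1 rfl
      have h3 : (s ++ [c]) ++ (d :: r) ~r d :: ((r ++ s) ++ [c]) := by
        have := List.isRotated_append (l := s ++ [c]) (l' := d :: r)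
        simpa using this
      refine ⟨d, r ++ s, c, ?_, ?_, hR⟩
      · rw [h2, Cycle.coe_eq_coe]; simpa using h3
      · rw [h2]; simpa using h3.perm

/-- Two adjacent new vertices can be inserted into a Hamiltonian cycle of the rest. -/
theorem hasHam_insert {V : Type*} {u v : V} (huv : u ≠ v) {S : Set (Sym2 V)} (hS : s(u, v) ∈ S)
    (hcard : 5 ≤ Nat.card {w : V // w ≠ u ∧ w ≠ v})
    (hham : HasHam {e : Sym2 {w : V // w ≠ u ∧ w ≠ v} | e.map Subtype.val ∈ S})
    (hm : Meeting {w : {w : V // w ≠ u ∧ w ≠ v} | s(u, w.1) ∈ S} {w | s(v, w.1) ∈ S}) :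
    HasHam S := by
  obtain ⟨l, hnd, hall, hch⟩ := hham
  have hlen : 5 ≤ l.length := by
    classical
    have hcount : l.toFinset.card = l.length := List.toFinset_card_of_nodup hnd
    have : Fintype {w : V // w ≠ u ∧ w ≠ v} := ⟨l.toFinset, fun w => by simp [hall]⟩
    rw [← hcount, show l.toFinset = Finset.univ by ext; simp [hall], Finset.card_univ,
      ← Nat.card_eq_fintype_card]
    exact hcard
  obtain ⟨a, t, b, hcyc, hperm, hR⟩ := exists_cut (by omega) (hm.not_chain hnd hall hlen)
  have main : ∀ u' v' : V, (∀ w : V, w = u' ∨ w = v' ∨ (w ≠ u ∧ w ≠ v)) → u' ≠ v' →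
      (u' = u ∨ u' = v) → (v' = u ∨ v' = v) →
      s(u', v') ∈ S → s(u', b.1) ∈ S → s(v', a.1) ∈ S → HasHam S := by
    intro u' v' hcases hne hu' hv' hs hb ha
    refine ⟨v' :: ((a :: (t ++ [b])).map Subtype.val ++ [u']), ?_, ?_, ?_⟩
    · have h1 : ((a :: (t ++ [b])).map Subtype.val).Nodup :=
        (hperm.nodup_iff.1 hnd).map Subtype.val_injective
      have hnot : ∀ z, (z = u ∨ z = v) → z ∉ (a :: (t ++ [b])).map Subtype.val := by
        intro z hz hmem
        obtain ⟨w, -, rfl⟩ := List.mem_map.1 hmem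
        rcases hz with h | h
        exacts [w.2.1 h, w.2.2 h]
      rw [List.nodup_cons, List.nodup_append]
      refine ⟨?_, h1, by simp, ?_⟩
      · rw [List.mem_append, not_or]
        exact ⟨hnot v' hv', by simpa using hne.symm⟩
      · rintro z hz w hw rfl
        simp only [List.mem_singleton] at hw
        exact hnot u' hu' (hw ▸ hz)
    · intro w
      rcases hcases w with rfl | rfl | hw
      · simp
      · simp
      · have := List.mem_map_of_mem (f := Subtype.val) (hperm.mem_iff.1 (hall ⟨w, hw⟩))
        exact List.mem_cons_of_mem _ (List.mem_append_left _ this)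
    · rw [hcyc, Cycle.chain_coe_cons] at hch
      have hch' : (a :: (t ++ [b])).IsChain (fun p q => s(p.1, q.1) ∈ S) :=
        (hch.prefix (l₁ := a :: (t ++ [b])) ⟨[a], by simp⟩).imp fun p q h => h
      have hch2 : ((a :: (t ++ [b])).map Subtype.val).IsChain (fun p q => s(p, q) ∈ S) :=
        (List.isChain_map _).2 hch'
      rw [Cycle.chain_coe_cons, List.isChain_cons, List.append_assoc, List.isChain_append]
      refine ⟨by simpa using ha, hch2, by simpa using hs, ?_⟩
      rw [← List.cons_append, List.map_append, List.map_singleton, List.getLast?_concat]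
      rintro _ ⟨⟩ _ ⟨⟩
      rwa [Sym2.eq_swap]
  rw [Apart, not_and_or, not_not, not_not] at hR
  rcases hR with ⟨h1, h2⟩ | ⟨h1, h2⟩
  · refine main u v (fun w => ?_) huv (.inl rfl) (.inr rfl) hS h1 h2
    tauto
  · refine main v u (fun w => ?_) huv.symm (.inr rfl) (.inl rfl) (by rwa [Sym2.eq_swap]) h1 h2
    tauto

/-- A search for a win of the second player among the moves `F`, when he owns the elements in
the binary expansion of `M`. -/
def search (good : ℕ → Bool) : ℕ → ℕ → List ℕ → Bool
  | 0, M, _ => good M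
  | k + 1, M, F => good M || (!F.isEmpty && F.all fun x => F.any fun y => !(Nat.beq x y) &&
      search good k (M ||| 1 <<< y) (F.filter fun z => !(Nat.beq z x) && !(Nat.beq z y)))

theorem search_sound {P : Set ℕ → Prop} (hP : Monotone P) {good : ℕ → Bool}
    (hgood : ∀ M, good M = true → P {i | M.testBit i = true}) (k : ℕ) (M : ℕ) (F : List ℕ)
    (h : search good k M F = true) : SecondWins P {i | M.testBit i = true} {i | i ∈ F} := by
  induction k generalizing M F with
  | zero => exact .done (hgood M h)
  | succ k ih =>
    rw [search, Bool.or_eq_true, Bool.and_eq_true, List.all_eq_true] at h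
    rcases h with h | ⟨hne, h⟩
    · exact .done (hgood M h)
    · refine .of_reply hP ?_ ?_
      · cases F with
        | nil => simp at hne
        | cons a F => exact ⟨a, by simp⟩
      · intro x hx
        obtain ⟨y, hy, hxy⟩ := List.any_eq_true.1 (h x hx)
        rw [Bool.and_eq_true, Bool.not_eq_true', ← Bool.not_eq_true, Nat.beq_eq] at hxy
        refine ⟨{y}, Set.subsingleton_singleton, fun z hz => .inr (by rwa [hz]),
          by simpa using hxy.1, (ih _ _ hxy.2).mono hP ?_ ?_⟩
        · intro i hi
          simp only [Set.mem_ofPred_eq, Nat.testBit_or, Nat.one_shiftLeft, Nat.testBit_two_pow,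
            Bool.or_eq_true, decide_eq_true_eq] at hi
          rcases hi with hi | hi
          · exact .inl hi
          · exact .inr (hi.symm)
        · intro i hi
          simp only [Set.mem_ofPred_eq, List.mem_filter, Bool.and_eq_true, Bool.not_eq_true',
            ← Bool.not_eq_true, Nat.beq_eq] at hi
          exact .inr ⟨hi.1, hi.2.1⟩

/-- A computable form of `Meeting` for subsets of a set with five elements. -/
def meets (M : ℕ) : Bool :=
  let A := M % 32
  let B := M / 32 % 32
  let C := A ||| B
  (!(A == 0) && !(B == 0) && (List.range 5).any fun x => (C ||| 1 <<< x) == 31) ||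
    (((List.range 5).any fun x => (List.range 5).any fun y => (C ||| 1 <<< x ||| 1 <<< y) == 31) &&
      (List.range 5).any fun a => A.testBit a && B.testBit a && !(A == 1 <<< a) && !(B == 1 <<< a))

theorem meeting_of_meets {M : ℕ} (h : meets M = true) :
    Meeting {i : Fin 5 | i.val ∈ {j | M.testBit j = true}}
      {i : Fin 5 | i.val + 5 ∈ {j | M.testBit j = true}} := by
  have hA : ∀ i, (M % 32).testBit i = (decide (i < 5) && M.testBit i) := fun i => by
    rw [show 32 = 2 ^ 5 from rfl, Nat.testBit_mod_two_pow]
  have hB : ∀ i, (M / 32 % 32).testBit i = (decide (i < 5) && M.testBit (i + 5)) := fun i => by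
    rw [show 32 = 2 ^ 5 from rfl, Nat.testBit_mod_two_pow, Nat.testBit_div_two_pow]
  have hbit : ∀ (m : ℕ) (i : Fin 5), m = 31 → m.testBit i = true := by
    rintro m i rfl
    revert i
    decide
  have hex : ∀ (N : ℕ) (k : ℕ), N.testBit k = true → N ≠ 1 <<< k →
      ∃ i, N.testBit i = true ∧ i ≠ k := by
    intro N k hk hN
    by_contra! h
    refine hN (Nat.eq_of_testBit_eq fun i => ?_)
    rw [Nat.one_shiftLeft, Nat.testBit_two_pow]
    by_cases hi : N.testBit i = true
    · rw [h i hi, hk]; simp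
    · have : k ≠ i := by rintro rfl; exact hi hk
      simp [hi, this]
  simp only [meets, Bool.or_eq_true, Bool.and_eq_true, Bool.not_eq_true', beq_eq_false_iff_ne,
    List.any_eq_true, List.mem_range, beq_iff_eq] at h
  have cov : ∀ (i : Fin 5) (k : ℕ), i.val ≠ k → Nat.testBit (1 <<< k) i = false := by
    intro i k hik
    rw [Nat.one_shiftLeft, Nat.testBit_two_pow]
    simp [Ne.symm hik]
  rcases h with ⟨⟨hA0, hB0⟩, x, hx, hc⟩ | ⟨⟨x, hx, y, hy, hc⟩, a, ha, ⟨⟨haA, haB⟩, hA1⟩, hB1⟩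
  · obtain ⟨a, ha⟩ := Nat.exists_testBit_of_ne_zero hA0
    obtain ⟨b, hb⟩ := Nat.exists_testBit_of_ne_zero hB0
    simp only [hA, hB, Bool.and_eq_true, decide_eq_true_eq] at ha hb
    refine .inl ⟨⟨x, hx⟩, fun w hw => ?_, ⟨⟨a, ha.1⟩, ha.2⟩, ⟨⟨b, hb.1⟩, hb.2⟩⟩
    have hw : w.val ≠ x := fun h => hw (Fin.ext h)
    simpa [Nat.testBit_or, hA, hB, cov w x hw] using hbit _ w hc
  · obtain ⟨a', ha', hne⟩ := hex _ a haA hA1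
    obtain ⟨b', hb', hne'⟩ := hex _ a haB hB1
    simp only [hA, hB, Bool.and_eq_true, decide_eq_true_eq] at ha' hb' haA haB
    refine .inr ⟨⟨x, hx⟩, ⟨y, hy⟩, fun w hw hw' => ?_, ⟨a, ha⟩, haA.2, haB.2,
      ⟨⟨a', ha'.1⟩, ha'.2, by simpa using hne⟩, ⟨b', hb'.1⟩, hb'.2, by simpa using hne'⟩
    have hw : w.val ≠ x := fun h => hw (Fin.ext h)
    have hw' : w.val ≠ y := fun h => hw' (Fin.ext h)
    simpa [Nat.testBit_or, hA, hB, cov w x hw, cov w y hw'] using hbit _ w hc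

theorem secondWins_small : SecondWins
    (fun S : Set ℕ => Meeting {i : Fin 5 | i.val ∈ S} {i : Fin 5 | i.val + 5 ∈ S})
    ∅ (Set.Icc 1 9) := by
  have h : search meets 5 0 [1, 2, 3, 4, 5, 6, 7, 8, 9] = true := by decide +kernel
  refine (search_sound (fun S T hST hS => hS.mono (fun i hi => hST hi) fun i hi => hST hi)
    (fun M => meeting_of_meets) 5 0 _ h).mono
    (fun S T hST hS => hS.mono (fun i hi => hST hi) fun i hi => hST hi) ?_ ?_
  · intro i hi; simp at hi
  · intro i hi
    refine .inr ?_
    simp only [List.mem_cons, Set.mem_ofPred_eq, List.not_mem_nil, or_false] at hi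
    exact ⟨by omega, by omega⟩

theorem Meeting.of_injective {ι W : Type*} {d : ι → W} (hd : Function.Injective d) {A B : Set W}
    (h : Meeting (d ⁻¹' A) (d ⁻¹' B)) (hrest : ∀ w, w ∉ Set.range d → w ∈ A ∨ w ∈ B) :
    Meeting A B := by
  rcases h with ⟨x, h1, ⟨a, ha⟩, b, hb⟩ | ⟨x, y, h1, a, ha, hb, ⟨a', ha', hne⟩, b', hb', hne'⟩
  · refine .inl ⟨d x, fun w hw => ?_, ⟨d a, ha⟩, d b, hb⟩
    by_cases h : w ∈ Set.range d
    · obtain ⟨i, rfl⟩ := h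
      exact h1 i fun h => hw (h ▸ rfl)
    · exact hrest w h
  · refine .inr ⟨d x, d y, fun w hw hw' => ?_, d a, ha, hb, ⟨d a', ha', hd.ne hne⟩, d b', hb', hd.ne hne'⟩
    by_cases h : w ∈ Set.range d
    · obtain ⟨i, rfl⟩ := h
      exact h1 i (fun h => hw (h ▸ rfl)) fun h => hw' (h ▸ rfl)
    · exact hrest w h

theorem SecondWins.pairing {ι X : Type*} {f g : ι → X} (hf : Function.Injective f)
    (hg : Function.Injective g) (hfg : ∀ i j, f i ≠ g j) (I : Finset ι) :
    SecondWins (fun S => ∀ i ∈ I, f i ∈ S ∨ g i ∈ S) ∅ (f '' I ∪ g '' I) := by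
  classical
  induction I using Finset.induction with
  | empty => exact .done (by simp)
  | insert a I ha ih =>
    have hm : ∀ J : Finset ι, Monotone fun S : Set X => ∀ i ∈ J, f i ∈ S ∨ g i ∈ S :=
      fun J S T hST h i hi => (h i hi).imp (@hST _) (@hST _)
    have h1 : SecondWins (fun S => ∀ i ∈ ({a} : Finset ι), f i ∈ S ∨ g i ∈ S) ∅ {f a, g a} := by
      refine .of_reply (hm _) ⟨f a, by simp⟩ ?_
      rintro x (rfl | rfl)
      · exact ⟨{g a}, Set.subsingleton_singleton, by simp, hfg a a, .done (by simp)⟩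
      · exact ⟨{f a}, Set.subsingleton_singleton, by simp, (hfg a a).symm, .done (by simp)⟩
    have hd : Disjoint {f a, g a} (f '' I ∪ g '' I) := by
      rw [Set.disjoint_left]
      rintro x (rfl | rfl) (⟨i, hi, h⟩ | ⟨i, hi, h⟩)
      · exact ha (hf h ▸ hi)
      · exact hfg _ _ h.symm
      · exact hfg _ _ h
      · exact ha (hg h ▸ hi)
    refine ((h1.and (hm _) (hm _) ih hd).imp ?_).mono (hm _) (by simp) ?_
    · rintro S ⟨h1, h2⟩ i hi
      rcases Finset.mem_insert.1 hi with rfl | hi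
      exacts [h1 i (by simp), h2 i hi]
    · rw [Finset.coe_insert, Set.image_insert_eq, Set.image_insert_eq]
      rintro x ((rfl | rfl) | (h | h)) <;> simp_all

theorem exists_injective_of_card {W : Type*} [Finite W] (h : 5 ≤ Nat.card W) (x : W) :
    ∃ d : Fin 5 → W, Function.Injective d ∧ d 0 = x := by
  classical
  have := Fintype.ofFinite W
  obtain ⟨e⟩ := Function.Embedding.nonempty_of_card_le (α := Fin 5) (β := W)
    (by simpa [Nat.card_eq_fintype_card] using h)
  exact ⟨fun i => Equiv.swap (e 0) x (e i), (Equiv.injective _).comp e.injective, by simp⟩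

theorem secondWins_hasHam_step {V : Type*} [Finite V] {u v x : V} (huv : u ≠ v) (hxu : x ≠ u)
    (hxv : x ≠ v) (hcard : 5 ≤ Nat.card {w : V // w ≠ u ∧ w ≠ v})
    (ih : SecondWins HasHam ∅ (edges {w : V // w ≠ u ∧ w ≠ v})) :
    SecondWins HasHam {s(u, v)} (edges V \ {s(u, x), s(u, v)}) := by
  classical
  obtain ⟨d, hd, hd0⟩ := exists_injective_of_card hcard ⟨x, hxu, hxv⟩
  have := Fintype.ofFinite {w : V // w ≠ u ∧ w ≠ v}
  have eqL : ∀ {p : V} (a b : {w : V // w ≠ u ∧ w ≠ v}), s(p, a.1) = s(p, b.1) → a = b := by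
    intro p a b h
    exact Subtype.ext (Sym2.congr_right.1 h)
  have neL : ∀ a b : {w : V // w ≠ u ∧ w ≠ v}, s(u, a.1) ≠ s(v, b.1) := by
    intro a b h
    rcases Sym2.eq_iff.1 h with ⟨h, -⟩ | ⟨h, -⟩
    exacts [huv h, b.2.1 h.symm]
  set f : ℕ → Sym2 V := fun c =>
    if c < 5 then s(u, (d (Fin.ofNat 5 c)).1) else s(v, (d (Fin.ofNat 5 (c - 5))).1) with hf
  have hfu : ∀ i : Fin 5, f i = s(u, (d i).1) := fun i => by simp [hf]
  have hfv : ∀ i : Fin 5, f (i + 5) = s(v, (d i).1) := fun i => by simp [hf]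
  have hcode : ∀ c : ℕ, c < 10 → (∃ i : Fin 5, c = i.val) ∨ ∃ i : Fin 5, c = i.val + 5 := by
    intro c hc
    by_cases h : c < 5
    · exact .inl ⟨⟨c, h⟩, rfl⟩
    · exact .inr ⟨⟨c - 5, by omega⟩, by simp; omega⟩
  have hfinj : (Set.Icc 1 9).InjOn f := by
    intro c hc c' hc' h
    rcases hcode c (by have := hc.2; omega) with ⟨i, rfl⟩ | ⟨i, rfl⟩ <;>
      rcases hcode c' (by have := hc'.2; omega) with ⟨j, rfl⟩ | ⟨j, rfl⟩
    · rw [hfu, hfu] at h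
      rw [hd (eqL _ _ h)]
    · rw [hfu, hfv] at h
      exact absurd h (neL _ _)
    · rw [hfu, hfv] at h
      exact absurd h.symm (neL _ _)
    · rw [hfv, hfv] at h
      rw [hd (eqL _ _ h)]
  let small : Set (Sym2 V) → Prop := fun S =>
    Meeting {i : Fin 5 | s(u, (d i).1) ∈ S} {i : Fin 5 | s(v, (d i).1) ∈ S}
  have small_mono : Monotone small := fun S T hST h => h.mono (fun i hi => hST hi) fun i hi => hST hi
  have h1 : SecondWins small ∅ (f '' Set.Icc 1 9) := by
    have := secondWins_small.map small_mono f hfinj (fun S hS => hS.mono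
      (fun i hi => ⟨i.val, hi, hfu i⟩)
      (fun i hi => ⟨i.val + 5, hi, hfv i⟩))
    rwa [Set.image_empty] at this
  let I : Finset {w : V // w ≠ u ∧ w ≠ v} := Finset.univ.filter (· ∉ Set.range d)
  have hI : ∀ w, w ∈ I ↔ w ∉ Set.range d := by simp [I]
  have h2 := SecondWins.pairing (f := fun w : {w : V // w ≠ u ∧ w ≠ v} => s(u, w.1))
    (g := fun w => s(v, w.1)) (fun a b => eqL a b) (fun a b => eqL a b) neL I
  have h3 : SecondWins (fun S : Set (Sym2 V) =>
      HasHam {e : Sym2 {w : V // w ≠ u ∧ w ≠ v} | e.map Subtype.val ∈ S}) ∅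
      (Sym2.map Subtype.val '' edges {w : V // w ≠ u ∧ w ≠ v}) := by
    have := ih.map (R := fun S : Set (Sym2 V) =>
      HasHam {e : Sym2 {w : V // w ≠ u ∧ w ≠ v} | e.map Subtype.val ∈ S})
      (fun S T hST => hasHam_mono fun e he => hST he) (Sym2.map Subtype.val)
      (Sym2.map.injective Subtype.val_injective).injOn
      (fun S hS => hasHam_mono (fun e he => ⟨e, he, rfl⟩) hS)
    rwa [Set.image_empty] at this
  have m2 : Monotone fun S : Set (Sym2 V) => ∀ w ∈ I, s(u, w.1) ∈ S ∨ s(v, w.1) ∈ S :=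
    fun S T hST h i hi => (h i hi).imp (@hST _) (@hST _)
  have m3 : Monotone fun S : Set (Sym2 V) =>
      HasHam {e : Sym2 {w : V // w ≠ u ∧ w ≠ v} | e.map Subtype.val ∈ S} :=
    fun S T hST => hasHam_mono fun e he => hST he
  have hmemf : ∀ e ∈ f '' Set.Icc 1 9, ∃ i, e = s(u, (d i).1) ∧ i ≠ 0 ∨ e = s(v, (d i).1) := by
    rintro _ ⟨c, hc, rfl⟩
    rcases hcode c (by have := hc.2; omega) with ⟨i, rfl⟩ | ⟨i, rfl⟩
    · refine ⟨i, .inl ⟨hfu i, ?_⟩⟩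
      rintro rfl
      simpa using hc.1
    · exact ⟨i, .inr (hfv i)⟩
  have d12 : Disjoint (f '' Set.Icc 1 9) ((fun w : {w : V // w ≠ u ∧ w ≠ v} => s(u, w.1)) '' I ∪
      (fun w : {w : V // w ≠ u ∧ w ≠ v} => s(v, w.1)) '' I) := by
    rw [Set.disjoint_left]
    intro e he he'
    obtain ⟨i, ⟨rfl, -⟩ | rfl⟩ := hmemf e he <;> rcases he' with ⟨w, hw, h⟩ | ⟨w, hw, h⟩
    · exact (hI w).1 hw ⟨i, (eqL _ _ h).symm⟩
    · exact neL _ _ h.symm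
    · exact neL _ _ h
    · exact (hI w).1 hw ⟨i, (eqL _ _ h).symm⟩
  have m12 := (h1.and small_mono m2 h2 d12)
  have d3 : Disjoint (f '' Set.Icc 1 9 ∪ ((fun w : {w : V // w ≠ u ∧ w ≠ v} => s(u, w.1)) '' I ∪
      (fun w : {w : V // w ≠ u ∧ w ≠ v} => s(v, w.1)) '' I))
      (Sym2.map Subtype.val '' edges {w : V // w ≠ u ∧ w ≠ v}) := by
    rw [Set.disjoint_left]
    intro e he he'
    have huse : u ∈ e ∨ v ∈ e := by
      rcases he with he | ⟨w, hw, rfl⟩ | ⟨w, hw, rfl⟩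
      · obtain ⟨i, ⟨rfl, -⟩ | rfl⟩ := hmemf e he <;> simp
      · simp
      · simp
    obtain ⟨e', -, rfl⟩ := he'
    simp only [Sym2.mem_map] at huse
    rcases huse with ⟨w, -, h⟩ | ⟨w, -, h⟩
    exacts [w.2.1 h, w.2.2 h]
  have hall := m12.and (fun S T hST h => ⟨small_mono hST h.1, m2 hST h.2⟩) m3 h3 d3
  have m0 : Monotone fun S : Set (Sym2 V) => s(u, v) ∈ S := fun S T hST h => hST h
  have hfin := SecondWins.and_of_left (M := {s(u, v)}) m0
    (fun S T hST h => ⟨⟨small_mono hST h.1.1, m2 hST h.1.2⟩, m3 hST h.2⟩) (by simp) hall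
  refine (hfin.imp ?_).mono hasHam_mono (by simp) ?_
  · rintro S ⟨hS, ⟨hs, hp⟩, hh⟩
    exact hasHam_insert huv hS hcard hh (Meeting.of_injective hd hs fun w hw => hp w ((hI w).2 hw))
  · intro e he
    refine .inr ⟨?_, ?_⟩
    · rcases he with (he | ⟨w, -, rfl⟩ | ⟨w, -, rfl⟩) | ⟨e, he, rfl⟩
      · obtain ⟨i, ⟨rfl, -⟩ | rfl⟩ := hmemf e he
        · simpa [edges] using (d i).2.1.symm
        · simpa [edges] using (d i).2.2.symm
      · simpa [edges] using w.2.1.symm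
      · simpa [edges] using w.2.2.symm
      · simpa [edges, Sym2.isDiag_map Subtype.val_injective] using he
    · have nu : ∀ w : {w : V // w ≠ u ∧ w ≠ v}, w ≠ d 0 →
          s(u, w.1) ∉ ({s(u, x), s(u, v)} : Set (Sym2 V)) := by
        rintro w hw (h | h)
        · exact hw (Subtype.ext (by rw [hd0]; exact Sym2.congr_right.1 h))
        · exact w.2.2 (Sym2.congr_right.1 h)
      have nv : ∀ w : {w : V // w ≠ u ∧ w ≠ v},
          s(v, w.1) ∉ ({s(u, x), s(u, v)} : Set (Sym2 V)) := by
        rintro w (h | h)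
        · exact neL ⟨x, hxu, hxv⟩ w h.symm
        · rw [Sym2.eq_swap (a := u)] at h
          exact w.2.1 (Sym2.congr_right.1 h)
      rcases he with (he | ⟨w, hw, rfl⟩ | ⟨w, hw, rfl⟩) | ⟨e, he, rfl⟩
      · obtain ⟨i, ⟨rfl, hi⟩ | rfl⟩ := hmemf e he
        · exact nu _ (hd.ne hi)
        · exact nv _
      · exact nu _ fun h => (hI w).1 hw ⟨0, h.symm⟩
      · exact nv _
      · have hu : u ∉ e.map Subtype.val := by
          rw [Sym2.mem_map]
          rintro ⟨w, -, h⟩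
          exact w.2.1 h
        rintro (h | h) <;> exact hu (by rw [h]; simp)

/-! ### Sets of edges encoded as numbers

The edge between the vertices `a` and `b`, which are numbers less than `9`, is encoded by the bits
`9 * a + b` and `9 * b + a`. A pattern is a number whose lower `81` bits describe the free edges
and whose upper `81` bits describe the edges which are already owned. -/

/-- The edges encoded by the bits of `m` from `k` on, for the vertices labelled by `φ`. -/
def bitEdges {V : Type*} (n : ℕ) (φ : ℕ → V) (k m : ℕ) : Set (Sym2 V) :=
  {e | ∃ a < n, ∃ b < n, a ≠ b ∧ m.testBit (k + (9 * a + b)) = true ∧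
    m.testBit (k + (9 * b + a)) = true ∧ e = s(φ a, φ b)}

/-- For every labelling, the pattern `e` is won by the player who moves second. -/
def ValidPattern {V : Type*} (P : Set (Sym2 V) → Prop) (n e : ℕ) : Prop :=
  ∀ φ : ℕ → V, Set.BijOn φ (Set.Iio n) Set.univ →
    SecondWins P (bitEdges n φ 81 e) (bitEdges n φ 0 e \ bitEdges n φ 81 e)

/-! The following functions are meant for evaluation in the kernel. They are defined by recursors
and by the functions on natural numbers which the kernel knows. -/

noncomputable section

/-- `f x`, where `x` is evaluated first. -/
def force (x : ℕ) (f : ℕ → Bool) : Bool := Nat.rec (f 0) (fun n _ => f (Nat.succ n)) x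

/-- `f x` for positive `x`, where `x` is evaluated first. -/
def forcePos (x : ℕ) (f : ℕ → Bool) : Bool := Nat.rec false (fun n _ => f (Nat.succ n)) x

/-- Insert `x` into `l` at a given position. -/
def insertNth (x : ℕ) (l : List ℕ) : ℕ → List ℕ :=
  List.rec (fun _ => [x]) (fun a l' ih i => Nat.rec (x :: a :: l') (fun j _ => a :: ih j) i) l

/-- The permutation of `l` with number `q`. -/
def decodePerm (l : List ℕ) : ℕ → ℕ → List ℕ :=
  List.rec (fun _ _ => [])
    (fun x _ ih q k => insertNth x (ih (Nat.div q k) (Nat.pred k)) (Nat.mod q k)) l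

/-- Move the bits of `e` in `mask + s` to `mask + k * d` for corresponding `s` and `d`. -/
def spread (e mask k : ℕ) (S : List ℕ) : List ℕ → ℕ :=
  List.rec (fun _ => 0) (fun s _ ih D => List.rec 0 (fun d D' _ =>
    Nat.lor (Nat.shiftLeft (Nat.land (Nat.shiftRight e s) mask) (Nat.mul k d)) (ih D')) D) S

/-- The image of a pattern under a relabelling. -/
def relabel (e : ℕ) (S S9 : List ℕ) (D : List ℕ) : ℕ :=
  spread (spread e 11440325928226245935058198299148986455232348673 1 S D)
    1235522187646151016549712383 9 S9 D

/-- The entry of `l` at a given position. -/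
def entry (l : List ℕ) : ℕ → ℕ :=
  List.rec (fun _ => 0) (fun a _ ih i => Nat.rec a (fun j _ => ih j) i) l

/-- The pattern with index `j` in a block of patterns. -/
def patternAt (b j : ℕ) : ℕ :=
  Nat.mod (Nat.shiftRight b (Nat.mul 162 j)) 5846006549323611672814739330865132078623730171904

/-- Combine the patterns which are the results of the replies encoded by `c`, and pass the union
`acc` of the patterns before the replies, together with the intersection `int` of their free
edges, to `k`. The digits of `c` in base `base` are the replies: such a digit consists of the
index of the block and the position in it of a pattern, of the edge claimed in reply, and of the
number of a permutation of the vertices, to be applied to the pattern. -/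
def combine (S S9 : List ℕ) (n nf base : ℕ) (T : List ℕ) (k : ℕ → ℕ → Bool) (f : ℕ) :
    ℕ → ℕ → ℕ → Bool :=
  Nat.rec (fun _ _ _ => false) (fun _ ih c acc int =>
    Bool.rec
     (force (Nat.mod c base) fun v => force (Nat.div v nf) fun w => force (Nat.mod w 81) fun q =>
      force (Nat.div w 81) fun r =>
      force (Nat.lor (Nat.shiftLeft 1 q)
        (Nat.shiftLeft 1 (Nat.add (Nat.mul 9 (Nat.mod q 9)) (Nat.div q 9)))) fun y =>
      forcePos (patternAt (entry T (Nat.div r 256)) (Nat.mod r 256)) fun e =>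
      force (relabel e S S9 (decodePerm S (Nat.mod v nf) n)) fun e' =>
      force (Nat.shiftLeft y 81) fun y' =>
      force (Nat.lor acc (Nat.lor (Nat.xor (Nat.lor e' y') y') y)) fun acc' =>
      force (Nat.land int (Nat.lor e' y)) fun int' =>
      force (Nat.div c base) fun c' => ih c' acc' int')
     (k acc int) (Nat.beq c 0)) f

/-- Check that a combination of replies answers all moves. -/
def checkPattern (acc int : ℕ) (k : ℕ → Bool) : Bool :=
  force (Nat.shiftRight acc 81) fun m =>
  Bool.rec false (Bool.rec false (k acc) (Nat.beq (Nat.shiftRight acc 162) 0))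
    (Nat.beq (Nat.lor (Nat.land int 2417851639229258349412351) m) m)

/-- Check a block of patterns. -/
def checkBlock (S S9 : List ℕ) (n nf base : ℕ) (T : List ℕ) (k : ℕ → Bool) (cs : List ℕ) :
    ℕ → Bool :=
  List.rec k (fun c _ ih b =>
    combine S S9 n nf base (b :: T) (fun acc int => checkPattern acc int fun e =>
      force (Nat.add (Nat.shiftLeft b 162) e) ih) 64 c 0
      5846006549323611672814739330865132078623730171903) cs

/-- Check a list of blocks of patterns. -/
def checkBlocks (S S9 : List ℕ) (n nf base : ℕ) (k : List ℕ → Bool) (bs : List (List ℕ)) :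
    List ℕ → Bool :=
  List.rec k (fun b _ ih T => checkBlock S S9 n nf base T (fun b' => ih (b' :: T)) b 0) bs

/-- Check a certificate for the game with `n` vertices. -/
def checkCertificate (S S9 : List ℕ) (n nf base : ℕ) (T : List ℕ) (bs : List (List ℕ))
    (last : ℕ) : Bool :=
  checkBlocks S S9 n nf base (fun T' => combine S S9 n nf base T' (fun acc int =>
    Nat.beq (Nat.shiftRight acc 81) 0 && !Nat.testBit int 1) 2 last 0
      5846006549323611672814739330865132078623730171903) bs T

end

theorem force_eq (x : ℕ) (f : ℕ → Bool) : force x f = f x := by cases x <;> rfl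

theorem forcePos_eq_true {x : ℕ} {f : ℕ → Bool} (h : forcePos x f = true) : x ≠ 0 ∧ f x = true := by
  cases x with
  | zero => simp [forcePos] at h
  | succ n => exact ⟨by simp, h⟩

theorem insertNth_perm (x : ℕ) (l : List ℕ) (i : ℕ) : (insertNth x l i).Perm (x :: l) := by
  induction l generalizing i with
  | nil => exact .refl _
  | cons a l ih =>
    cases i with
    | zero => exact .refl _
    | succ j => exact ((ih j).cons a).trans (List.Perm.swap ..)

theorem decodePerm_perm (l : List ℕ) (q k : ℕ) : (decodePerm l q k).Perm l := by
  induction l generalizing q k with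
  | nil => exact .refl _
  | cons x l ih => exact (insertNth_perm _ _ _).trans ((ih _ _).cons x)

theorem spread_cons (e mask k s d : ℕ) (S D : List ℕ) : spread e mask k (s :: S) (d :: D) =
    ((e >>> s) &&& mask) <<< (k * d) ||| spread e mask k S D := rfl

theorem testBit_spread {e mask k t : ℕ} {S : List ℕ} {f : ℕ → ℕ} {g : ℕ → ℕ} {s : ℕ} (hs : s ∈ S)
    (he : e.testBit (g s + t) = true) (hm : mask.testBit t = true) :
    (spread e mask k (S.map g) (S.map f)).testBit (k * f s + t) = true := by
  induction S with
  | nil => simp at hs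
  | cons a S ih =>
    rw [List.map_cons, List.map_cons, spread_cons, Nat.testBit_or, Bool.or_eq_true]
    rcases List.mem_cons.1 hs with rfl | hs
    · left
      simp [Nat.testBit_shiftLeft, Nat.testBit_and, Nat.testBit_shiftRight, he, hm]
    · exact .inr (ih hs)

theorem testBit_colMask : ∀ a < 9, ∀ k ∈ [0, 81],
    Nat.testBit 11440325928226245935058198299148986455232348673 (k + 9 * a) = true := by decide

theorem testBit_rowMask : ∀ a < 9, ∀ k ∈ [0, 81],
    Nat.testBit 1235522187646151016549712383 (k + a) = true := by decide

theorem testBit_relabel {e n k a b : ℕ} {π : ℕ → ℕ} (hn : n ≤ 9) (hπ : ∀ i < n, π i < n)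
    (hk : k ∈ [0, 81]) (ha : a < n) (hb : b < n) (h : e.testBit (k + (9 * a + b)) = true) :
    (relabel e (List.range n) ((List.range n).map (9 * ·)) ((List.range n).map π)).testBit
      (k + (9 * π a + π b)) = true := by
  have h1 := testBit_spread (e := e) (k := 1) (f := π) (g := id) (t := k + 9 * a)
    (List.mem_range.2 hb) (by rw [← h]; congr 1; simp; omega)
    (testBit_colMask a (by omega) k hk)
  rw [List.map_id] at h1
  have h2 := testBit_spread (k := 9) (f := π) (g := (9 * ·)) (t := k + π b)
    (List.mem_range.2 ha) (by rw [← h1]; congr 1; simp; omega)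
    (testBit_rowMask (π b) (by have := hπ b hb; omega) k hk)
  rw [relabel, ← h2]
  congr 1
  omega

theorem exists_bijOn_of_perm {n : ℕ} {D : List ℕ} (h : D.Perm (List.range n)) :
    ∃ π : ℕ → ℕ, D = (List.range n).map π ∧ Set.BijOn π (Set.Iio n) (Set.Iio n) := by
  have hlen : D.length = n := by simpa using h.length_eq
  have hD : D = (List.range n).map (fun i => D.getD i 0) := by
    refine List.ext_getElem (by simp [hlen]) fun i h1 h2 => ?_
    simp [List.getElem?_eq_getElem h1]
  refine ⟨_, hD, ?_, ?_, ?_⟩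
  · intro i hi
    have hi' : i < D.length := by rw [hlen]; exact hi
    have : D.getD i 0 ∈ D := by rw [List.getD_eq_getElem _ _ hi']; exact List.getElem_mem hi'
    simpa using h.mem_iff.1 this
  · have hnd : D.Nodup := h.nodup_iff.2 List.nodup_range
    rw [hD] at hnd
    intro i hi j hj hij
    exact List.inj_on_of_nodup_map hnd (List.mem_range.2 hi) (List.mem_range.2 hj) hij
  · intro j hj
    have : j ∈ D := h.mem_iff.2 (List.mem_range.2 hj)
    rw [hD] at this
    obtain ⟨i, hi, rfl⟩ := List.mem_map.1 this
    exact ⟨i, List.mem_range.1 hi, rfl⟩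

section

variable {V : Type*} {n : ℕ} {φ : ℕ → V}

theorem bitEdges_relabel (hn : n ≤ 9) {π : ℕ → ℕ} (hπ : Set.BijOn π (Set.Iio n) (Set.Iio n))
    {k : ℕ} (hk : k ∈ [0, 81]) (e : ℕ) : bitEdges n (φ ∘ π) k e ⊆ bitEdges n φ k
      (relabel e (List.range n) ((List.range n).map (9 * ·)) ((List.range n).map π)) := by
  rintro _ ⟨a, ha, b, hb, hab, h1, h2, rfl⟩
  exact ⟨π a, hπ.mapsTo ha, π b, hπ.mapsTo hb, hπ.injOn.ne ha hb hab,
    testBit_relabel hn (fun i hi => hπ.mapsTo hi) hk ha hb h1,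
    testBit_relabel hn (fun i hi => hπ.mapsTo hi) hk hb ha h2, rfl⟩

theorem bitEdges_mono {k k' m m' : ℕ}
    (h : ∀ i < 81, m.testBit (k + i) = true → m'.testBit (k' + i) = true) (hn : n ≤ 9) :
    bitEdges n φ k m ⊆ bitEdges n φ k' m' := by
  rintro _ ⟨a, ha, b, hb, hab, h1, h2, rfl⟩
  exact ⟨a, ha, b, hb, hab, h _ (by omega) h1, h _ (by omega) h2, rfl⟩

theorem bitEdges_subset_edges (hφ : Set.InjOn φ (Set.Iio n)) (k m : ℕ) :
    bitEdges n φ k m ⊆ edges V := by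
  rintro _ ⟨a, ha, b, hb, hab, -, -, rfl⟩
  exact fun h => hab (hφ ha hb (by simpa using h))

theorem mem_bitEdges_iff (hφ : Set.InjOn φ (Set.Iio n)) {k m a b : ℕ} (ha : a < n) (hb : b < n)
    (hab : a ≠ b) : s(φ a, φ b) ∈ bitEdges n φ k m ↔
      m.testBit (k + (9 * a + b)) = true ∧ m.testBit (k + (9 * b + a)) = true := by
  constructor
  · rintro ⟨a', ha', b', hb', -, h1, h2, heq⟩
    rcases Sym2.eq_iff.1 heq with ⟨h, h'⟩ | ⟨h, h'⟩
    · cases hφ ha ha' h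
      cases hφ hb hb' h'
      exact ⟨h1, h2⟩
    · cases hφ ha hb' h
      cases hφ hb ha' h'
      exact ⟨h2, h1⟩
  · rintro ⟨h1, h2⟩
    exact ⟨a, ha, b, hb, hab, h1, h2, rfl⟩

theorem exists_eq_of_mem_edges (hφ : Set.SurjOn φ (Set.Iio n) Set.univ) {x : Sym2 V}
    (hx : x ∈ edges V) : ∃ a < n, ∃ b < n, a ≠ b ∧ x = s(φ a, φ b) := by
  induction x with
  | _ p r =>
    obtain ⟨a, ha, rfl⟩ := hφ (Set.mem_univ p)
    obtain ⟨b, hb, rfl⟩ := hφ (Set.mem_univ r)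
    exact ⟨a, ha, b, hb, fun h => hx (by simp [h]), rfl⟩

/-- The number encoding the edge between `q / 9` and `q % 9`. -/
def edgeBits (q : ℕ) : ℕ := Nat.lor (Nat.shiftLeft 1 q)
  (Nat.shiftLeft 1 (Nat.add (Nat.mul 9 (Nat.mod q 9)) (Nat.div q 9)))

theorem testBit_edgeBits (q i : ℕ) :
    (edgeBits q).testBit i = true ↔ i = q ∨ i = 9 * (q % 9) + q / 9 := by
  change (1 <<< q ||| 1 <<< (9 * (q % 9) + q / 9)).testBit i = true ↔ _
  simp only [Nat.testBit_or, Nat.one_shiftLeft, Nat.testBit_two_pow, Bool.or_eq_true,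
    decide_eq_true_eq, eq_comm (a := i)]

theorem eq_of_testBit_edgeBits {q a b : ℕ} (hq : q < 81) (ha : a < 9) (hb : b < 9)
    (h : (edgeBits q).testBit (9 * a + b) = true) :
    s(φ a, φ b) = s(φ (q / 9), φ (q % 9)) := by
  rcases (testBit_edgeBits _ _).1 h with h | h
  · rw [show q / 9 = a by omega, show q % 9 = b by omega]
  · rw [show q / 9 = b by omega, show q % 9 = a by omega, Sym2.eq_swap]

theorem bitEdges_edgeBits_subsingleton {q : ℕ} (hn : n ≤ 9) (hq : q < 81) :
    (bitEdges n φ 0 (edgeBits q)).Subsingleton := by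
  rintro _ ⟨a, ha, b, hb, -, h1, -, rfl⟩ _ ⟨a', ha', b', hb', -, h1', -, rfl⟩
  rw [Nat.zero_add] at h1 h1'
  rw [eq_of_testBit_edgeBits hq (by omega) (by omega) h1,
    eq_of_testBit_edgeBits hq (by omega) (by omega) h1']

/-- The invariant of `combine`: the moves outside `int` have been answered. -/
def Answered (P : Set (Sym2 V) → Prop) (n acc int : ℕ) : Prop :=
  ∀ φ : ℕ → V, Set.BijOn φ (Set.Iio n) Set.univ → ∀ x ∉ bitEdges n φ 0 int, x ∈ edges V →
    ∃ Y M C : Set (Sym2 V), Y.Subsingleton ∧ Y ⊆ bitEdges n φ 0 acc ∧ x ∉ Y ∧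
      SecondWins P M (C \ M) ∧ M ⊆ bitEdges n φ 81 acc ∪ Y ∧ C ⊆ bitEdges n φ 0 acc ∧ x ∉ C

theorem answered_init (P : Set (Sym2 V) → Prop) (hn : n ≤ 9) :
    Answered P n 0 5846006549323611672814739330865132078623730171903 := by
  intro φ hφ x hx hxe
  refine absurd ?_ hx
  have hbit : ∀ i < 81,
      Nat.testBit 5846006549323611672814739330865132078623730171903 (0 + i) = true := by
    intro i hi
    rw [show 5846006549323611672814739330865132078623730171903 = 2 ^ 162 - 1 from by norm_num,
      Nat.testBit_two_pow_sub_one]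
    simp; omega
  obtain ⟨a, ha, b, hb, hab, rfl⟩ := exists_eq_of_mem_edges hφ.surjOn hxe
  exact ⟨a, ha, b, hb, hab, hbit _ (by omega), hbit _ (by omega), rfl⟩

theorem Answered.step {P : Set (Sym2 V) → Prop} {acc int : ℕ} (h : Answered P n acc int)
    (hn : n ≤ 9) {e q : ℕ} (he : ValidPattern P n e) (hq : q < 81) {D : List ℕ}
    (hD : D.Perm (List.range n)) {e' y y' : ℕ}
    (he' : e' = relabel e (List.range n) ((List.range n).map (9 * ·)) D) (hy : y = edgeBits q)
    (hy' : y' = y <<< 81) :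
    Answered P n (acc ||| (((e' ||| y') ^^^ y') ||| y)) (int &&& (e' ||| y)) := by
  intro φ hφ x hx hxe
  have hacc : ∀ k, bitEdges n φ k acc ⊆ bitEdges n φ k (acc ||| (((e' ||| y') ^^^ y') ||| y)) :=
    fun k => bitEdges_mono (fun i _ hi => by rw [Nat.testBit_or, hi]; rfl) hn
  by_cases hxi : x ∈ bitEdges n φ 0 int
  · obtain ⟨π, rfl, hπ⟩ := exists_bijOn_of_perm hD
    have hy'lo : ∀ i < 81, y'.testBit (0 + i) = false := by
      intro i hi
      rw [hy', Nat.testBit_shiftLeft]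
      simp
      omega
    have hlo : bitEdges n φ 0 e' ⊆ bitEdges n φ 0 (acc ||| (((e' ||| y') ^^^ y') ||| y)) :=
      bitEdges_mono (fun i hi h => by
        rw [Nat.testBit_or, Nat.testBit_or, Nat.testBit_xor, Nat.testBit_or, h, hy'lo i hi]
        simp) hn
    have hY : bitEdges n φ 0 y ⊆ bitEdges n φ 0 (acc ||| (((e' ||| y') ^^^ y') ||| y)) :=
      bitEdges_mono (fun i hi h => by rw [Nat.testBit_or, Nat.testBit_or, h]; simp) hn
    have hxn : x ∉ bitEdges n φ 0 e' ∧ x ∉ bitEdges n φ 0 y := by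
      obtain ⟨a, ha, b, hb, hab, h1, h2, rfl⟩ := hxi
      rw [mem_bitEdges_iff hφ.injOn ha hb hab] at hx ⊢
      rw [mem_bitEdges_iff hφ.injOn ha hb hab]
      simp only [Nat.testBit_and, Nat.testBit_or, h1, h2] at hx
      simp only [Bool.true_and, Bool.or_eq_true] at hx
      tauto
    have h81 : bitEdges n (φ ∘ π) 81 e ⊆ bitEdges n φ 81 e' := by
      rw [he']; exact bitEdges_relabel hn hπ (by simp) e
    have h0 : bitEdges n (φ ∘ π) 0 e ⊆ bitEdges n φ 0 e' := by
      rw [he']; exact bitEdges_relabel hn hπ (by simp) e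
    refine ⟨bitEdges n φ 0 y, _, _, ?_, hY, hxn.2, he (φ ∘ π) (hφ.comp hπ), ?_, h0.trans hlo,
      fun h => hxn.1 (h0 h)⟩
    · rw [hy]; exact bitEdges_edgeBits_subsingleton hn hq
    · refine h81.trans ?_
      rintro _ ⟨a, ha, b, hb, hab, h1, h2, rfl⟩
      by_cases hya : y.testBit (9 * a + b) = true ∨ y.testBit (9 * b + a) = true
      · right
        have hboth : y.testBit (9 * a + b) = true ∧ y.testBit (9 * b + a) = true := by
          simp only [hy, testBit_edgeBits] at hya ⊢
          omega
        exact ⟨a, ha, b, hb, hab, by simpa using hboth.1, by simpa using hboth.2, rfl⟩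
      · left
        rw [not_or, Bool.not_eq_true, Bool.not_eq_true] at hya
        have : ∀ i, y'.testBit (81 + i) = y.testBit i := fun i => by
          rw [hy', Nat.testBit_shiftLeft]; simp
        exact ⟨a, ha, b, hb, hab,
          by simp [Nat.testBit_or, Nat.testBit_xor, h1, this, hya.1],
          by simp [Nat.testBit_or, Nat.testBit_xor, h2, this, hya.2], rfl⟩
  · obtain ⟨Y, M, C, h1, h2, h3, h4, h5, h6, h7⟩ := h φ hφ x hxi hxe
    exact ⟨Y, M, C, h1, h2.trans (hacc 0), h3, h4,
      h5.trans (Set.union_subset_union_left _ (hacc 81)), h6.trans (hacc 0), h7⟩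

theorem SecondWins.union {X : Type*} {P : Set X → Prop} (hP : Monotone P) {M F : Set X}
    (h : SecondWins P M F) : P (M ∪ F) := by
  induction h with
  | done h => exact hP Set.subset_union_left h
  | @step M F N hF hN _ ih =>
    obtain ⟨x, hx⟩ := hF
    refine hP ?_ (ih x hx)
    rintro z ((h | h) | h)
    exacts [.inl h, .inr ((hN x hx).1 h).1, .inr h.1.1]

theorem Answered.validPattern {P : Set (Sym2 V) → Prop} (hP : Monotone P) {acc int : ℕ}
    (h : Answered P n acc int) (hn : n ≤ 9) (hall : P (edges V))
    (hint : (int &&& 2417851639229258349412351) ||| (acc >>> 81) = acc >>> 81) :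
    ValidPattern P n acc := by
  intro φ hφ
  have hsub : bitEdges n φ 0 int ⊆ bitEdges n φ 81 acc := bitEdges_mono (fun i hi hb => by
    have := congrArg (Nat.testBit · i) hint
    rw [Nat.zero_add] at hb
    simp only [Nat.testBit_or, Nat.testBit_and, Nat.testBit_shiftRight, hb] at this
    rw [show 2417851639229258349412351 = 2 ^ 81 - 1 from by norm_num,
      Nat.testBit_two_pow_sub_one] at this
    simpa [hi] using this) hn
  rcases (bitEdges n φ 0 acc \ bitEdges n φ 81 acc).eq_empty_or_nonempty with hF | hF
  · by_cases hex : ∃ x ∈ edges V, x ∉ bitEdges n φ 0 int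
    · obtain ⟨x, hxe, hx⟩ := hex
      obtain ⟨Y, M, C, -, hY, -, hw, hM, hC, -⟩ := h φ hφ x hx hxe
      have hle : bitEdges n φ 0 acc ⊆ bitEdges n φ 81 acc := Set.sdiff_eq_empty.1 hF
      exact hw.mono hP (hM.trans (Set.union_subset subset_rfl (hY.trans hle)))
        fun z hz => .inl (hle (hC hz.1))
    · push Not at hex
      exact .done (hP (fun x hx => hsub (hex x hx)) hall)
  · refine .of_reply hP hF fun x hx => ?_
    obtain ⟨Y, M, C, hYs, hY, hxY, hw, hM, hC, hxC⟩ :=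
      h φ hφ x (fun h => hx.2 (hsub h)) (bitEdges_subset_edges hφ.injOn _ _ hx.1)
    refine ⟨Y, hYs, fun z hz => ?_, hxY, hw.mono hP hM fun z hz => ?_⟩
    · by_cases hz' : z ∈ bitEdges n φ 81 acc
      exacts [.inl hz', .inr ⟨hY hz, hz'⟩]
    · by_cases hz' : z ∈ bitEdges n φ 81 acc
      · exact .inl (.inl hz')
      · refine .inr ⟨⟨hC hz.1, hz'⟩, ?_⟩
        rintro rfl
        exact hxC hz.1

end

section

variable {V : Type*} {P : Set (Sym2 V) → Prop} {n : ℕ}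

/-- All patterns of a block are won by the player who moves second. -/
def ValidBlock (P : Set (Sym2 V) → Prop) (n b : ℕ) : Prop :=
  ∀ j, patternAt b j ≠ 0 → ValidPattern P n (patternAt b j)

theorem patternAt_eq (b j : ℕ) : patternAt b j = b / 2 ^ (162 * j) % 2 ^ 162 := by
  change (b >>> (162 * j)) % _ = _
  rw [Nat.shiftRight_eq_div_pow]
  norm_num

theorem validBlock_zero : ValidBlock P n 0 := fun j h => absurd (by simp [patternAt_eq]) h

theorem ValidBlock.push {b e : ℕ} (hb : ValidBlock P n b) (he : ValidPattern P n e)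
    (hlt : e < 2 ^ 162) : ValidBlock P n (Nat.add (Nat.shiftLeft b 162) e) := by
  have heq : Nat.add (Nat.shiftLeft b 162) e = e + 2 ^ 162 * b := by
    change b <<< 162 + e = _
    rw [Nat.shiftLeft_eq]; ring
  rw [heq]
  rintro (_ | j) h
  · rw [patternAt_eq] at h ⊢
    rw [Nat.mul_zero, pow_zero, Nat.div_one, Nat.add_mul_mod_self_left, Nat.mod_eq_of_lt hlt]
    exact he
  · have : patternAt (e + 2 ^ 162 * b) (j + 1) = patternAt b j := by
      rw [patternAt_eq, patternAt_eq, show 162 * (j + 1) = 162 + 162 * j by ring, pow_add,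
        ← Nat.div_div_eq_div_mul, Nat.add_mul_div_left _ _ (by positivity), Nat.div_eq_of_lt hlt,
        Nat.zero_add]
    rw [this] at h ⊢
    exact hb j h

theorem ValidPattern.validBlock {e : ℕ} (he : ValidPattern P n e) (hlt : e < 2 ^ 162) :
    ValidBlock P n e := by
  have := validBlock_zero.push he hlt
  rwa [show Nat.add (Nat.shiftLeft 0 162) e = e by
    change 0 <<< 162 + e = e
    simp] at this

theorem validBlock_entry {T : List ℕ} (hT : ∀ b ∈ T, ValidBlock P n b) (i : ℕ) :
    ValidBlock P n (entry T i) := by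
  induction T generalizing i with
  | nil => exact validBlock_zero
  | cons a T ih =>
    rw [List.forall_mem_cons] at hT
    cases i with
    | zero => exact hT.1
    | succ i => exact ih hT.2 i

theorem combine_sound (hn : n ≤ 9) {nf base : ℕ} {T : List ℕ} (hT : ∀ b ∈ T, ValidBlock P n b)
    {k : ℕ → ℕ → Bool} {f c acc int : ℕ} (h : Answered P n acc int)
    (hc : combine (List.range n) ((List.range n).map (9 * ·)) n nf base T k f c acc int = true) :
    ∃ acc' int', Answered P n acc' int' ∧ k acc' int' = true := by
  induction f generalizing c acc int with
  | zero => exact absurd hc Bool.false_ne_true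
  | succ f ih =>
    unfold combine at hc
    dsimp only at hc
    cases hb : Nat.beq c 0 with
    | true =>
      rw [hb] at hc
      exact ⟨acc, int, h, hc⟩
    | false =>
      rw [hb] at hc
      dsimp only at hc
      iterate 5 rw [force_eq] at hc
      obtain ⟨he, hc⟩ := forcePos_eq_true hc
      iterate 5 rw [force_eq] at hc
      have h' := h.step hn (validBlock_entry hT _ _ he)
        (q := Nat.mod (Nat.div (Nat.mod c base) nf) 81) (Nat.mod_lt _ (by norm_num))
        (decodePerm_perm (List.range n) (Nat.mod (Nat.mod c base) nf) n) rfl rfl rfl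
      exact ih (c := Nat.div c base) h' hc

theorem checkPattern_sound {acc int : ℕ} {k : ℕ → Bool} (h : checkPattern acc int k = true) :
    (int &&& 2417851639229258349412351) ||| (acc >>> 81) = acc >>> 81 ∧ acc < 2 ^ 162 ∧
      k acc = true := by
  unfold checkPattern at h
  rw [force_eq] at h
  cases h1 : Nat.beq (Nat.lor (Nat.land int 2417851639229258349412351) (Nat.shiftRight acc 81))
      (Nat.shiftRight acc 81) with
  | false => rw [h1] at h; exact absurd h Bool.false_ne_true
  | true =>
    rw [h1] at h
    cases h2 : Nat.beq (Nat.shiftRight acc 162) 0 with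
    | false => rw [h2] at h; exact absurd h Bool.false_ne_true
    | true =>
      rw [h2] at h
      refine ⟨Nat.eq_of_beq_eq_true h1, ?_, h⟩
      have h2 : acc >>> 162 = 0 := Nat.eq_of_beq_eq_true h2
      rw [Nat.shiftRight_eq_div_pow] at h2
      exact (Nat.div_eq_zero_iff_lt (by positivity)).1 h2

theorem checkBlock_sound (hP : Monotone P) (hall : P (edges V)) (hn : n ≤ 9) {nf base : ℕ}
    {T : List ℕ} (hT : ∀ b ∈ T, ValidBlock P n b) {k : ℕ → Bool} {cs : List ℕ} {b : ℕ}
    (hb : ValidBlock P n b)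
    (h : checkBlock (List.range n) ((List.range n).map (9 * ·)) n nf base T k cs b = true) :
    ∃ b', ValidBlock P n b' ∧ k b' = true := by
  induction cs generalizing b with
  | nil => exact ⟨b, hb, h⟩
  | cons c cs ih =>
    unfold checkBlock at h
    dsimp only at h
    obtain ⟨acc, int, ha, hk⟩ := combine_sound hn (List.forall_mem_cons.2 ⟨hb, hT⟩)
      (answered_init P hn) h
    obtain ⟨h1, h2, h3⟩ := checkPattern_sound hk
    rw [force_eq] at h3
    exact ih (hb.push (ha.validPattern hP hn hall h1) h2) h3

theorem checkBlocks_sound (hP : Monotone P) (hall : P (edges V)) (hn : n ≤ 9) {nf base : ℕ}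
    {T : List ℕ} (hT : ∀ b ∈ T, ValidBlock P n b) {k : List ℕ → Bool} {bs : List (List ℕ)}
    (h : checkBlocks (List.range n) ((List.range n).map (9 * ·)) n nf base k bs T = true) :
    ∃ T', (∀ b ∈ T', ValidBlock P n b) ∧ k T' = true := by
  induction bs generalizing T with
  | nil => exact ⟨T, hT, h⟩
  | cons b bs ih =>
    obtain ⟨b', hb', hk⟩ := checkBlock_sound hP hall hn hT validBlock_zero h
    exact ih (List.forall_mem_cons.2 ⟨hb', hT⟩) hk

theorem exists_labelling (hn : 0 < n) (hV : Nat.card V = n) :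
    ∃ φ : ℕ → V, Set.BijOn φ (Set.Iio n) Set.univ := by
  have : Finite V := Nat.finite_of_card_ne_zero (by omega)
  let f : Fin n ≃ V := (Finite.equivFinOfCardEq hV).symm
  refine ⟨fun i => if h : i < n then f ⟨i, h⟩ else f ⟨0, hn⟩, fun _ _ => trivial, ?_, ?_⟩
  · intro i hi j hj hij
    simp only [Set.mem_Iio] at hi hj
    simpa [hi, hj] using hij
  · intro v _
    exact ⟨f.symm v, (f.symm v).2, by simp⟩

theorem bijOn_comp_swap {φ : ℕ → V} (hφ : Set.BijOn φ (Set.Iio n) Set.univ) {i j : ℕ} (hi : i < n)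
    (hj : j < n) : Set.BijOn (φ ∘ Equiv.swap i j) (Set.Iio n) Set.univ := by
  refine hφ.comp ((Equiv.swap i j).bijOn fun a => ?_)
  simp only [Set.mem_Iio, Equiv.swap_apply_def]
  split_ifs <;> omega

theorem exists_labelling_of_edge (hn : 2 ≤ n) (hV : Nat.card V = n) {x : Sym2 V}
    (hx : x ∈ edges V) :
    ∃ φ : ℕ → V, Set.BijOn φ (Set.Iio n) Set.univ ∧ x = s(φ 0, φ 1) := by
  obtain ⟨φ, hφ⟩ := exists_labelling (by omega) hV
  obtain ⟨a, ha, b, hb, hab, rfl⟩ := exists_eq_of_mem_edges hφ.surjOn hx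
  have h1 := bijOn_comp_swap hφ (i := 0) (by omega) ha
  obtain ⟨b', hb', hbb⟩ := h1.surjOn (Set.mem_univ (φ b))
  have hb0 : b' ≠ 0 := by
    rintro rfl
    rw [Function.comp_apply, Equiv.swap_apply_left] at hbb
    exact hab (hφ.injOn ha hb hbb)
  refine ⟨_, bijOn_comp_swap h1 (i := 1) (by omega) hb', ?_⟩
  simp only [Function.comp_apply, Equiv.swap_apply_left] at hbb ⊢
  rw [Equiv.swap_apply_of_ne_of_ne zero_ne_one hb0.symm, Equiv.swap_apply_left, hbb]

theorem secondWins_of_checkCertificate (hP : Monotone P) (hn : 2 ≤ n) (hn' : n ≤ 9)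
    (hV : Nat.card V = n) {nf base : ℕ} {T : List ℕ} {bs : List (List ℕ)} {last : ℕ}
    (hne : T ≠ []) (hT : ∀ e ∈ T, e < 2 ^ 162 ∧ ValidPattern P n e)
    (h : checkCertificate (List.range n) ((List.range n).map (9 * ·)) n nf base T bs last = true) :
    SecondWins P ∅ (edges V) := by
  have hall : P (edges V) := by
    obtain ⟨e, he⟩ := List.exists_mem_of_ne_nil T hne
    obtain ⟨φ, hφ⟩ := exists_labelling (by omega) hV
    exact hP (Set.union_subset (bitEdges_subset_edges hφ.injOn _ _)
      (Set.sdiff_subset.trans (bitEdges_subset_edges hφ.injOn _ _))) (((hT e he).2 φ hφ).union hP)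
  obtain ⟨T', hT', hk⟩ := checkBlocks_sound hP hall hn'
    (fun e he => (hT e he).2.validBlock (hT e he).1) h
  obtain ⟨acc, int, ha, hk⟩ := combine_sound hn' hT' (answered_init P hn') hk
  rw [Bool.and_eq_true, Bool.not_eq_true'] at hk
  have hacc : acc >>> 81 = 0 := Nat.eq_of_beq_eq_true hk.1
  obtain ⟨φ₀, hφ₀⟩ := exists_labelling (by omega) hV
  refine .of_reply hP ⟨s(φ₀ 0, φ₀ 1), ?_⟩ fun x hx => ?_
  · intro h
    exact zero_ne_one (hφ₀.injOn (show 0 < n by omega) (show 1 < n by omega) (by simpa using h))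
  · obtain ⟨φ, hφ, rfl⟩ := exists_labelling_of_edge hn hV hx
    obtain ⟨Y, M, C, hYs, hY, hxY, hw, hM, hC, hxC⟩ := ha φ hφ s(φ 0, φ 1) (by
      rw [mem_bitEdges_iff hφ.injOn (by omega) (by omega) zero_ne_one]
      simp [hk.2]) hx
    refine ⟨Y, hYs, fun z hz => .inr (bitEdges_subset_edges hφ.injOn _ _ (hY hz)), hxY,
      hw.mono hP (hM.trans ?_) ?_⟩
    · refine Set.union_subset_union_left _ ?_
      rintro _ ⟨a, -, b, -, -, h1, -, -⟩
      rw [← Nat.testBit_shiftRight, hacc] at h1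
      simp at h1
    · rintro z hz
      refine .inr ⟨bitEdges_subset_edges hφ.injOn _ _ (hC hz.1), ?_⟩
      rintro rfl
      exact hxC hz.1

end

section

variable {V : Type*} {n : ℕ}

theorem validPattern_hasHam_of_isChain {e a : ℕ} {t : List ℕ} (hl : (a :: t).Perm (List.range n))
    (hch : (a :: (t ++ [a])).IsChain fun a b => a ≠ b ∧ e.testBit (81 + (9 * a + b)) = true ∧
      e.testBit (81 + (9 * b + a)) = true) : ValidPattern (HasHam (V := V)) n e := by
  intro φ hφ
  refine .done ⟨(a :: t).map φ, ?_, fun v => ?_, ?_⟩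
  · refine List.Nodup.map_on (fun i hi j hj hij => ?_) (hl.nodup_iff.2 List.nodup_range)
    exact hφ.injOn (List.mem_range.1 (hl.mem_iff.1 hi)) (List.mem_range.1 (hl.mem_iff.1 hj)) hij
  · obtain ⟨i, hi, rfl⟩ := hφ.surjOn (Set.mem_univ v)
    exact List.mem_map_of_mem (hl.mem_iff.2 (List.mem_range.2 hi))
  · rw [List.map_cons, Cycle.chain_coe_cons, ← List.map_singleton, ← List.map_append,
      ← List.map_cons, List.isChain_map]
    have hlt : ∀ i ∈ a :: (t ++ [a]), i < n := fun i hi =>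
      List.mem_range.1 (hl.mem_iff.1 (by simpa [or_comm] using hi))
    refine List.IsChain.imp_of_mem_imp (fun i j hi hj h => ?_) hch
    exact ⟨i, hlt i hi, j, hlt j hj, h.1, h.2.1, h.2.2, rfl⟩

/-- There is no path for `adj` from `cur` through all elements of `rem` to `s`. -/
def noPath (adj : ℕ → ℕ → Bool) (s : ℕ) : ℕ → ℕ → List ℕ → Bool
  | 0, cur, _ => !adj cur s
  | f + 1, cur, rem => rem.all fun v => !adj cur v || noPath adj s f v (rem.erase v)

theorem not_isChain_of_noPath {adj : ℕ → ℕ → Bool} {s f cur : ℕ} {rem p : List ℕ}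
    (hf : rem.length = f) (hp : p.Perm rem) (h : noPath adj s f cur rem = true) :
    ¬ (cur :: (p ++ [s])).IsChain fun a b => adj a b = true := by
  induction f generalizing cur rem p with
  | zero =>
    rw [List.length_eq_zero_iff] at hf
    subst hf
    rw [List.perm_nil] at hp
    subst hp
    simpa [noPath] using h
  | succ f ih =>
    cases p with
    | nil => simp [← hp.length_eq] at hf
    | cons v p =>
      rw [List.cons_append, List.isChain_cons_cons]
      rintro ⟨hv, hch⟩
      have hmem : v ∈ rem := hp.mem_iff.1 (by simp)
      have := List.all_eq_true.1 h v hmem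
      rw [hv] at this
      refine ih (by rw [List.length_erase_of_mem hmem, hf]; rfl) ?_ (by simpa using this) hch
      simpa using hp.erase v

theorem validPattern_noHam_of_noPath {e : ℕ} {t : List ℕ} (hl : (0 :: t).Perm (List.range n))
    (h : noPath (fun a b => !(e.testBit (81 + (9 * a + b)) && e.testBit (81 + (9 * b + a)))) 0
      t.length 0 t = true) : ValidPattern (NoHam (V := V)) n e := by
  intro φ hφ
  refine .done ?_
  rintro ⟨l, hnd, hmem, hch⟩
  have hn : 0 < n := List.mem_range.1 (hl.mem_iff.1 (by simp))
  choose ψ hψn hψ using fun v => hφ.surjOn (Set.mem_univ v)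
  have hψinj : Function.Injective ψ := Function.LeftInverse.injective hψ
  have hψ0 : ψ (φ 0) = 0 := hφ.injOn (hψn _) hn (hψ _)
  obtain ⟨p, hp, hperm⟩ := exists_rotation (hmem (φ 0))
  rw [hp, Cycle.chain_coe_cons] at hch
  refine not_isChain_of_noPath (p := p.map ψ) rfl ?_ h ?_
  · have h1 : ((φ 0 :: p).map ψ).Perm (List.range n) := by
      refine (List.perm_ext_iff_of_nodup ((hperm.nodup_iff.1 hnd).map hψinj)
        List.nodup_range).2 fun i => ?_
      rw [List.mem_range, List.mem_map]
      constructor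
      · rintro ⟨v, -, rfl⟩
        exact hψn v
      · exact fun hi => ⟨φ i, hperm.mem_iff.1 (hmem _), hφ.injOn (hψn _) hi (hψ _)⟩
    rw [List.map_cons, hψ0] at h1
    exact (List.perm_cons 0).1 (h1.trans hl.symm)
  · have h1 : ((φ 0 :: (p ++ [φ 0])).map ψ) = 0 :: (p.map ψ ++ [0]) := by simp [hψ0]
    rw [← h1, List.isChain_map]
    refine hch.imp fun v w hvw => ?_
    rw [Bool.not_eq_true', Bool.eq_false_iff, Ne, Bool.and_eq_true]
    rintro ⟨h2, h3⟩
    refine hvw.2 ⟨ψ v, hψn v, ψ w, hψn w, fun h => hvw.1 (by simp [hψinj h]), h2, h3, ?_⟩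
    rw [hψ, hψ]

theorem validPattern_noHam_of_forall_noPath {T : List ℕ} (hn : 0 < n)
    (h : T.all (fun e => Nat.blt e (2 ^ 162) &&
      noPath (fun a b => !(e.testBit (81 + (9 * a + b)) && e.testBit (81 + (9 * b + a)))) 0
        (n - 1) 0 (List.range' 1 (n - 1))) = true) :
    ∀ e ∈ T, e < 2 ^ 162 ∧ ValidPattern (NoHam (V := V)) n e := by
  obtain ⟨m, rfl⟩ : ∃ m, n = m + 1 := ⟨n - 1, by omega⟩
  intro e he
  have h := List.all_eq_true.1 h e he
  rw [Bool.and_eq_true] at h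
  have hl : 0 :: List.range' 1 m = List.range (m + 1) := by
    rw [List.range_eq_range', List.range'_succ]
  exact ⟨by simpa using h.1, validPattern_noHam_of_noPath (t := List.range' 1 m) (hl ▸ List.Perm.refl _)
    (by simpa using h.2)⟩

end

set_option maxRecDepth 1000000

/-- Combinations of replies for `3` vertices. -/
def noHamCertificateThree : List (List ℕ) := [
]

theorem checkCertificate_noHam_three : checkCertificate [0, 1, 2] [0, 9, 18] 3
  6 13
  [0x8000800000000000000000000]
  noHamCertificateThree 0xc = true := by decide +kernel

theorem secondWins_noHam_three {V : Type*} (hV : Nat.card V = 3) :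
    SecondWins NoHam ∅ (edges V) :=
  secondWins_of_checkCertificate noHam_mono (by norm_num) (by norm_num) hV
    (List.cons_ne_nil _ _) (validPattern_noHam_of_forall_noPath (by norm_num) (by decide +kernel))
    checkCertificate_noHam_three

/-- Combinations of replies for `4` vertices. -/
def noHamCertificateFour : List (List ℕ) := [
[0x39ae39a164]]

theorem checkCertificate_noHam_four : checkCertificate [0, 1, 2, 3] [0, 9, 18, 27] 4
  24 497737
  [0x5040001000000000000000000000]
  noHamCertificateFour 0x1f8 = true := by decide +kernel

theorem secondWins_noHam_four {V : Type*} (hV : Nat.card V = 4) :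
    SecondWins NoHam ∅ (edges V) :=
  secondWins_of_checkCertificate noHam_mono (by norm_num) (by norm_num) hV
    (List.cons_ne_nil _ _) (validPattern_noHam_of_forall_noPath (by norm_num) (by decide +kernel))
    checkCertificate_noHam_four

/-- Combinations of replies for `5` vertices. -/
def noHamCertificateFive : List (List ℕ) := [
[0x5a2abb19da9,
0x2fc90650]]

theorem checkCertificate_noHam_five : checkCertificate [0, 1, 2, 3, 4] [0, 9, 18, 27, 36] 5
  120 2489761
  [0x1016040200000000000000000000000]
  noHamCertificateFive 0x9d8 = true := by decide +kernel

theorem secondWins_noHam_five {V : Type*} (hV : Nat.card V = 5) :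
    SecondWins NoHam ∅ (edges V) :=
  secondWins_of_checkCertificate noHam_mono (by norm_num) (by norm_num) hV
    (List.cons_ne_nil _ _) (validPattern_noHam_of_forall_noPath (by norm_num) (by decide +kernel))
    checkCertificate_noHam_five

/-- Combinations of replies for `6` vertices. -/
def noHamCertificateSix : List (List ℕ) := [
[0x1959fbd90ef5f,
0x32b58b505e902,
0x1107dae5df,
0x16cfb14f530735a4be38a3f,
0x18fc86e3afbcbb2619c475b0e2e58443349b8a94dee27f009f9050]]

theorem checkCertificate_noHam_six : checkCertificate [0, 1, 2, 3, 4, 5] [0, 9, 18, 27, 36, 45] 6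
  720 29867791
  [0x201036040200000000000000000000000,
  0x380026140a00000000000000000000000]
  noHamCertificateSix 0x3b10 = true := by decide +kernel

theorem secondWins_noHam_six {V : Type*} (hV : Nat.card V = 6) :
    SecondWins NoHam ∅ (edges V) :=
  secondWins_of_checkCertificate noHam_mono (by norm_num) (by norm_num) hV
    (List.cons_ne_nil _ _) (validPattern_noHam_of_forall_noPath (by norm_num) (by decide +kernel))
    checkCertificate_noHam_six

/-- Combinations of replies for `7` vertices. -/
def noHamCertificateSeven : List (List ℕ) := [
[0x1d1fab1905a3b00,
0x75e5777c1190,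
0x3a3cd2142f74770,
0x92a6c843a470,
0x1d1dbd0860bc92b,
0xb808cf1e037,
0x1a8540282e918ce5360ed26eaa9f2d276cd,
0xe911623f92f467,
0x1fa185257012,
0x2370bac4867883e305399b42a9331e653e6,
0x3a43d58fd7d3a95,
0x75e56b06bac2,
0xb8099673a72,
0x17e0cbb92ab7f58649b07b670d2b66a8b36dda04bf45fecd7f,
0xa2855e1f01958,
0x5924332adea0,
0x2281a6d2e7a0,
0xe91315caf90673,
0x92a6d4b9b5a0,
0x68960de7ad784,
0x703a46aafc87a54b0a28a5c1c1d7867c0b780ca698,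
0x5759f91020a9a66,
0x2cda3d103e33d2c361b409eae78f,
0x5761296519be950,
0x2b220bdb93b0,
0xdcc52b7b4d6cc2e859b4ee88db571b31bfc2ba9c59,
0x4369e92ba91f1,
0xaa03343b748e080e059dc556db0,
0x2bad366d6e1e6c4,
0x495931602e9d4533c956,
0x27adade0bf372a418e6472a90991bfa4c046703679075ae8acc317249,
0x22ea1ba438d08b5c41a8180e5230,
0x2bae27f74fe1d7a,
0x1413bb4a900c3191add4e6d55431,
0x2cd77e5470608093e4842ae26713,
0x41276ab8ab139d23536beeb63c829d7bae0ba455192bfcb35c8146f36,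
0x1ebe9f4f7a6104f1d64a1dfe0112,
0x255cbcad2f0974ebce3a862e5ee0,
0x8be1ffaae588756c73fe50613ebcc81b8aaf476b25,
0x4cd7582d98a9a3987bb77e6fbff38056b44018190891aed0f582bfc62,
0x4613e9da693abfea511e9d2795a9770a4364ef45c41714e4451c0c7fbd685016788c18d,
0x714a68741481c2ceac1c9d5671c19b9d561f1744b8dca21cdd158f1052fb0f9f4da35aa80d1161acbfa1b4ced358a84058d902248bd2317018fec9abcbe180eb655a3e7a]]

theorem checkCertificate_noHam_seven : checkCertificate [0, 1, 2, 3, 4, 5, 6] [0, 9, 18, 27, 36, 45, 54] 7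
  5040 627313681
  [0x1e150d054340000000000000000000000000,
  0xa050d414350500000000000000000000000,
  0x20100004358100800000000000000000000,
  0x1e1109056350300000000000000000000000,
  0x70000046251300000000000000000000000,
  0x171100044351100000000000000000000000]
  noHamCertificateSeven 0x19d70 = true := by decide +kernel

theorem secondWins_noHam_seven {V : Type*} (hV : Nat.card V = 7) :
    SecondWins NoHam ∅ (edges V) :=
  secondWins_of_checkCertificate noHam_mono (by norm_num) (by norm_num) hV
    (List.cons_ne_nil _ _) (validPattern_noHam_of_forall_noPath (by norm_num) (by decide +kernel))
    checkCertificate_noHam_seven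

/-- Combinations of replies for `8` vertices. -/
def hasHamCertificateEight : List (List ℕ) := [
[0x1d21152a192d6ba0,
0x7e7c327460d30,
0xb7fa76864a478,
0x57110f207bfc6,
0x1d1d21f57ff6ead8,
0xb7fa7685ddff0,
0x5bfd3cd2d4c78,
0xbe45a87c353d5c,
0x227ef8c305940,
0x3c4ed0b3d00b44146f7d120c49d880,
0x13c270d4ae3bfe687f9534c5c3ccaf427cad5e,
0x5f4337a13eced6,
0xb7fa76857c488,
0x563d6936e2b78,
0xcd97077d5b420e,
0x563d6935d89f8,
0x1d1fb5b9c7152b70,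
0xb7fa7685191f8,
0x227ef8c1f09f8,
0x31e38a4df9daa7c6afe046bf7bcca6,
0x5eecc9c1080483,
0x227ef8c0c11c0,
0x1d268fed18730140,
0x563d6936df270,
0x7e7c3274f1540,
0x6a70bd548eed5a6561a99e,
0x21854d83f67b0c,
0xf255bb00230c2ad006e2d379f5cb41,
0x316494e6db1189c,
0x227ef8c1f09f8,
0x1d1cd83d69916810,
0x563d6936e2b78,
0xb7faa5409278,
0x1ee09688d601e2c531fbfe0,
0x5cc48937ad2108,
0xebb8e6fa79740,
0xb7faa5400f40,
0x77a297e7fa36be1dfca38ca0d3860,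
0x74b17adc312db08ac45bb7ea3eb7fe,
0x15ee794702e6e0abac69eb6,
0xb7073b82ef9eae6943d9a2d6e2dd94a18fb5a2fe58fa220c99751d5a95ae7642ffdcf0441d033,
0x125c2b087c72017,
0xebb8e6fb39848,
0xd6e87cda0e8932c2b9b8,
0x1f3c552c942723fb0586575,
0x50d2ea0935e3c57,
0x563d693611428,
0xebb8e6fa6b3b0,
0x17e6d871c83eecc31a0b67,
0x1242403c5dd7788dc4ea65,
0x3a1cf0606f953d325188d3,
0x1062c85963b2b28dffdf9cc79c409cb,
0x237bbb4357942d8b50e9ef8,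
0x1088dbab99e2956684c6e44d413e019,
0x1fff320a4976861f061f6fb736a671650f044395e2ae9bfa5180eb33eb3e530fc73377fe23f80,
0x2a90cefc3e27a77,
0x15eb56ca91c7e2,
0xee78f325f7abbf55cb75af,
0x1281866ba0ae696858ce6990c71abe227eb466f,
0x18dc7e15638fefdaae53858d580671c,
0x305f7b0afe117a8332187e2,
0x298387a6b5ba47bf67ee9e5,
0x6c129a9ad6bd2e3,
0x1f428708c741d34a047dd4b9e4f3093729343653d338f7c03ba2,
0x172505bb79860adf152701149ced881,
0x17b1fa2e251dbf3b3d578e6,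
0x395455035e8d5de,
0x19388422f311862929de46fd607157e,
0x345bc6e07815d145fb36aa7,
0x29fd425e673ac5f4f9953d8,
0x4779ff177df652fcb736986,
0x17930504fe7d2ec1b43bba328abe77bef1e8714f44278c425d8d8aa2eba814,
0x29ff85b9881f5bd97ca1e91,
0x1ffa84012b68faa1edfa1f2,
0x443f10210e452bc182f9ca2869aefe5220886eeb75de41ded6bc2d6666d2f54d1026,
0xb54aa312b81ccf325dcc3b423af68d,
0x30fa10b3f91cee107d42835,
0x24accd54e634df45865412e,
0x3983663263f640ee692c873c4d83f4e4b94c9a9140b9a409fabb3a,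
0x347f01881aa2a4e9277d1ec,
0x4d9fd5a094f5386c911ff27,
0x52f48eb5806b9dad3ab6c71,
0x3fce112e905183ccf35ddfe,
0x2aeeac79d7cf6795a41974c,
0x16f75341909827a14504dcf907548d34aa7a0cfa397ac01d02c9235c87d4c0a38fd34d6ae82c9,
0x998de487c354ad9,
0x12af6fea5ed9f8,
0x1550af473d4036d2e063a11,
0x1c19561a46b3e366515abea69b37951870860e2e1ee08,
0x1124ca93c2924c7b63ae136836cb53bf978a5195352a88,
0xdeb91c967a0df1e284dbf81ffcb5efc3c3c955,
0x2936ecca70a24b15bedcdd55d771a91,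
0x4acd426fbce0049e99bb7b7,
0x54ec92d2139e00566523db80c6055004a89f55a57d35fb,
0x13e75be523445e2d9a7ddc76c07fbbe0a2099f473cd7f3affc49cd,
0x9a8c804c059d7c6eef28df5b01b6fcf971ff5a,
0x5ed8e8c19e55aa69824833a,
0x63f0aaf84d1aadd6ee06b01,
0x38b73e3ca623b3bf2f2277be079d21b,
0x5946fa0f551f9c7e2c5eb36,
0x93dfb42575e79b8a7fef588bfd496ccb9a625455c904432b707539,
0x545c05ed2a947c904776810,
0x6509ab35634eb9332866385,
0x7cac5405f72777f70e62ad00ed0afd31026ac0adeee338e7709e86,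
0x5767106ad47db8179040da3,
0x286676fc56ed449389da6f7,
0x44d7582489bbcabdf0f15a1d44d6ccf60aa99615195371db2786afd01611c3cd2ec8,
0x6accdeaef83e175939408a0,
0x9f650e054072144b9af522cfdd031fcc17b322f809b74d,
0x3dc7f7667765625d4f1a3dd4b2d4da9c344e05,
0x7a28d4fa8703ed04edcb3d16c5d8783c0e1346a4e83274,
0x6eea2bf781c962082b5e67a,
0x1451cf11fd05ce677bf1c47f2724fd0b4dcbf781c78dd200ced76,
0x16943a70fb2bf7edb5267fa973d54bd3e85da8a46131295730fde447f1fd47f7a2ce9fd08a88f8e38dd8cab754bdbc0982fb8312224697d1dfac3790d6a946f6565e5a89433baab71a00,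
0x763671c2ae3391a94cfb8ce,
0x73067719ef940eed3227e9c,
0x1ecf611f0a9263dd26586c27db09402,
0x3cd4b085820a57df58850f79dbecade,
0x60e7d56560549958d8e0987aee5ef513ffe2f6f888182bcf39ff1,
0xcc7e46c06102b35,
0xae9ce2889484abd764da1,
0x4f2ea667ce15e53cb2f0f2c,
0x7eb946a619e4c8847e53faa,
0x268ba3e72380f5a64e8d26c,
0x2768e30e5f87a893fe96e2e,
0x8229fb4c116ce9990c34e96,
0x78dda47e8276d6f540d13bc,
0x22b979587963df62ed0a9bbdb797f672572433cab04cd5a7b046,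
0x4dbbcfb85223599c42d19ee56dc03f4,
0xf3f8f83b0eb45bd8e1c55062ad43cee1077037932c92,
0x768051ac01425a41bfb88df,
0x7132402a3933946ff5ff051,
0xf41b92e95016ed6096733d8839fa92084fcdc4268374a5,
0x79ab3c723f0de99a4552c78,
0x167a68216d5ebbc1a0ecd1033a1b177d87e63c281b5aeaf,
0x8c864c60555aa8faf8aa31c,
0x813b76a62788cb28c27cc30c404568153c7996cda644e7,
0xb7241191688efd392389fb1b1e14dc6c30d385ccc7ee08,
0x1f827511038ec0830dbeb88ca49270fe1a3bd8d3d1178d,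
0x70b1bf993df065f62e07a49,
0x10f3401483509db0539fd6e624c4976775b8b3093b1549f,
0x7b8b3898868e0593aae28cc,
0x7c622110f1049cd84487dac,
0x898b1e60ea9e3a89b7ae4ebfad0c772b839058da3f469240f18a,
0x153686fa87fb5728f448408187576c12a6e157e2d200e624e42112b0e8ecaded83a8a9e46266399fad566be062f8635922ad182c4e2b562f9c5541e488f71431c365,
0x5347b4ee8e528f4dee20e77,
0x5caa7542a67e0a07e297f34edb7e1429b358f9414210b58f05c76a7748903e,
0x402f27cb2c8f0e1bd6c0efe,
0xa2597f3250a2db1dff52b7821fb589386983024acd55,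
0x842f74e2c5d74f977b890d9,
0x7c8734ab4f3086ef644acb2,
0x251f0031ff2fecfb39c7a5b086fe38e243811af3da8a74627e805,
0xcaf0901ac168a16eb5765d506867c91608bfe,
0x468b323503f8876370e9013,
0x5dc794c8e5f0d0adb49bd2cf54c821f7358235cffac193f1fd83,
0x7c3240c3f2272c3,
0x40b87c8a46817d5f88aaad49bca80,
0x110f62d89ab6a2dc,
0x1e0b17dbfaa6dd04b81071bdd52f8,
0x44c58f2ebe6e0e8190d51db19f7e29a1c51c3cafb0dc936392027,
0x95e54c0b0bed61912f6eccf,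
0x96f54a4396b60d0b3ba02e1,
0x6500941a78a3b7a7e29a297,
0xaa1028c452539c76d79b058,
0x2d45c323983ad8f6591171b8234c350fab89c8d748460dfccb26133835f59d,
0x68ce018043524c8c4f8ddd4,
0x8073d2713559621b97422f0ed2087f1accf18b353e2b,
0x6a5710997045c266fbea442,
0x331f09711ae806ebbffdf2c10ed2e066ebb204e47fd2c6a2672f8548fa31,
0xae0935d84915d6f1dddcb41a188d67fa2217b92d89b9fa,
0x663c2eab8a028fbd9e453bed2da51affb7a7dffade0b51,
0x9b887bd3901df666d55bb70,
0xa2597f3250a2dddeed34c5e849478fabed9c5631f44c,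
0x2010d50194058b62cbb885ca75fd14eb7737261a7a3cb4653c0c9137e8d136ba96f89ac7c2fa755b4d70e22b0aabb6594171d4e5896f06d56a10998ebfb9e1e0f3823ce1087ad7cb27dd,
0x5c95a0157cb7caea7dd4244b7287098,
0x9d8a5252d0d614c09b7f1a20ef896dc5894ba7896e4a21,
0xb21df6250da7d2e6107c38a,
0x244c40f6083fca81d8571d4b18b4752871779da,
0x8a2c603ef4a5b5ab8334221c8de7af4943856a2a966d06bbb88ba8c40cd39323c3a415521ca17d31fe348d0a9e9140e9a3457d14f09ca26137d1e751aaf4c9e3632c3798c,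
0xbb73211b26be77468654fd7,
0x5ba34f03dc1e1ad68887f2ee4b105b6c290f,
0x25e396e996fff7c64bb8b73ec5f16511d2a62b0,
0xde3946ca1d6ff837132e4169605c2f3e9a25d,
0x168c54bcabea7e5daae7fe1f603bedc5c8650d84019ca0f,
0xac87dc3e8b5db40f8a82b8f,
0x11f402f99735d64b7f626a0d3643809455dc381,
0x1286b45ab0616ae5c90edded2135eb29f3e969fc955fe62,
0xe3ac77eb37b560b80eb7443ffef289603895fd,
0xb4206aadac24df7bb991553,
0x69e36d159f908ac32ffefe516510550,
0x24482055e24e7773301602af09e67b48773f808711120b04e4588194d89856,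
0xe4b1e10576f1734101e64ae4dac78e2d1e43f36c1a600d,
0xc97e4030fb718914e86ddf6,
0xbb3647f395773976399a2bfa4faffc20b1c18241881cb8640e028c,
0xb73099b2a82c8ef831c10e5,
0x505b3e522b8f13b811bece1,
0xad4231605272db23ff2d140,
0xf4187b63939de081cb3dbc8c73630c670bd10cec0a92df413e7530,
0x85ec890d69e5ab0a81db6a507e632b1a65051497724ca2,
0x8926549b03acb8bfce1c0c95c58d827a438f97fe3c926,
0x2db06e2358700f6b4c1fcb50efb39bc2c19814c,
0x108cd10a8635b53e5275253402019d647ab6200543bfb737b11fcf853e5de0dda1adb8a0734ea0451154361574e08e925e024900a839f8a0ff372f7e58101484f7c3c99df4b76b9ed76,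
0x2f9662d94b89b2fdc904ef2585930782fac3842,
0x7eaa56a493296705aed405d5b0ff1ace9aaa9f283abcdb,
0xbe9a73818fcb4f3c6ea09f3,
0x6ff45b8fa055d3dd6545e055ed25211,
0x25e7107d1214c46c7ce4ea3615ef681e5bcf0cc0c6772c5174788,
0x276b93e77c412b0307b6acf2ce1a50c1c85d4b2,
0x812225765f70d5ca4955744,
0x95dc78cbbcc74ad14b8de1e1b6fc2a0d4863566cb8aa,
0x831b96c9295f139e0a07f7e,
0x10f2fc3e80a16b8e915e81b2d8f0112f4f293a12a04b5cd,
0x296cd7075d6aeeccd4ec8d56e980e85ddbbb3ce,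
0x1741502e23ddb4d1,
0x468448dc24e1a26677d29,
0x35859810bab9615e894f70c188ddf018a03a45a59ae2,
0x6933e63ada5d7fbad58c8fa3dae0314,
0x8a47b6227be44433d1c3182,
0x898b1e61b7a091405542794f324bb5a161f58425346da0d6b246,
0x12abdf1c716595661800f468092a2d8938baa090a978f87,
0x168e97a8d8ae0263,
0xa3eae17038555f0b96224ea,
0x4039eafe7b8627f0235889cd584d6054c0421a31cb17,
0xa611b76cca1ab7f23a263e2,
0x190207b29e234d8b85162db97b4eb9b63cd390d839fc6e056d99,
0x1ad58109fa91fb23a43877c9f909c83684d0e6b17746c5c,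
0xe8042205b64e28121293043eed1a42a800e509479118f4ab307cf58752f0493f883571003f78cf7bf39ef9434b7856e1bc3c9ca99c3ea4bffa6a9dc7d749f6b7c5fd8d6d66feb36003f,
0x23978cce0470b843aa63d37919a9bedba62bf67,
0x1995d6a8e7238d12,
0x3029ba15db8cb59104d65ccd8bc2ece67c95a8,
0x190205f7aea82b88de1a579baad088f209fc02cd6e5bc182000d,
0x2059d3ec26cfe85708070a87ff3a2ba9d3805b5,
0x30586babeb618522c29f130ffbb56f5051cfcfc,
0x240baf80b6606131799d4703f7db13c9eb0946ab12588b24c6429d369b644b0c00ae38fef487c959f812a5e96670cb4aef3b0940611c3129deb2b93141893ea08ffc9595acc3b6ff710e,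
0x10f0b81145eda41fa583e416952271a822fddf38c5ef45e,
0xf08c8e787f52e73ef1462bb,
0x91dcc3c127ae1b13cc39948781643ab2d6a923d21997c9,
0x32285658e1c9277466fff9012da0dbfa3a001da,
0xb63be0dbc83310d9432d97d,
0x3adfc131fbcc5b14479314d180b0692a88460109ea93,
0x46723b2f53fb052a72921e72f7addd5,
0x3a7f58f42303a4173065b39c31247710cd8833b,
0x186ca48db893ca0f27f94909982e1714457c1cf,
0x10de031888333c52f29b897a157be8d3cb61131,
0x8bf413b3809d7b89028699b4ffe0cdb,
0x5efe316de57bcf7deb40809,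
0xc81044f3ab161ba800526389bada23c0240cfddf07b35bbed3c,
0x11113ccce35b76a4e5aecc6a785ae349db7b19f151c8201d83383132575e21685c1fdaec1f25fd66d1ae2f2e3b7e7bce0f8ceb3aa6f1bbb465a19c6f965155d93abf,
0xab281af1b6dc396ecee784c,
0x1b890aacee593eca,
0x2456f0281517a421001a7eb89d150242742f947dbee42c731dbbb,
0xaeaa0ffebbe642a2bd14133,
0x4039ecfb576810a99d14e5ef58f38f34f60459c46040,
0xf2cf8e84de50072cd648d01,
0x30a6f504231eb117e359dddfc821d52a64df6a123b80ec3b94344d69f1c06a019177f,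
0x2fab266d6d1e97d05e9ba407169e6515791cc1a],
[0x37b43a04cce3af0976a183c9fe75c419af86641b3d33ef6,
0x1325542922f431f9412a16ca72ea2cd8,
0x216fa7f16877da14d36a51e6,
0x558fbf97ddc630c30cebf5d43c47e7d82db175b9c320bcd,
0x438ae6af7a876ac76d9c531a868e2051794853a5055f093,
0x113919530c914c70ad528ab4bd79330e,
0x59dd06f1025f3e294e6008e39688bedf9549bb1fc067c98,
0xcecea8928b90f8ab2c25ba41bf82d22612f8ecbe89942ce1e6ff7f2723704b7678c9a28c19337b2a7c5c7d057fe78a3cfb49e25dca72ef33e17b693489fc289fe3a6a361a37d7251add5,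
0x116fe68b35ff3464fe58043b8088ef43738319ebfc035c,
0x9cb70f72341e1ef128273ccd4c81de0efe97f25,
0x5195d7a0e9c7b0242bc861aa942fb114ec9d8ae6fc41610,
0x36a54890a83dc4b856f414d72968574b0a94d0fe3c84e3e,
0x1c418178dfe64d056597ff33,
0x160d88629695a23758417a3e68a06bef65a5ec8b1a0b2a79d8d92f,
0x20942769db00fdd38e9563839803558395c06b0f4f17c74b964cc86,
0x11488b89b3b159e45d1d46fa4e19f373,
0x4a69af334554b0ab93eff0b3c3cda5ef5934,
0x42fb017944cc162dfb46e6491aefca00c825e7cd5a25611,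
0x1b2b2cb04f3983e1d8732854208babf8f48d150bce474bd70078199e88b44af49384799100bf238b995b85702c0617745ca07a84922c31fa2f66030d57cd3d02b80961809d35a,
0x301a0b6ec45bc0a16df647585ca8b1dec67e392bf8461e10ebc8b1f,
0x15527646ba1e0dbd8fe358283f9a957ac2fac1ee8738538f674999c0a1a0d97,
0x1a14bf94b2b174048988e674,
0x1c3a5e979aae7e2ff5557b9f,
0x398936d5d38b2f00e5b209bb4630445d29624cff4fc18,
0x305da5399ae2bde0,
0x21cd5552fef3fe0f52c02dfd,
0x2907510ed46d5380d2852515137a5f84a1e7a9661cb7309c8dc15,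
0x2057f8e603ec97b4fc6f5bb7,
0x51deb7a697523608ad1aefaf43336203d8dce28dc4ed83b,
0xa1ce60d9780857f275d251814a550f5f3a4ee9ab3084c6f5f4e1cda9a26287be48d1e996bca49043c0a3751e4a68bf732b42bde0ebd440b61e81d990241b4ae6f6dfb633c188bb894dc66f44b111,
0x210ee9a2489ddd8a645d266473bd35421d61ce7d631cfee4a9863c4,
0x1f2b57676eb9cc39f1bbbc34,
0x25da8f5b51ccd61d7adb8d8aea77ff94c56f9e7cc2437026fbe28f2,
0x7a295f91a52c4c579e936caecbcd4bbe1978264,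
0x178eaa52c6aac62a540fce68,
0x1302fc4ada96ac062dc45f2ee22ad62d,
0x3989363837146483c7963326d1459186dd126af1c2d8b,
0x686a4ca423206ed00b6d73760ffe4de6c456e46,
0x120e2e3143107adebede59f899e5224b,
0x8ad527971e2e58b1f5c537bc0271dfa8a408112,
0x1f27d4b8930f9430a9dcdcc0,
0x984b6b7481aad73fdc69d1d1f67f4c1cf5c12b8,
0x1f27e5e97333359231c71e11,
0xdbedbd360595a18a43b2311ddcc6fa9,
0x1890a2603da71fe1cb8ed300b0a0491e42f50fcfcc87d6f01e578cff08c8968,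
0x10aa89a7228f7d905ff2c377cd454dc8d487aecee779ea91725504c8cf563dffde9cd827e6ea665ce73296e84c92a4fe822bfc3d5c13ed06730c858ac44d915f24d918ec1413840f51275,
0x12e753dbd59157762031810ee72341a4,
0xc810879f18a9c9271257bf38bfc19cd5801ab939f43b21c4712,
0x612ea04f05420aa05864da794ec780775b8ee4ff1470293,
0x1ac09ef4eb7863dcf776ed1d7c4ab1dea8aa07cb284af562b6dcd3a2d6ff1143f1c53adb3b7633c20e7006035c1500b7024a713ee65bb1bf4638f6ba772be0854838e92ce5c78,
0x205df031bc871dc137c40d2f,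
0x1ee20b54710d303fe4857365,
0x2ffa95ffd94940a4be42896f593a68eb67f860ad10439af7d4f3b8b,
0x8ad5b5825be4b292ae1fe7a8be9bb2eb0fa051a,
0x692dbd964046573af691c6855cefdbafc24b5b9e7fa352,
0x938b65a58f7bc681879e4bff7c37f3f0f7d750d,
0x42ca1619c7ee047e2ff9c65947f5c38ae2b5fa83180416b,
0x202311dfa1d65e1c5165ad572a144bff93b69e,
0x13c2d92878a783947b67f97e8e96cca2,
0x287f2aa31e9bcce0,
0x3ec287ad1792b538b717cd38a5ad,
0x379b48afb61c1789,
0x507d98b7f0aa0,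
0x12b25a9a26208369c7a816a199f46798,
0x35586392c87d4f29,
0x7e7c359247460,
0x1425ce4cb9370181e8e62,
0x34ccb3b39e58e202,
0x37a4ed81d15cbadc,
0x1cbf284306c60,
0xb8f1682ab8d3153bf8e3c45e465aae7,
0xc0293b4ba53d83e2f4e45a54dd32563fb006b3884c7c06386f5ab56ba52e2,
0xff047ec393547b5d32cdefa5a5783672b0dd6bf1b4faa467a9b0b3ec228eb3a5221b5a0a882800c17aa93be7a8cfe3caaf462548b653258e5e6491534d2255cb2a795203a81b65844bff959dfd5,
0x8a26a9df2fabe878b776d002a46485d38785b64,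
0x2f206beb6824e8ac006091ee9eab00f4f0f02d61d2c9f3e26ea513b,
0x2c27d4be6cf3eec825c7232589bd81babfe3e167540f3ed62b0036fc91eea9cacd97a34b3cce6ea2add293774908c36b94117f1d225818bcfc8530b39dfefc1890c3d,
0x44c041d39d9f20734efd44a8702db5e0fad5fada761e042167891e,
0x5116b6a34c2a61bfde736e0c9f4f97fc1c559a055208159,
0x9c9bb487284c312de1f198c4ebe42a34cdeb88cb083c8dc2f742aa3aaf2c9ecb9d60ea30e96271ede3bb1a606eae47dd29edd0602b9e846d24750f41688687b43f9edcb227f19696f4ac25715c94,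
0x350a6429e90292dde8bce39c44b3e3d973b59c332b7536e22f086b7c65305fc4ecd180abb84e7539409f565361b14284f239730ab4e6964fd438465522e6fd8e5307830fbe9d19b2c20fcf6aec7ca8bce7bf373d9262,
0xb4522e41140686d405fe7e8005527f763ed7f09,
0xd491355d23fbe649ea866071ea48171cc793dd19f9d784e86ee4,
0x20be1785820286a4b86917b3,
0x1f26532437041649d4de3511,
0x12cd14b075bf5dd796e03186b57d0b69,
0x2096ab449105baf7ce190a6c,
0x218a5aa0af262f1b3d96af68,
0x4c9630e87c4fae55146789a37dc76ec44f26612fa5ba08fddbf69,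
0x3a3b7c9254bc0738,
0xf738914f599e0,
0x49dfe95a349a1f33fcaaf,
0x3ec26a5557f9759349bbfc7fa447c,
0x2107a9953937eca630996413,
0x1eeda52e7ebc777c2cf80716,
0x1e42c9244a397193969417ed513428080adae9f73801be87ed41da8e31114c5,
0xa9913ab6050e385c12c92e768cd1c7124b76fd74502e5a1073b22092159ab,
0x38d20e0c3840a83899da090a1b88e02736587c3204ee99c6c3f792beaa0943,
0x1ee9f65774393507afb16604,
0x35859e5543eb6db83e1d9c50fa655ed8cd8c7d320ab2,
0x1a0f05e57fecf5310cde706d,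
0x95dc7e27de9433aec7b35a95badcbb1d4d2cdf8f748e,
0x45546de4768a02fdd76f2b1fcdd6115427c3d7b103a9e95,
0x51b88168e95fc255829002d00c1d8200a73df938b699048,
0x18de08240b8661d6cfd6f8c06cedcdf,
0x8073dc3568c1374b47442d882bad357c3f1a84bc651e,
0x162c486a5e3bcb0c0f8e1967c06d8be290b30b6,
0x216968441fc60d8ff69a56a9,
0x287b9cbe356040ee,
0x28608803f2a363390f10d4d674ed97b,
0x1632d813d0416dc4c986b8340535a63b46fb59ef00e581371cd277a46b1dcb3,
0x210dbfaaa3a58233db51c3f0,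
0x1ee25f48a013f6a10394e7bc,
0x394ae75570e86b4f1d0ee517562da3d2cc76fd24e8ca19dd11fc340,
0x9defa12426a89cf44eaa19e39cf0b0395000974,
0x18dca540f70a04a319c6fdb2a3847f828dda3eae1362b569fc17dee6d8a1648bf160d2f70881ed8b870444ef9d8e178a4b6be3f907ec5aa51138e6132b48e33467d6a56bb3ae,
0x7ee03d979b6235d9512b091787666e5c231615a,
0x4bcb130a57656ed07bebac3191480503ffb648b4a08c03b,
0x2c48cdda345753a9bbfd8e6b871b7b031f32c96d785cc05cfdf655a,
0x2060cbb602e23d1287e242e2aa30a46cf852624091bd77e3188ba2ba426e35c0ed8a74ec46a3870bc10c22cab64677d56f5b576f35b8964c6ef0cd3d27bc7d64076905ddc5110,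
0x9b9fec157404bd6a57d4839e83a5c9e059dad10,
0x13c18782ab77b6b4dd7706c5dee4d1ea,
0x3e2ff2ac3b0369a6f265e01,
0x74d9441919a696c8fc7876c07bf81d36478abd51221915c42989675280c,
0x9ddb115e204c66b8f3cd8f59d9d00634dec17b9,
0x513c6793db20b92fac1fecfcc57ba03cd23cd0fc2f5a2c7,
0x7edcd6317adec16304aa042387387b94fb0cbfc,
0x2fbcc29affa17072f1f495739d94ed0d797ddd8fa919b7e6f608a268a9871675521339867be4edfe4b6260f2a31a5b3d7829500c2423fe85e7942aa6d32c2953afd89b25d9e,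
0x81d1ae21ef9a5fe76b876b53a2e5eb6e75541b7,
0x95b8158488e17e45725644bddf3697e07b41778,
0x527c23272bd66bd69c1d1b5e49e2bd644c88967247bf04d2252824514396be8cd98f70db15717e5b2201c36591d2ab560f3e97724f3c09c112cf47e6e7bfadd7ceb499992e3a9df38472bd7a97d,
0x141f88752490e86c6aa75078c945ef3c20be39341f7b0ed,
0x475a7fe0ac17b9999d2e102fdbaff0c87f5d35e053f6bcb,
0x1352215a606cc3cf65cd5292abb9111d374199c7a30cdcb,
0x1903d487586d1be57cefd307618f775,
0xd7f36ce8cd28ac91370d434cf4c3cbfbdb73f062d93aff,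
0x18fad5b8a173d6cb3a33eb2957a79ceb621731df62ecd3bcf5b201ab6df9da89da835d3d6277db9baf5205488f98515e6f1db657e621e591a973615c10d7f9695d2aa7376c20,
0x96298826c89f8e13f7a8df33fc90d308535f196,
0xe39f8681bd2cee363904c94eeff4589c6fa8ba9748f8cafc4a0144,
0x205b6f64f04490f817f49362,
0x212785b5bc3c32484bfe6358,
0x22110282d399dc9516df152,
0x216c2c3008a74df7eeb7df0a,
0x1c122f46a2898e1006a3dde5d7f21850667bb9dda6095a62a04d545f05171,
0x7b971875cdc19736c5b7c95d5c14673a75f156625c310a23e93e6c3a93b44bddd4ca050da3f4d346a8549cd6a559ca056481d5b4f959fa79d8313247af3b4b2ababa3895c3f74551801036f5cb90,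
0x10fe891f2eef6c1e5e8de4d0aade258d6a98b2f9954e29e,
0x25cf2cb10c0061d54eb194b48a53184dd6bd2eb,
0x16439827e5f242f9c8f0db16af5943d40083efede30619e,
0x81c33dbfdc7ed741268f749e796762b9228e9e2e468477,
0xdec4aa4811a452c084092570e62a50ef7667b670edf251fe19a993a83aec62931f05c149bee6b3601342ff84abab3597bec4314834410a6c68a0217744fdb67a868d9d29271dc821a629,
0x1c2c60dded08b5474c6ff15a32096e4fd3ce5e5120af367,
0x20c1a06050fea690e87e62cb,
0x9f87f4fca7de9b0c2c3821818eff2021afe203572ab232001cd7540c0177a2,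
0x14d5d1945619ee33aecfbcbc96682a05dd2816ed9b2da9ddfea94db1afcd6f4,
0x8ee7ced2a44aee840dcab0e03fcd5bde10a4291,
0x30c7121d39d1d507c18c8c9c01bb1a06111a46f2ccc2ea87f855c4e,
0xb06b6e839e1d7a957548a39a00896ce74a3c569fb8d63702360170f96a4c3d3e4592b2600ff5bb37f742050424ef1e034c49d112020e7dadf7e8bbe554e,
0x1d9241af71f53d7b0fa01e7d,
0x20c16f7340894cfb534a0d10,
0x25830d64be0f05f8e7310df6118f7c703a502f9e4d89acc9e4c7,
0xa3d6d6c085175d89a28c7ff3b32bf9a2deb952b,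
0x1844267623fcd885e904bb74fdff22c0cc7d435f2de8fab181f1fe5e6ada5cb579f7c181c769501da8e577a8d01d6cd55eb706226e4a8f0aae408609a7a29f7e164197dabf1a6,
0x5e4228defe31490b86b0f899c01b9431ca9606a,
0x1927b2cd2b166c2b173c8799b65ebbeef20c634,
0x4cbd144a706b6b85556145c943b910cf30f470c20fab7e5efc27162a80f4480bf254f324d7e5ffce8dc8c28e117dea9cdf5e96f5e5ca344226d78e28b97,
0x522aae0a4c012c563efaeac63c45efeda3735fa033436b6,
0x199e93c32b6ddb0a9ef9e73f85abf7e87f7d544c890e0a7,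
0xaf5aebc9691d7e1,
0x6ea82abafe1a5a5825867ae,
0x9fc564e5d56b43775be427c22ab475c7c250f0784f0fbf,
0x920a2ed5940eee0,
0x227efbdf9b2f0,
0xb08965aea62641291dd33d97107f7828d17705e,
0x4e560e239fdc7c5fedd20d6d8df29dcac877582acb84183,
0x31b8b7ecc52283f780257f30c1eec01a8a12f55,
0x114e9539774fbb3c339a314ac9ed639ff4c04e2da526290bb3112c9f82cdee8db95c711d62555ffceaf294f8a40f86ea8dccfc2b5a6f0ba8f5ab65bdf24d0a0ed75a4677199a858814eef,
0x8bf42dcccd067d510e28a572d37b273353d3614,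
0x1da565d41bead5e35063bc989d4686e647fda9c48ccd4c,
0x1c3dac7ddaf29182935d8f4f,
0x4b06148bfd9fa4aac750af3b777901837ebbefd02133013f429b,
0x1c31aed0be3b556de14e0ad98651e8e540d8f7ec50ed619740f2292a5852dbff70e186af5b5fc91ac46a48ecf6836eeed747d69487babcd1814e4e420859c2ae9f355844fbef0,
0x3746dec44072b9bb75da76935270a8886ef5dd3,
0x54b3d7b318f08614c80b208d507e947d6f74cf82eb49520debae18ca533cb6fc1e7652f4e60489e45fd6977a1300bf74ed43d5fadbe46bfa7f04528d0f95468aacb2a0c547b536e1a5d0,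
0x8aeb1b0283a8787ac891d8d73db7e48197ca0a8,
0x7857f83589460875b991d45,
0x31415ef82776f6d11834ee1357fa898b26f53,
0x830aacc20a3e4392210c5d0a3e3e539cab745360cf99c96c957737c380b362e6574d11a9076ec01ae0d808de7f23988f9f16f43d5f08c511c647150e25d61d307e22d7d4c172b7705e41d88aa6c9,
0xac0f5e63806a0e79ccb08ca998b537a3e9c774baeee7c26b7b21a2107b38cfd89ba4519e8b213d45733673c454248ef7b7584f8dd4a2c7e8607ccb4a91f7e959826a97a25cf957523d8b4a0493e81694fef537d6dda,
0x12642e3a0b98b627af0f06a61e771be6e672bfada4c053204b15893,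
0xa1089a4d4407c9453c4101aa73684d6fc622713,
0x4c6a20a97e17dfe74636c10a3a69fafc1159eb27c1c3bce4272e3f30a8bc05e3387451a3e752a8f0029c3507385247e367c22ad8c56d953b540c9,
0x1f298a224c9a3da82be269eb,
0x21098abb4de44afb8afb3d2d,
0x4661093ec96021fb527bbb2986b31b14ac6576cc876a28e8b81ffcd7b8777b264ba9,
0x8fa30580fbc90f38fb9492e84deabc8538bc5ea,
0x459e5707067a104275cde5ac95452f2b2ceab7e5a35927e15aeb70cda0308866f56564af71289b1c2cbdd7358b447a67651f03ae32e094fd2624cd00e35,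
0x18fd50ed204bb8e4e18bea41023bf23f8e1c52,
0x1374d25a46d7144ebd2f25e6da6787102311a4165fcfb63b601c4add2cad6d4d43a10aa0330aed73c64e3d6846d62ae267fa0b11dd1670163d95aa80e619c541dec6,
0xa0f36471f12aa99fb5757e7145a4eeca4eb96ee,
0x219387187a1e85dd0ca417dd,
0xe0caba2d3fe6a6d1fa0de61515006cff4246687ff99e,
0x8c6461024b89354fb1e434e39ae24747bfd05,
0xd70d9655f5817ded1091cd1d7f6b4417d5d9e,
0x459e5707b12584407c5f3a6fb5da87a5c865f8eb26077bd826469b6efa29d060e135eaaa23890dd97e010a113a5003ea09816556631ff9181e019f39ae1,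
0x21d18a15ff56c75df3fd095d,
0x524b1597d074c254a2098fe3e06a71c1d7142d703b26316,
0x8249be36e202f1ac0e2e03e6c4f93bd1eaa80,
0x344591ffe94ec55dc5243b808c33260c3d52ca62f0f561c55e0da0c299d2504b9bc82cda5af74918ce8e5d2ffed0cfd3be3bf97b115a51a31cc574a118ad1013bd882,
0x1d8ddfa0983119b4f40ebf73,
0x1fa7703f35ea534f4c7e6c8376b906fe218937ea6347c02e2dc826a,
0x5b75f7b45ce7d038df7d601f039fe115063acdf630ea55c,
0x111a6f86eeb0d62195c990f49e0aa7c50e382f1fbd0595049000ea86ad79d182f7c4fbb1c44ccc25482f98f6bbdcbf1e436f8a39da93259eaf14a6cb9d1ee7437b2734bf426bd,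
0x292b8867812d3288b595a929280df9d9667a527fbf748e6859a5b670d11506f01660237ce3a053b6aa4e8aa3ecbdb117a11b0e188b92898a24dcab0e00305147a70b4c6f9024d4513f1a40289f735d759ffebd03a46,
0xedb08996853c8d727194594e12c5dbdc9fb2e433a9a90a51e7bb02,
0x21076158939c49a33f461bbf,
0x1451a47c6ba20b3ceace5c570ee5a9fcc04fa735826715c310f46,
0x96332ec54cbaffdda98e871237b958ccdf4baf0,
0x5b291a314bd99e89ab98fb125514917a283524a07af2aa3,
0xa0cbfbd7582d621e1185359f777d85bd718b95dfaeaa879951479da784735d7ebdc502526ff2fdbc30d67bd35bfbf3361558dbaaf0850da3b945c6854c67d0ad301,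
0x37e2e93f50816aedfc43b30c8efec95ae7dcaab,
0x12deb7b0b7ef6bab5cac38baf692f762,
0x7e3c36091b84aa145c2eccc365d635c9465d04d,
0x9b827a56bd2dc461cf3132d17fec50f8b0849b7,
0xae5f3a66b8c83903e8eee784038e214b49659a347e41ff31db8192fb4063b2e6f04896f7462a800bca72c92309d2a89b6d765e8ae4d0c98b15d5dbce9826b9c795856da3111ccdaee67e3a09b1ae,
0x96d0c6dcda3b5e1945fe8d8724ade875e685aa71bf7aa629024b93a736cc920991126203d9517a440c8afc1bdb56284ea16a6dc738916580cd207f72782cfe45fb5fe694164498430516dfbfc342ce36a12bf53c972,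
0x87469e85bd079e413aa8a8500cfd5c6bb5b1640dd7bd6d17972e9f49aa9b4a,
0xb710af23cc84f29478542f61ae6dc04d6812924,
0x2189c454833cc43d4278afca,
0x2063bb7dec2912cf7f33fdaa,
0x2191724c7457ef7f303ac436,
0x219ab7cb373f735423297173bd265f96c0b15caf3f103ea558154,
0x1ed109d2cd39d36462763d00,
0xb64b67459bc90a84e6a917d9ea74fd96abfbc0792e209410e29304e9416453c0c6560c18ab5b47,
0x1fa634c5c1490ed9345807311059624f7dd860634ec776a,
0xb8c0c90c1e29fe1cbf0471d92d311eb47a2f36c1d2d3109f141f2b,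
0xaec92c5f9a72518b8f5d704,
0x209471bebfdfb20b9ba4352c38e8efb59d04d17df8d1b733f25753d8c51b3bf,
0x10c26c2d1541069d,
0x563d6c537cef8,
0x219193c38f1376be6c49cb4c,
0xca90600ece8338cd89cd676647553308b73ad2e7cf7fc54b629d,
0x631b57290d2069a7ab4e26d0673675e32c164826eb4e3ef,
0x5370b7569f8064acfd8ade906391c20dde9a9b883e6bc67,
0x507cf3ff0c5fc4113f9799f,
0x1241f111574af8107577287f3ee899a6ede99dbd3f0018d7afbf4da797fd,
0x1322ec1684b8a8bc0be942824422b1e5,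
0x13c2db4904c97c5353317df5860a5c55,
0x1997a682e439273f682160bbd825ae795e64eee5764b7ba047e7646a914a78d35987,
0x177a8a4e9af767488143ba763d0438080e9c1d9704e6027434d7d4a90b2c087536e4871b3461137911c38eff14857ad52fe56d9e4e6c3cb330592f3c18e03df579cc0cfb14f5,
0x1c3bf549591c0c3f52b57103,
0x1d8f5f636a62189b86e24e33,
0x1fd254d90820f89e06712a80,
0x55367cace4ae561be1c68fc68ba468d8a08893371e5ab5a8ee509aafaeff1a5a2f01f65f27cb0a,
0x3814d42d805999e6,
0x1b750fe1ce886522c8860d5c32c4e,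
0x2c7f6076fa4409578fa5a0dbb733a1f194c6c1b92466f62,
0x94aa972c2f3bddfc2260f2dc343eaa264c37829],
[0x925aad4a22735bd42948725c5f46ea460437a597c2a71ad,
0x15dc9b94a993095c25351fb89a43b6791d37d8689d5d4fbc1d41d4d1f7b20502a27563f54949e5a7e87a4d4c19fe7b4daa37c75364e1c27e3c4239e1d35bb04315a9a20f1e5a4,
0x95e90e279693c0d8b8597999907e8a19c29688871447e16,
0x87f6d2375008eda9a24abc676c412ca33bf1e35330c045c,
0xe8c9d4a4c9e79fdc259dae828935781efd85913,
0xfaa1e28a8c4a74fe779e1490eeeba934ea790bd,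
0xc3681216402fb45b7a9e11dd4e24a9287c708dddfc2415b4f1a6fddb91fa0d9459d2fe842ff25e72e56790c6b6e87813df36f437ca28b55d8c995dabbb5,
0x385e3253b1c5edb8f1ff0bb67ff3c38ac85054d3685f28d,
0x2f7d1c37ab224e2ff42166be28b618233e454d1f678101462000ceb30c22f760c9a0640f0f4bc424561b9585db3be10ccd28f97591d30ce14d99440045ba1c3b937c1e895159d,
0x374a5200123919c3e2fab7fd73fde01cd1023f7e5266c1c,
0xa2defebd80d7e1313b7fdea1a14ec8df9dde070f172fd16b92385b01f4f4a110e80dfa4fd8a407e52ab9d06f720658833dd1f124e043ecdf24a9e,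
0xae17576b12c6750db7ee806036e3ee3c3927a705f096056aa1a551c5d92869eddbd321d390ae8d5ce0fd41c50ddbc93334f03df9fc697286309bb,
0x2a04177947f2a93f596be1954d69299872207441ee30bef26901a978a68318d0bfe3e8fa714801a574e367d28606e121f603cb45ed1ad60fb3040c483713029104a3e879e8e90438c423d83a3c237be9af76d4322433,
0x51dd2dc7cae5fca2,
0x40b87d7c840c54b102e51ada86ee8,
0x118a9b0d60ff5160ac714001f91b652a,
0x123304a3b54ead3aa9a753b1,
0x547a94fd632ddbe9,
0xd3d93eecbf87493220b9330391755cc,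
0x1d8681461a742b567943de9121f7ae45,
0x56fad8d3c55f0b70,
0x13bf025814abfc3351fbe,
0x4e828c018e35f18343d92f973151df99950fecd63f712deccc672aff32ff811ceedbf,
0x563725f72e7ae548fbf1a4,
0x302014c566ef57e3,
0x1c0a8109f1281da8f8eca3b5,
0xbc473a7486ecd8475cb78ce37834,
0x6f5d0095d4150c065bd0d3279589c5529542ac3177e8a042aa252,
0x31c3a0c737e200ccb11f5d12,
0x113f404226f05382247a72df1b42f1f302f2b63c,
0x1e53c954bdfc9983cc020bb3bb1fd438d6e371a08da8b10a8b400b6c3221a889ebca3e6,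
0xef501d60975a861507ed764c80a5fc0a76e0a7a,
0x3267852537148105f0b1f1f2,
0xf633532d915ceb3b976294d21392679527058fc11289,
0x32c26258e853103f52afe50b,
0x4959d34b42c01f48baeae7d54f6964238edc0a04ab51467b37c2cc2,
0x318557fc54935146a8699dfa03d9df8e0194e318e4bbbbb1bf63265,
0x15bee581ae53e95e0ead48ba6d229bef9e350fb93a6a8ae0e0bc0ab1d8d92605edc7e89231461da2cae124c2b93382938dec2fc43a706e0f793d353530b348073c71,
0x1943b3f0dd136cd953052f93920028d6,
0x315a1ae16975f62048d6152a,
0x1017b8de11c22ac5e64b252d3ef474278a325421,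
0x1dad0269ec09d95607dadd4de5468ae1,
0x678c5edc591a689b68cb7c09ec3fd777fca0750700bb02408980e,
0x2ab1eed7eabaf5788582e12d03ff0b02852da7b396a77ae0abed55da2420e624036513d46995cfdb73e6a01ac3eaad042f63f7600a8957077593779a594de355bc298,
0x26c78053c78920fb5909037468d2afeccf873908efc515dd7e98156e23c0c0de4fc6e915d88bcc7b3ca2b4eb55dc3867c753968455e2fd2adbf048f5b00df55a7e965177ccf65,
0x312bce61ade192c31758be6b986510020156fbc135cd066535056a82de8462662ef8928ce4bd7e8e95f87a51e87c07ea39cf4c139f1a8bbc37d6ac573e3846087267a1c6e0d21b0b264c8cc41cc6d856bca9e6838484,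
0x115487de7304536b7ef2ea9af336f8d545b85e57,
0xdb4af05e17b1ac8c1e50aa78e20f6621d8abd03,
0x326784405794f571f1144809,
0x11633c3c1ee36a020f315d718259c46394bd922909fa954e37eb4cf2533c1505914d5f8,
0x9583b39add5644351d1c2cf796341446637d1094c17b651,
0x9583b39afd762b72fb04d08cb37f5b90f0bfa43cb41816d,
0xa28623606f7e3ff363f7262d3c31278bc292dc1,
0x9d2e9d805649a7ebd8b7defe0b644556726cb527ba47f4d,
0xcf0efb18cd3b8895b280cef64deafa1f3016b67,
0x52bfae26cc504997cb123d5b57bb4681ec777cdd3794780272cc411,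
0x20bfd4dec13fa02442bfdf3938f955cc67da14bfe7f0b97e152e6ce477664b63974961554543edfdce4693ceace878608179535899d8434c418d95504d047224a108afce4da80,
0xdba8b2428bf405445bd1b3f7e98dfec11ec5c7a,
0x2d3fa5df3ca744667512393e,
0x5ee698b55e2caf4c73b43906faf6034de4517001ea9f83e,
0x1dddaa2f0e3485bedf2fb6fb,
0x1adbb367f7e14c808d17eaa51273b2c,
0x3c7a6e59dae63bc5787fde7bb11c41171049d4f88fa126386d00475415f2f,
0x9115ead580ce077c7bcd920701ad23ce122f516a4f25a70,
0x9d1489b64f8784f32948ad98b6e784d570a9036de0012e49e9446577557f0c47207fcfee58fb4f88b89c8b45d3cd84195e1b59b3f8de3f17a517c02f5da05,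
0xf84958ae02a22f513776b0520532dace9137f06,
0x4e677d19af98d0a94037de36dd6670ff2c94ca918a315ef,
0x1b943ae9573d1146d94a2ffbf7eeec53e90b1fe3b21981509d16f20ad8ed126a9978a75299abaf991ef0eb7edd6db24b3b47728753722bf865b459ff3ece0e7a959faf72886ae0ccee0a59a28c5b,
0x26de0b03860d0a6570768730981de9ba7cb175695a461c86b59c9ed4f684ac6ec224fd0218319efbb4d15903bc14856b270e6afc70ac07c5c73d5147f218bb85c41bb3ae7337b,
0x64d2211b4eeccdcdd293e421ad84179a56f9163706263a0,
0x4508644b726db594135d4d026319f6721f36df3d5ba4c6732422ed5bd01de397c401a6c30715082f691698d2faac1e4a217898ff9812cf22fbcfdcd85fefffeeb3208,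
0xfc3bb8dc284849545d88e8ecc64d9b1d514bb77d3fca66cb3c47acb144040bd56e87f425cb3f11e6cbc9b8078fa0d805882e0b92134e2c97e58a0f02b7ad9d75188168944c40395a4f59c6ff2c35ca343030c2a00b,
0x11a40f38127b3241d71ec1e767d5ddbd86e95ec83c9e2a0deb87a5ab3af8e25b7b452a84d324d1ae2bef82c55a26d943ed349d7f3216f6e02053a93b30105b2964d2bd481b1c037738ee0591847ff737035be1429e3b233c3f978ba571cf,
0x3102f2693c13f9147cb57f3d,
0x635191302f00f1874e184022f55551664166d70,
0x12333edd7352c98c34cc46bf,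
0x36382bc7d5b9efac364910d,
0x31053d87ddd36e9fcc084a93,
0x3029cb2de22301441c460e3e,
0x3203ade53883425cef212ac8,
0x1ca1400dc4682951fe7badb5f733f8af,
0x1d70d69084397761cd7681fdff893b15,
0x2bfca55e74f16c86d4a12b95be4763fc45cdb1a0ed1c59a22482f8b498f6effe31b80,
0x1295c09a7197b1e3d9b976821bdefd9b498fa3dae518a63908c658,
0x3203ae371c2bf41e1136f123,
0x94d9abcdb718dfcf877defc675260c67a034c4f40a4e65c,
0x9d228d68f3c71b55546f4c9187e6784696273f69851d69c,
0x54967f999f0afb4df08ea72a9b5479169bab99fd1c541e59428eb46,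
0x2698220440869c9a48c1ac22e6c9d4bca101b52285d7a2,
0xfc20d14534eb2797b5631407e7a1cf025655d55e6fed8,
0x112870152816369fa69f65381975053e,
0x92130cfd72843d403398ef2aec537da86be701bf023b5b0,
0x30d3c65bb5eebf873b26556a,
0x95dc756a3e3310801192993917074263a1364551fa15,
0x1c1f37da4ee7cf101f28f4f0afd8053,
0x101aa35ec7e0a37cd00bd84fae230b89948b207690ecdd0,
0x564e5b1834eb01f3552e6478a07af9d871f1a15dbec1cfb6a1943aa,
0x2d3bd206dca7a9f2b4eacac0,
0x25ccf61aebeac0ff25c877b0c45c1ea275809,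
0x3d367eb3ac9f14d0b80918d5267880f04b75e7067282be34d335507c52c08f4f4d95411df2a6aa3aedb1129de0eb889b50a26ef4bae3ebb06d1e55552113,
0x8c30c7ec44798811a023218cdb369f8713129d0b1d8b387128cb1afff9eff3d52b01ca2e3177250a56c0ee65ad314fdf22f289765432308306778e1b3c4f6,
0x256a1859e0a6192cf258e0b013f0837d7393eecc473414c28f2ca671b18984a3ac2de6c4d90bfbddd1a28bfbab0a47ef271a5a17b5f188145cc02817a54a958e10e10592fab8d,
0x99fcc22c78421862c6715aa7850067fb30a552f512e82f9fdde1fe107b859dae235e5f5c444ed5f32a272139421df53348dca7107c06f83280eac29bdcb76,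
0x3cd4c06eccd85b87a5bea6e649b5c3b351ab23e8ebc521e3e77955ce7021d94e768af8e0442b516bcaa7e586fb34749e1fa4b7364e412913002381ebd9d6592514a065111c06ede07b28c34b6c4c97432ea952bdc518,
0x32e0d0983ea2865e491cf0508c62f0ff82f81a40e96194b16821d8748a69653f84e2b3,
0x1d2e5b1c3a8c8bc593abecf53c729ac8,
0xcf10db46ff922779d979c54eb9be65b6094b596,
0x1d2b1e92f457cf551481e16012bf23b2,
0xd656ef6281a55814de9c880064b4c38,
0xb184acd0a2724ade2d962868333c79dac7e8bb124f59cecb19e605389d63480b25befa,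
0x4d6f6b4c351d4ad4,
0x3ec26a35d20dbe4d84053fb340d9b,
0x16a62f582d81b3c2b82db6f3,
0x238c4ba03d289409309ec4,
0xe8416b764e7d7fc6d006594acb26cfb6d91f94b84d801db8d3d2a14b535243cbb5693c,
0x2a38803041399135c7aa075ea4ee3125bade916716982d43d3fcd6d08cf38,
0x30282f7439376ddc6533ecbb,
0x43998da2153eb39df5499e9d12b20dc14da5dd08004449a6b4c8cf038238ad97ddc827,
0x1a6d69904a7e4c0cd23ac23ee0893acb,
0x28cf76dea7f11d5cec2be32502e5846eaf7d64d680179,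
0x1d3be9982d22413ea8cbc8918888d167,
0x32cfc0b9a82d81a30df17b21,
0xeedcb8615186f66f263638ae8fae5331fd7c693ff27197418705fe9f1fb1b7a0ebd,
0x814e142c5f3d9c49c40365dadaa0fddfa590657ea2dcb1,
0x337918a7ce53055670990acf4b665fa17d5e76339ecb58,
0x235f0249632fdd9906bf957923ab51fbe4367ad8cd6672e7d004188,
0x2e5c663bf4cc70701fc967fed51d0f0cb6a490b6b5dd35ff394742a3365e06a,
0x10d0f6910be20f56638b1d23633818eda2da6f172b236c76acb47e7ccd90fc2cfba0b3e4472fa0045098308429036668a4f90880efa5c4ad3b71fb399bbe745b96eac1faeeba,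
0x203741ba9a57fc5aec7e8cc1b49a91d98e8180995aad457636de38aee18b04bbc678c88768c79e8dfef97ec440b0e77802fe0c3f5756375d45a50944eca8aee8c4f55f75299a8,
0xe21c3b5ff866f3c143f1bb851bca248f95a88317cf0acd17638ece30ad76b7cf7fe4f09df23d0c192f19f82c9936bddb4faf6e0c50022f23a6de4b523c2b7a21409dd64ae2e9ffcc09c10ac4607a,
0x2ef954bfc1e43da1808e313a51e4744d89923b8ff3587620b1b218391d94458,
0x4fb43b9445eee54d902565311131290ff29ba5d632544fea08c4d46e1e97a32d0dc7f1eced1d1a1701b54a268d31101d0650e7a2454005d0fa6b3ac1004a5751ee525,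
0x39cff059febdb5ca8b5bff256c93bfd40077096b689ca1261b44671b57c7dd5372dcbbaa23e8e764946d88f0aa31cbc802a95bf523c51342acc129dfeca060665064de60ca45e154bbf3c8a8105e854b8037ec07e9a8,
0x1c835245dcf66b18a8f3d1e9c811f0f1,
0x302753f930f1b45717e7e54b,
0x1088b21429c7c190fa58403e01589fa41e5aa5a0a7783be19e6cd43319a38f71f5af0,
0x89aed5c83b61c0feeed01909a8637b89a9949ccf9787054,
0x1d12eeda25582aee4d0764c624a8a307,
0x198f89b950ee2a36ece232f861d54830dfff1981dc58632d5acc93e31997,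
0x1ae877f159d3f461c2c0163ffdedab5d0dcec1486090e66416ba63b5d9ba0fe,
0x1afaf44ee0401b4a6d0d816b89b9bf00852110e436cfa6d3764a3c1d1c95f74,
0x16a513072e3c1bbcea647d5b1a0d479eb22ab9a57e02d5c0384c62e18f0d1635c6d60cb4e0f642b3327eb5cb50c6760db364f64637269fa8f7e095199c13b8bc5fd0131aa7d95,
0x197cc258d42f2cfc694211f5b60c2c43e7915fb89891c3,
0x579c9a7846e899c5cdf9c95c9ba011d15ca77f4dd66991955128c30,
0x507e21470fd1733c0f601dac66275d72b5c05da8bd9f5bd0de4816b,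
0x2b623c6af0fa0fdad7ef93a6dfbaafef643122109cce309bccf0526a4c78e1a2f7abb9f35a9d98db56bb4081b2c1491f71505f7b2a7eec81c69440c3995c3e84b65a968cabd63,
0x80b05d36f42b658e7fb2a25ed3afd3749e6e436,
0xa2141ecfc24ebdf0ed693f1e5562997374ffe425bbc5827074b54db07650ba086af39c67855131117fb71b7899c549c66939f4b20636df7cc351c,
0x1919e9e6ead223c8bcad86c2e046f82420053ef566e0f5b902c0063d3c49065e1f55fe0,
0x34e6ec88c9b8f4f3d878edf15bc2571d8ffc6800e8269acb56f67bd070002c6026cdfc62eacd0b3ceeea1b6a8ffde49f17fbf97ccf8763793eb26133e29c67fa3e87becdc5a3a78f37163385753b48ef85b695aa7cf8,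
0x890e14476bcf3090dcf48df9a38882f1ffc6d5982b8a4bb000a432,
0x43fcdd76296ad606de3f6ab2970c96c785bda671aa56882,
0x1ddbb831546b11d266a324d8,
0x1b7dcaedde88dba6d5fdffa88290a0b79d849,
0x1936f964692e595cc3450e643464e44608a0029d92df210df3cd1c46d4cb6ff129c3964ed4c94145102834df196e49987137043beae936bbac02422127aa14ad461a016f1c30a,
0x3d4ec75bd823c4408b56fbc2590df71e11a47384ccf0034a35d5d7d4049bb0acc0ce62039cf5f7fd95b1f5c0b41834b8661522ef4308d7b579121c57707e4050cb2343e292bbf70a0ef1fa09a4e34fce37cc5983966d,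
0x14659aaee65c354ef1c45bdd9c80f73633a9eced8d08411f05ab374b58cc55e070431fe6cf55f0009075e9e30befcca69cb8d024694dfd92e7dfdc893ebe00d9a971d48b0cbd4bc9eeff7a4929c1b7649ae844057c00c7b06d76a67754c,
0x1d87d160a89ad4243d2ad00ed6975294,
0x12171008b25773d2b55de51485d79648d8a5bedf05d75a7ab31db3ff3e883451dd1b886e4370e40,
0x1b356cf984c5fe38d153bf2ad5ee1846,
0x32d3671a8b13f83de6ecae03,
0x302589736bf5bb66d1752c6a,
0x1d0d1f7d02b30fcb46f30c7cf0138d5b,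
0x2fdca632b6cdd9000cf8daba,
0x421d179906ed35c5be27cda0c8c49cca47e6efc5f8bde336d589a2eabe918cf59bd2,
0x123cb3e3bd57589a42180a6e,
0x1d72bc0fe317dd10714e940cf417ec93,
0x318b1aed44e30ad1ceb7634f,
0x221ec3e0a587b623796ce89978c53453c37ed557b71ea,
0x9209685c7eab9331648307408e9d2d1d45256b76be08321f517dd1e11d0ef7f79629492e802223,
0x30d575c7b278b5e4096a0987,
0xaf83c493550002489baf92ee52f589ac008c5d7,
0x290751714fefcafed058aab1ea0aa85cf50bc9fe5e3bf4ce2d94c,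
0x21d27ab39c97c6c4fcd3b54a273ec17fea57d2424304817ccf9a504f9d6dfe2,
0x75a9c9b625f83cc52f909877a411229c41d7564442623530e8255d2baf45fcd85adea5df5ee17c8b0c83b0f9835b8e095854a78b39070b5c9b50efa27081fe7d406ce4731f5,
0x2fed8ab660b53a05da056084,
0x910f27a82fd1546db294d9761e691f120694,
0x2ee45cc98871cfddb54afcf596f04d693a18a8415e06f3eb3f7e92d5cb1bde8e435193628ef135a8955cb902dd5de104a5b2b2eb631a7c6024ef6bde23d95cd20916bd820e7ff,
0x5e7a28ac563354c8b6ca222a9f752374b1c039254c849c7,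
0x2fe5367a2aef2bf2bd1ed0a1,
0x3a46fbe65cd9d1c009447db5de45a429622e19507730cd88853d47295e42,
0x116522531a776d613ecd2b4ac13c7f99e64d1c1c8d5759163c5838c7c6222685d201b982da44a6f08236429a04a6b483a2a810f72c43ceb5ff26cf1b64a3fe400d65397165cb1a55436a7fa310850,
0x31597a4672f564d8d52dbddb,
0x332706f3f79a2e24858b2b66fe51f224602349ff0314247cf58ca2ed9cbf52a,
0x11b6ecb9da25f0676859c51257d4ff08e712f4970d78996c1abb85c6ff15c5469b2eef53538974dac188b9a98070ec44e1e7426bfa02040f7b182e06ccf456d7ab7d8a1e6f606e4ed0a64ce6340d6,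
0x56178d79907279c3b97db5ded5f7b62e5329fb32c53e387547040d36de6d6c1441fa1e266c2aa6236f9ab161ba7d589b59b253bfcd68a55981ffc37403329c7b579ecb29ff3a0dc6eae10d9ca15bd7ef5bda4273444d,
0xcff35252d37495a2a739125007ce1ac9fbbdb676296e2d70eb04676ea7e3c8313d84d,
0x1befaf14c94179e4a8c3ce84810686c7,
0x5a2754e93d4ddebc57538fe6f97280b6f33ac23806f2211e49a88ad,
0x940647e0ae61336223b26f1db7cd4edfe542f9196beaf57,
0x78f45d309180a76aab88cc6bedf72167a8ea1463d954dec,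
0x89a7b95a51b5d8460880839bd791b3fc651afd3cdd5e00c,
0x87c4fd8a8c2c9c678d26b66111958a489113ee9452082f681f98dbc71e43fc0c62de6cf1b22cbc244f550ca511f0dfac23d67993329e855f0ac844b9aefb5,
0xbfecb98e96adbe6e6e252b0c5341c42736b2678,
0x5b45996d12bf2f89ab5805049df38ff645a55660e9ba7b2ef53918093c616cc975e1048911776a953d90554c272a9050846bbb49bb461,
0x1d5efd2bcf2b18ca3bc4d8a8,
0xa0eaf3b94af8640e611203ea7d50fd8,
0x3224e7748d4bf4169972bed968f3c0131f558ab0c549e1223388d5ba16573a7,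
0xa48d970689dc8ccf80c77d61ddfa6597a4b2b39127eecdac5abe50abd1dd9b1934eee684eb0bf516f2836bc5806e26ea65e08f8eef0ae954a5331ad0dc,
0x1e9ad64518112e4365477b97d1de9bd0688dbbfd7c3f9ff608e6b617fac62b7e1980fe7a658790ad072565537e68adeb2b643856cb94a2385bb3c69b9eab0bb4db872e208c31e91ab0704fb3d096ba6f86c8213d8860,
0xc9759553c64d8af139cad749116cea0de273b99da3ce121c749756dd2c0afad41c6d8f5b8b4e5bf5ba2463cc9eb84a55a0f0fd9e35e671e8e6e377c45a5b97cfcf530f0ec4cdf40e7514e3c1530b877ee5ad049aec9bde9e53ef2f2bc6,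
0xd10728432c19f592f96d2fda001c6c14e45f4c68bc7d74476e5b40313d1265a5950ce7a81bacf50578fb06c20b36382995291c72ba8cc46e869bf98e39c35757d003c094464fe5e970f0dc70afcced7543c030672922bcb2fde4d617cfb58e59eec98be8a2]]

theorem checkCertificate_hasHam_eight : checkCertificate [0, 1, 2, 3, 4, 5, 6, 7] [0, 9, 18, 27, 36, 45, 54, 63] 8
  40320 2508510737
  [0x41501405014050150400000000000000000000]
  hasHamCertificateEight 0x1d880 = true := by decide +kernel

theorem secondWins_hasHam_eight {V : Type*} (hV : Nat.card V = 8) :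
    SecondWins HasHam ∅ (edges V) :=
  secondWins_of_checkCertificate hasHam_mono (by norm_num) (by norm_num) hV
    (List.cons_ne_nil _ _) (List.forall_mem_singleton.2 ⟨by norm_num,
      validPattern_hasHam_of_isChain (a := 0) (t := [1, 2, 3, 4, 5, 6, 7]) (by decide) (by decide)⟩)
    checkCertificate_hasHam_eight

/-- Combinations of replies for `9` vertices. -/
def hasHamCertificateNine : List (List ℕ) := [
[0x15823a347e02c10ec1,
0xb680f392d555f6e,
0x1538ab4da1d59c3,
0xac4a5bd00911c725e73a458c,
0x1b1ce7ecdae098fd,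
0x8f251c879a8d70bb24c553e3,
0x3818c7f537dc73283609d2f51,
0x93f8c8659c8ed63a,
0x65dccf7041cca95,
0x6bc40730ddcd7555a88197ad1,
0x7c6a7e4d22feaee02707b1f98,
0x36988c0a8bae8b8d9eef74ca266ccaf491484a04c80,
0x462a886ea4af6710,
0x375adca1c7114b3bd321f307d41126fb33,
0x5cba84b3fa15e103ade729b13,
0x27f6a04fb4e67830c06e5260b,
0x5d3a5a5b4d9a9420328c17d97ad4528a0c,
0x13a75979d2199d2d2,
0xc9b1c641fb5d30e0,
0x65dccf70380bfd6,
0xc77ee653da1dae324a52fa830947e50c,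
0x8c806d17db7fb3dbb386fc4e5,
0x13f437494e40b9092c297394ef,
0x3bb481cff0e65654d89e583d40b24781012ba5932dd5c3574a00,
0x16033fec86c45fdeb5620d6851,
0x753664f0b626bd82f5ec3af130a0cc78f1c57d04dfc3227198,
0x18946a61bf8cb44caa15bb6be0,
0x19405e48c8856a2b97db794ab4,
0x4ab9138bc4f0af89d9cc13fa8c188ad85f9d21bd032c7acdea6,
0x1b6beea373743034df10ea2e70,
0x174314b1d13065e25,
0x8be4449dfe6b7cfb8dd7e791,
0x5e117dd964e909915d45f9c60be8298e822ba94686ce43c52e78f49da61cf,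
0x27a28b4f998864cbb3afcdd28,
0xaea8b79b49a53c3dbf17b933731a14678093425dee8,
0x11ca1f949d5aad3340ed67336ba41eba12d,
0x626a3418ca6237092bef317713c88902eb1a3310f4ac7761a4a2,
0x162343130f5ff0564414b761d00135e5b2d,
0x104737458a7d3486f2580c7704e186d7351,
0x17fbe679b9d58db6af5d3a12dc522538d2b,
0x625d306afd2dafd47c099b54c2122001310e0af5c51d2d61199e,
0x181546427e9b5b87435a34249b,
0x91b6e368d175a15b07a0546aa0b346a833,
0xd2332b8ba7cb66a3dddd7ed0e,
0x3719e3e704509b406,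
0x2b6018b81e080e622,
0x681b2ed44bcd592e356e1f02,
0x33e087dc61d1e9180,
0xd035fb1be22496e17261fc8,
0x2276c7dcda8871249d66b1fe0cfd1bf231291812f8ffb031b663e1fa9e4b0,
0x11418956fe0ddf36ce10fdca71b3eb283fee2cae89b0,
0x2171b8295fac5dacb89776715285ed0f04e,
0x41e12c270ed6138bd,
0x7e8d8760072b7a4caa213a28a0b481e40093374aa659edf73418,
0x44d6520d0cc1de144,
0x143427b25eab191529480d0d1c8c377109c56c0ad314,
0x5dc51da126363143f3446c57d7fd3aaf3629725a58a8385cac,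
0x31ce48705e8263f7a047078c61,
0x19c881bdfa0ba0b5e6f98ef834d9835d283f3398354c,
0x14a6879081b14744ad0ea1a11eb5ecfcd7c3514d453ba4723d25d,
0x34e896aa506496d4d614f8b366,
0x291248b8f3b98a8bed142f627d6899477a6,
0x23f0213b1342bb53075313d2d7870d76593cc3824ac200a829099bd1ea70,
0x509f6cb79c13d8082,
0xa92bdbeaf6f2fbefaeef68e1,
0x196a96e28c8ef41f7039fee53,
0x6365446c3d7645dbf68e04bb5b231dc42058f61369,
0x6e52806159c8303c8054f864ad854f6674b7547f612b6dd2a1be84849cb14c24893729d8bfefff94ff0d2b427b1df657ba8631952aeb8699b83753d8defc4cfc471ba16b15a7fd1d866c00,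
0x974412b873e49dd884eae2f2c2d7fa89be54ccde28c,
0x201ca1472cfd2ab18fb6e90df537d56e134cf93137dd,
0xabe782004fc3e6e413db06009f1bc4e36ca4aabc93d,
0xafaf8832ab8be0b70e39ce15f149d19a4b56f0f71d5,
0x36e168c9ef5722704ceaefd56ed7aed735e,
0x1fb35c3040c2d908e8305b7253643f40346397fc0055,
0xb7d2783b3480d3aec5ab5cc08a44491abf8efc700d9a716344f,
0x34636a5631b6f4179954d9338855c3ba562,
0x4b3d4874157f6f15695b4105da,
0x1434cfc83cf466e210346bdc376807a6d63120e5105e6b65e4a05f1d3d71a0a7e64af4,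
0x62703556bd3503051,
0x16c5e77904782bd6e4ddb653,
0x654e996e80c866d06d362c0fce1fdb4ed8b5d43f31,
0x285e3ea3ac47e7af799fd3c69e5497a4f7d149030c1fc6a1120a,
0x271819c66377da3652ce80a2b0296f4488,
0x3f2c8c92c4564f111e5297a98a88efd0b0e,
0x1fb5e1f0a4cae081bc5335f20d9fdda95954a31748094a1d4e328,
0x378c9e9419fddc4cd10c0eddc1b99edb8c5,
0x8e97f92a5b2c768ed2bb0334e7bfcae0864037a86f3f070bc69262f68dc74dbf4046d6501952ee47dae7bf49e7ba9913f99ba71a95175e58d6aad15ec4e2b36915c4918b7a1a4,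
0x50359ac775ff48337c15df0ee735f5c6677d5f073c3ba98384ec395b419f8,
0x51a6f7688d94e0eec5fd609479,
0x2ee28ec7bb778b66bbdd2e40ed5ccc6853bb6a6eef839b621ae,
0x17162ccfe39fd530f7a7c7399b3b5e49d80,
0x54d05ac985b2bd97c162d1e058,
0xf4aa812f60cdb2ec435982de55d67e2c25ea4898c,
0xef8d917af89bf12591262a546f8601b800edb048f723f7179ead,
0x4e90261850e591101c78f497ad,
0x267bb17bc9a4f8500ff933526c3c6b55c479e00ad162,
0x453de3ededbfac9fe86cc5bbeefb0955e9d,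
0xf4aa814a9853c1ec3b5dc501455e6e32cceb4d6b6,
0x3173bbfdd36b59756fc5fd7f5924a9040f4585ce6464,
0x43c3b8971d92cbfcb5a908d636ac9d05cbff4378be59a201fc27e04d42e3b4c1c4d73c,
0x5e131b5185898ddfe736f7c0cc,
0x5f1b85f99f0aa1687504e8dd1e,
0x5c08ab378189cb9c49e2314d91,
0x1c9f1990b41bcdf585885fc3319c206e47904043f97b48af6f30ad074baf0a,
0x4b0610c1d76cf68af34ee56744b76e72ddb,
0x633997400c2d913cdd8cbf5689,
0x63eebc6ef8c79f330b0f07924d,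
0x38e84e961a1b658e6c62e70cc2742b40e56ec6d76f41,
0x8d166205dec757ef5,
0xb680f392d4653ec,
0x48a15a4df1cf379a205695175250681d78c,
0x1cfd32cd0dca6a5605a82b13674e16590c26db4fc4917e7e37d10b9aa38b8,
0x76b0f64266c346e4fe0913a450c30a04f3a0a7cce8781a5c37cb390a4ac949e02fd1377e917b7d8904d8c5790cd2b83e364bcfc1da8743f596132c5fb0badfc54b05ae1c47316,
0xe5c7d0e4c35c2b7cd723af09ea23f6dcc37d336f2713ac924c27c94a2823c,
0x2dff16e6e565ff96b3533b9d9decb7d46fba558468a6,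
0x82fff293aa70e81439cf9de6d5e1e3d916e1406f4a0,
0x6e3a73954134d3c1d01ae18f9e,
0x1ec4adb2c84e0784db047f087e02c7639c97b54060128fb9af8,
0x23bbd2d813c5e2cb09d59d976c58be6e6fe,
0x1286b2a7d51ec66d79896976d7f48d0eb45912f355ec,
0x47585b41b343cf59b4f7bf10ca946fc29dd,
0xb2ca6e3037e7c3644878d06e860196ffb0926ef04e1b1ff8dedd6099281498c859663ea3bc6a4b37fe3b94eea1b8a280490797acb8a850158ce8856b4,
0xbca38bd39f33b504c6645f906d4de9ff71b4376c35f53295b460,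
0x1226cfcdd353caa0d0558c489affd9e70079e4c490b8538977335,
0xb1634b308ede84501dd903b04cd5f3a355,
0x6c271ab48b883f698,
0x402a567a242c125951d3cf0552984fb96b274345eae7,
0x14831e76a278eb79f33a4980b634ff32fbf4eaad3c9822aa33b1,
0x5e6a851f19f2871530c4ba6635ec492a1ea,
0x1536931e13f67814f08d0e6a5cb49cf399d,
0x292aab47fb87457c5d3bb3db2a5e081460a94766197c,
0xe244aed2eede28b1270d6679e76623a6a7f70ee55ca,
0x15b9dbd9d36af923c9e477147b9a39d30a47af13b9f888a0cf212ecc2c76ba3cf5a26ad,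
0x36202e8d84f790cf3f219959408e587bd65bf790ded1370c44839,
0x9d52415119fac6efc132a40dd062051a333c6d9d630d2bd37bf9b7aa933c7fa3d585310e135867b3b654aa2d,
0xa9f358cc3d18b2d9e,
0x61a649bf98a9e10842784445cd793407502,
0x80306796e17690a9a3c170d489,
0x71d9d74a293c5815b90a56b15c80556a43ece2621cc,
0xc46de55987f192c68b612d885c0dfecc86fc17f5550a97498931312d74e3fcd4e6b23b3ec029886ed4aa0a318b724a1477d68f480,
0x7e61ca48e5bf1681f29682eb1e,
0x2d36ec81c412b70666d02051dd4875747abe37caf13306138cac3,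
0x3c898870aa094c33b026b5493faa9ee4781fd45d8c72,
0x1592f91400e2e14ea43cf4a0498a760f80c6f01e2031078359126,
0x232152d40d95a16b56e17586a29756122c1bde73a29,
0x30c063e71188413064cf16998475a37c6fe7347f3192165459cb5,
0x93465570cfd8e97e000c3781b9,
0xadc8a3603c69340c9,
0x86800f37dffa99d5414e95fc8e,
0x189c267a62b46df0a40b08531a7130954f3bb29b934,
0x956c7f38b34112c50c7f0dce1a,
0x1b99c8c554008e13bc046f85b9cee3dce7ee191411d77c8cdbf45,
0x5aabe6511825278d4cd343017a,
0x8b1115dad2b106d18310a81ff8,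
0xcb090097b7dab64fe,
0x8f251c8777904c723454bc23,
0x187d912a7ab9feeee5bc2c0522dd0fc70b9fd353cec,
0x6935c7e604ca100011fff9b622,
0x5b6c151b0eaf0b986ddc28f1c7dee7594e23a5d4824c,
0x30711483b730172d1656cca5d92d2c974e8027cc9c452754fa32,
0x596cc9edb63c206298f2444b1530a11b7103e39adb57e1037cb9929d11cc36e6c11d3ecd692101da39aec84bce3e8cb3304b5552061f8c88dd7b81aef90c,
0x9a0537e7eb95b540557a80e4bbac060436,
0x3e106297a44d8915159d3b1b02c66168d93,
0x1c011e019e94cd9e93655b9179b1c7324e36a6cf8320d17f745ba,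
0x30c4337c380bf2e8dc76581a08ef29779d7f7555b304,
0x340ebb43fb1957514ccdbfaf43f9581ed001808538aa82a41cc60,
0x23f2a74d7165e795f80f330db741f2938ba94782e6be,
0x2073b8ef710edc2462e3173d86fba4e7cf777187a425b7ee408fae645415e0,
0x2659da193e1ffa0c8ae3a8681c80af68698547e81f01,
0x42c8d28e1e434f78402b50231342d7b74b6b9c43e8746cc3a082d8f539335127df92960f2867e7d913d92bf8a24c844d3128ba5b5683295f2f973fad12799fb192f6,
0x648ddd50acfd653ef774e7370223fe237c9c87a62868,
0x84a05ffd308cf6055d5dde70c42c2432cf8,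
0x4ec83a50f72b53d859d42e677563883b27913f8f9b58,
0x25ccb0acc8efa35a6fcfe9f79e5eef05aa59e7fa2e420fff93458,
0x4120f7d9a470362c388122543d611d50020,
0x26ba0b9f9259cc1062b977889c1bdb5ffc88e47063f18153af7de,
0x19d3e06d2937e93c57a7e4b4908d78c8fbb85f141d552acf1962050826722,
0x4ed220c5db966c62ed2cb2a4d544015f8f21936e8e9159e357a28,
0x241d4e5eefdf7b94b94e6d031ab0e6f22848aaf1e4ca90a5e4529f360be36a,
0x454517552dcbe2b01bb8ce6df717fe5b65cd0104b3321e5382869,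
0x86f9d3d09877dd792fbfb6b123841e4727b,
0x84081fdf136cc1451ba05a4020,
0x728d69e7f515f012ca6ed2e0d5cd62d8decff00355a8014383bfb92c8608,
0x6c45fc3d17b43c905af0e4f413d85603474fb8e97820,
0x4d24e98452147ba30900d38048a784f3fd3e95a829132cd01fac2345b14697230ff1efce4a1534f4a9280fb5166d2605f0bae1949f362b602b3c57d0d3ae332755d8fbe38ade8,
0x8c855874edfae95e4d7f290b0fd6b2dd486,
0x6c4bf7912949c9f4c975ffd7fef27776dc81997ce29c,
0x2ab1020eb5fe3f99c43182595001acdb6b91476f3b2dc13c221f2,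
0x5bfec94baf10f047aa7a16ea07ec62bbc259148163d6,
0x65438b79b82f2944aa4d5b6e1911187d22c16288d352,
0x241e50f76983bccbfe2235f8ac,
0x2d0c3865d05bd7735a67dc30cd,
0xa418f3b468ca5f24d5f66eddb378e2b9aa94ebea7737a5269f0,
0xb22eb9f7f91a90d84972e9a86c,
0x2d6b7a559f8cc9bdb4eb8f558481e62f3461799ef34f5fed248,
0x508cb81be0a5a5bc5ee0a7eb92b025f7efbca5c101158b2bb5320,
0x8fb231f5955b7bb2ebbec9773a3119541f3eef0a610db6f2feac7f28e2e5b9a6d11e0d430a099df02615b07c0d1ea4bed53174011efc8c38c4fb8980a75,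
0x723cc548df5816fcc1f2414ac246eb25652f66b8dd34,
0xbf1cf31b2233ee5a1fc5aceb7a,
0x6bd063b2a112b81d4e2f529e2f29132f5ca04795f578b20679187b0a241b,
0xf1fbe647260facb13,
0x16c5e782c11b22cbe2ad5666,
0x3b85b7092e796b384cd0556c7d75cb73ca1d3e5864f13091d93296796169,
0x16cabe262e7f7d05b5b663974b361ff4e6d8c42b29731fd7bb8c432139ef41c3dabcce9c545ec928,
0x7733cd360d0ddee13b7a6858e58a1bc897ba4b7b0a4e,
0x36c2714a5f6709907bb6de5e2fba986c422,
0xc1668d3ad1f4db149fa195b26420080a2b47d1439c8e466fee,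
0x4f14ae52113700986eca4a341749749f75309d69f59c,
0x24fccd509001cb0b8dce3a4901d7bab78841a4fd3797,
0xc50c3cda74ca2c6061e9dcab6b,
0x30eaf5900459cfddd70f35486c4317b37bbe06a551a99f5202a6d4747cfdcd,
0x7ab45bd7f31abeb3f90d7d49e720187c7978313a81d2,
0x774155c22e54c50b659add07f4f93253ed3fa10fbca2,
0x7ab4c0c55c53a5724c219df2d5d041969a9f72f62f89,
0x672abcbb6cb69dfa5d1969c5afad8e8b308,
0x41b812741467059f67bfe48d7b767925ad4740e42c5e,
0x5ff19fa6245f1d98e16b799acc57283eb1ce8585b710,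
0x170dd33bfa8e811ee2e86dcc0e145a96ab4cb942ead7f8c26a00e9a1b2a41c6138bea002b722c383f4dd0a90570c7784be9217b06b1a7a02b8613d20e31136861b091b4253b546cfd04cca7164d4c9e4dc23b7e4,
0x7dbae394517773e72ffa9346c2e25731a0a3832d07f9,
0x362fb01ab0c9740b677e190b4cdd4aaff0d6a92a34a9d602c52b1,
0x65b2a3deeecb2c05d4e765833d6e7429bf5fd198c30c,
0x4e11defec0aba47467e94ce2e8f648a0b032804e41862111d07e4,
0xe1d6bf8977947974db96adba27,
0x320cacad00dd275067a54ad7c0f563365b59a593d370,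
0xa9b408e0248833d41666c6fea6c3f025469,
0xf61ac988119959e96e8bdf16e51c6b7b22123432993e3a7db88c,
0xa76a6fffbc924c2380217f8694f34230cac,
0x5778ad1cca5921aeef146f76b46cc89f3429e16e1a0c,
0x558dddaa79438e24b7a760103f338f418e9287ce627761528b51522ebf9bbee23bed23d889586051a34c12f8d1d24e5c43e1f0e1b465cb932eed49c34e3,
0x40d37863c289a41c7331f168efe0166ef6f,
0x5688dc2394440f8486ee1e859f82aac54dc9c8bcca9456ab4e3aa,
0x5062eaf323be55485ce98a6d603eb42ce14b1b7a632d4a4943bf9,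
0x4131ce2f7a50c9aa816c8ee44381707ba23ca845a6e8b27cf9540,
0x85410f6b312b880e310a25979e45bfc9232,
0x4d58aeced1c9fb3af5e649c9a8d651b9c5b19ab0a6c4,
0x6612c061486cf67e95d7ca7d9d0082724865e1fcd9bdb4db085a0,
0x8a67d461460eae3b1cb0fbe56ef1ddf8399,
0x22923e6f9081fdcf4e029521fb5d17af7f5d29f86d486ab4edc31085656de4686ce6e54353a18c5f4d7694aecbd3c3e17f361d550e517537a077a002916fa47f3f960fed94640,
0xe8620255a5e8f36e763e88e806,
0x5cccf608930f25493ce1cc44feadd7c922d5e40722b1d8eadbc1d,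
0x136f3573c2b7a571fb,
0xf52b0409f99268d23eb9963fa0,
0x4980ba0d3f6b9b6b6c0e3db0b25fa7f1a05,
0xf4aa8107265b7ffba1ee2546f5cfa2190c5b5b3ba,
0x8ff1ebdbe58d127b6bc5c6f190a0aa029851bc5d389bfa39721b,
0x7d4c84efd6632918e37d5e7149b9ec712f49d5887a03,
0xe940719c6988044b040fbc53a172d78bd36ec7ef18e5edba1c3a1c0cb4339ba4f6e51a674aa99f5a5495d8c6130330244e7e0f2520e0e4c2,
0x476aa27a56104bb0c92cdfcdb0f0c20fb2a4e09d114c,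
0x7f1d1e6de15b580ca88ad15dbd589bd22740a8002417,
0x317f9534cf99d051dbf81a8c6c,
0xb587a604487b45b48c0ca39508790915b50,
0x967d8b271197a41ef549843cf147214baaebc2671d08407caba1c18018d5,
0xfa8fbb17122d73ff28228e62d0,
0x2f406a212d5a6f9e04f1d53e999d149c73716fc4dcdf9293e5d,
0x340135bfcee706b1c9cd934ff519ab4457377b63d5d5fdeaa6e8c48d710aab7a43429835c17479c012a4163b99e4d6ad14fa88f62,
0x4d084f7e147a5bcd90e5c8a69cd6244b770],
[0x1201e784eec7faced6d62dc6d31289946584,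
0x16bffc5a0b7f8e4736,
0x1292d9b8443764082de733973b7da0aee345,
0x262f235669bde0bb3761cd0728cb345e2e1dc8db6c1c4371d3443cd1d05c,
0x2b20540d6a3c7726cd976cf113fb250cef75d6c93766e12319fcca7d158ff8585e784113d5a690dcc379390b2802e3105ead54ad787297a948d7b783296,
0x120033f5e89414778653c9bfcee48810a5d3,
0x128ce718cf03c8e3c2834c6fada2552d4f6deedf62b46,
0xddbb51c4267e97399e7a58874fb372af39d5b108eb61fe0790c6c,
0xd67b938fb3daddc526ba41b15f8e63573d675eb684ad,
0x1304d4c10f4e995411c238c994bbe1237e2f5d3db4af8f84c8ab70adf0be992c41e8b0d69f2d995a5d0dd32944897f6491564d50,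
0x1d6b8e2ab4b14f2cf7f8cd6a790,
0x12c271250c721bcdd4dfd651df99346372ae420970690,
0x11b3795cbc100129e8f57382a4ee91b0683ec9f75da6e,
0x10035fe33badde70425b2e6520cbdfc9a9d7380933af2,
0x182eeeb9252e4ab6cab14cd47edbf3f63e89,
0x1400d3de6b540ebe343e6cbaa67655cc13c2,
0x569a0d729aa3d0780e216a9f4ad0fb37dc4498745d58fce941012f7451f0d447754effa656f42bca678b95dd233ab8d9364c196b3b26de1dc8e943d634,
0xa871d4ae8053681490178863af96ebf688eddef70bcb6ed7c44f4eef006cb3,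
0x205d40d3c36667bf52e22c3e99b,
0xf568fbd6a512469ebdf9d39123da4783dd3f85791460,
0x12f78c22aa0b9a662304c9425d4ff0f1c8fd310dedc9b,
0xa05d8ec2e989de1a0c66e928727be1ba658c629ee014e9bcbdbb8c6b17a05c,
0x1f036b88ece7f00b33b4c29b3f9,
0xe411f4fd310cab1b20133a776989b590ee9,
0x728d69f572617430afca355d600fcc0657bac15adfe274c726d64e14bea9,
0x3944d742880bf28a7392362a9871896f7e33a823143ba162c7f26a6b1d44bf97b1a16d2114e2ce7e93879679c1cab357cf67cb13ca92310ad42ce29fa68,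
0x1fd6925e897a51bf81c56296808,
0x2062e36c234a123a3eaf704889c,
0xc2f7dee29c05cead41bef20c6b5db0beb47315790b,
0x16ff01d4f8612699c7d422ab13884d7a243f,
0x11bd8cd71feb98c5926fe615af9d31ede5a1c5b952b28,
0xe7df51171ff100f82393c99a34375047b32bcf6c7ece,
0x109d6c1b018d4eeb8f6f4ba7570d0a76248f0cff0f332,
0x13d6978fabcd090249143abd66d6a42f29fd,
0x17c2190c95803f1ce72919ec347f9fe83339,
0x1e962cb44a81e33f4a,
0x20cdc4eb7fea466c101ddce6d46,
0x2a592909ee99b6424e,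
0xdcb3c16e77f7ccc,
0x4451b682a75666e237e244ab,
0xb02df9108f84882721a993319efe72372524b0f22348b9aafb752576500c4bf79ada8f8ed98304,
0x2a435c48ea42a3e44e,
0x16e9b90d015087b1089f4997dddaabdd6f09,
0x1611efbce5c107a0dc69d7a0b75b251457e6,
0x2639e912b75b9b033a7f4f93a,
0x67d3a5906bde7ac4c7a316cc0,
0x2ae7b56c51785a5050,
0x87d114a852a42cc,
0x2066fafbdf7da10a7e8c2f5afb4,
0x71b384e0956b2126ac2f3d411d3b2e36f8c8cababac970993cd68ceed12f2a3cdb233b2,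
0xc2f7dee99315b68b0dd7072cc46711a388af9399a2,
0x6f7c28ddd688ce0f95853c3966924291f62d8f23950dbb6f371e764230bd9de865f6dd1163faa105ffc3abf41513a9ceacab751560ba2b5373a3515b96aa84ba18d454c714bc5727808c9bc,
0xf7c0deb09157bbd1259586ddd9a54389f5047a1ab7cd,
0xf79b402c3dd1293eead312c92c348992125f1cfdcf68,
0x20619dc8af6d1848d2c75ddeeb4,
0x8b372fb9d7341f766453559162cf11df42184654ed3a620437a7e,
0x18d35e4dbd3f2df04e434b915a582d5a19b8,
0xc19829b78ca0251a8c19df353e6fff64d9fedbd8c61f,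
0xf484d0755b0d7131e5c5aaff009a4f704d33199aabd6,
0x18a2710f826e19904355dd90d0ba1c29c2f1,
0x12a4941410400d16a9fa8879bd,
0xa5c4a5146ee78c2ba03f230f1d8d1d2d0d347586d4,
0xb40ac98a3faecf02c13f5ce45bbf5a2394,
0xe68d3e881c8004bca8ce7917fc681232cf534c21edc66e0acaf9b,
0x1a63abadaa581b4d9588f83612,
0x1df4042f943a32a39044bfb531,
0x17e787fef0b3cbd507e76179a64f2683ace,
0xb82eaa484b4104dbfc63138cdabb3a2f73eed55fa775f4d5cb417ebd046e,
0x1b14443eea2fe6d0a57791f78d,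
0x31441005e08e2edbb227755aaef8d19787a6176cad7d6ff7723d,
0x132f064ee8fe025351629d4f102e77c48472ea8e9205201d3ca2c17d67247a2d5a503632c4ba816752e07b4f794d47caca44321e411de9cd56da51913ab119bc0922a0,
0xb2aeb695997da72c1d76454dea34e487c6,
0xcbecee1d043974fdeb5a67ffef992e7c3d19dea88c836fd4c7230,
0x16f924be7b50452d5cc21eb6963,
0x1171053d5f47244af0eba8ea703,
0xeeee8214e499ab2aa50d17e3e6d961dcc8b152c4a8,
0x1be19d40edc0ee1daf8374604388c0c33d91ecf52dea,
0xf8132baa7874f64cdf312d6266d3f9ed9e3871829946,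
0x16e70d4b66ddbc9a4ef153305dcff1c29a6e,
0x76a857fa4aae016bd32b459998f9035d528089aacd52c9dcf4af673019bdf0f6d4ac95e,
0x210b34810a4fe25fed33a6ffa3,
0x1fd7b72c9dfb64cd81a3ac4bf83fb42ea5113c7281,
0x1ae8142dd4ddf72bacd1e19bf0c534f692f,
0x247b345a2b503e89ca5e211c08,
0x11e8a1dfa5fd571afb5f859ef8b38a6d1a54,
0x205f6a3d1b493c2a3999434b95d,
0x33e487efa559b5344,
0x2567cb31d7a23813fd6833e2038406251,
0x1fb30f7df99f0bbe8b0160b1161f99bf3e7,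
0x1b95c80ede6c6d483d6926dfe1c,
0x213104b08eb73156981cc88161104916470,
0x974bc122d4e0aad9e2cf0f16bd60e8cbe33ed54e7c4b7028a6f6e4b8ab5c,
0x34cb0dd96d37cb65e39fa50b89e557cef36065721b3d6d78f365271a33a13381a17462904f9c5afe1ba7429d8b121430014dcbe94331068d841bf85ba47ff87e6a362d0315909e0fe4903624fdc4169a7c2bef51cbc81792b24a14f1d80,
0x8ef78b2562e4ef632ec3f703bdb35da1c897a2d2f1c,
0x35aea1d1e4c39fb8f1b348bd67,
0x17023077d17a1713e31648efec9,
0x611091d236ca798a209c8f1894ab9c665d781a5a7e13e53e25a1fbe102dec2,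
0xf769c3489c3ad03e6be8d16334d3c442da12d7897ffe,
0x205ed0d4766d657fac3a9f43f7c,
0xb0adf2781598ed410be94bf480de88e006c6ee4ccbb487f9109895469651fa,
0x3c1a93b4fa62df2fa93bfba977,
0x205e13b42ab14d72accb30ec856,
0x111567c250f4ef1f1c529315ba7fbb9322fcfbfb3dc,
0x797ac562fd542a2dfbbd2de62622479677125529066b82e01ed1f64d03b51e124e8bd750c03f5bf652521522466539c969623ff6562c560c6d5969d0e8620992e35528f3fdc312fe831c8c0,
0xe3aaa10387531ff69bbe66e839208983fdaa54b0b62eaa7576f0c,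
0x12cd1d571b32dc33b66e29c8478443132ded3a23cb0bc,
0xd8eac9907c002ff70f398ddc8165278ccb27f1793ed7,
0x205f495ab5cad8883fac41a50d9,
0x12440b99bdd92b2f316b14a74e6e189c8e93e1b6f0ab606300b4a,
0x183b806c4bd8e1219ac64301cc7,
0xd1670cb5109c4f2326db3d11b08b2c4de184041b19e,
0xbbd84018f519e6aa6f9d002e591c210168b3532fe87e2ce698654,
0x3de178a41b7e8893c51e747f2c1335cade9bd54805c57f0a2165aed7f1b54816e5f9d2e990c398dad3af6515501eef5999e9a60a2d67d1a793fedeb0910560728a8c3ebcf9bafd9893eb1917a51287d134d69cad1e13b64a4b,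
0x295c7f160795cdc82eac6074f5f33a7ca0661b5fb722,
0x74a1f920e5d4cc54eb2f49ccfa4fa06e5556e9fba4500888fc6e55147fd73bd0e19bfa6,
0x1d6823d9477c217d4ff0fc4b66d,
0xbd076770a17ffea76ae32a98bbbf8a7d9b1f02fe51e6b45ec1767,
0x92f4eab2892b9855f4f2ab71bb8ec498ff0d0ee7c9759ec75c87fb1920fc9320976b7091326d99f5c5b86a21dd9599f5aa725c20d245fa1b0cfa3b6d92cb29383ab864966420b8e34f64fb5,
0x177a2784dbe5ce4201d2798955138ef47af3,
0x128cf5a89dc174e83c3f80245bb4da9a31c967d8504ce,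
0x8b40b5d2ac8469d0efd6ccef377df415c7fb9c04b573153e7ab5e,
0xbb0850c1f29f3df4bf0f13cddbfdc113d97a574cfd4cfe4f58584a7ef256912bf688dec0d16fee3c175eb9754f313f384fc343cc1dadd69db98f7cbaa163491f8934a,
0xbe525d372c1e70a0bcd240c8cc9060f96987c7c780e4ce6500735,
0x1d69458b575805032d307bba936,
0x1d71436df83dee176fe4c6d97e1,
0xc1668cf010d7fedb3b53e71c044cbefa2f175bb9d56835e8eb5,
0xca03739e9496ecb94e0bc651abcb2c75632b0223fb7686077e43e8a7e55267ac91e5cfd82a771222d5b8250e7002e1d1457233d845b52fcf2c81ee4c5ff06982f6e2b,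
0x6fd68829b0793c6c7c81de8e5baeaf3ea83b1093bb63fa255795dad818a2ac5ebaee086684b39978f8defb71fd51661a676189ddd2ae21e8cf15c0bdc59941dcf17a9fd27f5456be96917ca372851fcc43a6b8ef23a3194dbae007efb4395e8c34fb09d20fdeff5d98900768233b729ddf24b4161e286ed64c4af3b60,
0x747224b7d720590872dbd6154a7a5e4270f9adb1045,
0x109b4456b4003450cc991bae3989733aef28f39a291aa,
0xbdbecf080ff6ad6e24f387b46e7a134fef0c11f9541786fb06a95,
0x4375439739e838014daff20c53760c9ae666bc4a811c525dd0e5e442bc4328fd4744d4abec0f766ee2e7aa178e18006a,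
0x182d87abafbb87541fd8288aa29168b66094,
0x438461d3180e663d6e0a217eee2229e798f80d797717e1ec3180896a84b64b52759aaf60450553a191c4c71529513cfb96fda8d7a4d28b09a799eb9000,
0x1e2a9ca88487d334a21adb08258048e5549886eb3d7bb7c3edfb8,
0xee53b7fd51502c81949d5a3e2e69cc43e75,
0xfe11fac500d0312dde7bfc3dcbcac69d6f0c3512889c,
0x31d062b540728692a37d9768e724a557b171a1a713b63f00bd8d74683e4b7b8862c89af526f3e044f36a879ce8578f73bddd13b91,
0x3bae0bea0106c1468ec2e408dd30829758d,
0x12d92e7659a1bae93f126d5f84cf8ce384f435e247d9b,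
0x128686b52d1a95a3088db3f8a5757ab44acbddd300555,
0x12057735b3037aa303283d149aabf473db20,
0x47521de365862da1098ee7ad7de4fb7a5d2957ca05d7383a8e326be3e62bd9fee237472590ce9400ad5afac949b067b7efbdeb24,
0x13f060a187324b8d8b30902788e36572d53a,
0x17ce7b48070f5054267d335161a5330f965c,
0xbd62fcea041a6b0a96ac1ba250066ad686b05335b9f4f1868934e6218ab20bec67920e590b0560bde3e157e8f9835156,
0xbb6b7669b20c2a2eadbf4bd7625f2e761894b46743c8f60d9dca9,
0x151ecd2a7bed5cde346b147679acf5355366,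
0x15bfa990302eab8d0d801838efdb807d7ebecf86e37aea26baf2fab4ba1e45b93591d94e30702e2533c097a,
0x17c61265ef24fa5b83ac7730fd333f4c0cac,
0x2acfc98ecaf27a8981,
0x6e59e0d33a9347e,
0x4451b6821ded3cfb4fca47d7,
0x384c73115b6e9222899302a011675c78c50ad0d18b59,
0x1a57c88e07a460f8b181a09e8a8eeb5def204c7bb503d59becddd2ab3f98bf4664a8e101e6b57c681b5ce5344149f48f321b6a17c6,
0x74d647f08cc92ab914397ab543dd4be70aafe9c885e1b1a5d7d43a81e186329a8105cb4db6f65ae831fcab99ad0ec5f50a13c7904e881ac3ae0ebdd2dc0,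
0x1277f38de30fee02153d6a6b31a34dcda51e,
0x3aff97ef66031c477fc14992156950fad5355c8102ef,
0xb89babd9488aed4d867b90ceece54f8a967fdb8aef8adf7f7794ba6da845b30c526f0a6e421e094f7c1421ab07cf00e7b,
0x2a604d696a5098683c114a36982c54e8c27af56c77fc,
0x14febb31034f01df748e1a9459b34cf10361b4797bf81f30f7e648cbda64df5140f3487cbfe6831e22099978651a14513134a35802b90b9d1ab6980489e1365419eb3113261822485147a2,
0xf76c288a36b67f98e21263befe58e86fa1bc417e9137,
0x2079c4ff998bc59a69e2b8465b3097698b1ddd2c7ce8150fbfccc0d00aa287405bc4af364f2c0f672816720e07f4535fdf09c608f9d4f760a8872325b2d,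
0x273afedac013a61c5cbf89ea364a40c219edc7c2253385e61ed7c176b1a612e6f443ec48d67f4f703a1dec977d3616bb27586fb11ba1768e9f3a7cb83ef177e6cef12fbef3f56685b3e4371b0ed2eeb435bc628e8494a43f8fbf401fcd89d036aa1b3f03b8a234920338edd8966fdba5978fdc04defab37d27fef828,
0x161074d143ad944782e07d0df03d8a4b7ec5,
0xd7c68b726fa863fad1f489d9fe7b264cafeadc0e2c34,
0x22dbdaf0126072f5744ca13c7016d331860ae11e17f28993b110c0eea9f5b625d7b7dd5276fc602bd96cfd16a27700165b,
0x37f49820c8e1f848efb84ecdfb7aebd6e92ef885b0fc,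
0x174bf644f18ecf66160678a903b29f49ad6c,
0x4a3ba8ee5949c985c82e30e33dfa8ef4d00,
0xe296428eb2ea1560621d2ecfcaa0cb5db148ed578d9e,
0x13ab0a0c1b15c9cf59dee26995,
0x160e7cf8298c0bfb46fca55354f4cd227235,
0x3d895b66d7c4acf102496fabee9620978118e2376eb6369c8a4,
0x7f304ecd7bd92d9d3bfaa2d075d7edeaec6b4e3a4ac6c9ab8635ef2daa8bad4e786ce4b412065aafd170414ed3927b7dfe88705b8,
0xe72aaac888c61a7904f2793656ed218debf1e522fa97e675ac59c,
0x8a812751cc7da9c90acd0fa885,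
0x20c5cefb15ff1587b7a57873e35,
0x1fd1012ae6b62a42f8b7bf7c482,
0xf5767746c763391c0da6464c0b14aae9de6,
0x1aafa74961b1c9e06752374b986a50a17349e01b5d1015347b277cc7b4dc3afbd0b23,
0xfe410cc8301d274b28754867f85b178edede57642c3c,
0x205d54c7deb42a5e56f4ea99a3b,
0x261814109dde9b232c215b10768fd197a0012490ea730264400,
0xb6dc2aeb33147aac2,
0x2064dcf8e0803a31c693208f0da,
0x753665298eb4d7fbe0ae48601835ee04445825ad58cf617801,
0xf45ace2402186e4481658332dbd7a30dfa9c62954c93,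
0x64b6647f7fe607edccdd9b70b01d29f5ab8,
0xbccc9690aae0445cea7a527988e0dd68aba67a08673941e4df616,
0x4652798d6da2e637d55dde5971d619fe9a57569a956a22e8280eba0eb9e3bebe972d4bb5ea3d9ba9720052ab2,
0x869dea5e4f8253b51008d1fe08b73985487af345fb206a86e5a2edf75b1809190580ffd56898c042a111d0307c03c0f552394f76bfa6bad2570a229337e,
0xfb4e5a04c8bc1331a159f6f0a75f1039510b7e43fffe,
0xc6abe61f32a2a0eb594ea200b25d5f81caef0c8deaf6d660dca50,
0x11aac246c487849f86c72d3b7dbc2824a37f2d1c241d5,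
0x3b8b5d5d9aad2c40634d0693fe52d9dea5e95b572e136567a87c6,
0xea1fc421cfd96522a501c475b4900fea517430cd03fa59a62f458,
0xf524991c465942b7282521dd40dcbe18f43416489b8d,
0xecbf64bb710926901267865eed8ddaae999,
0x170312ddf16a95ba15d9c82af6e00b176054,
0xae36c66524b69ad5e7f5de7e964b39615a69b6961f5110ebcfe1deb2683dc1,
0xa679bb134048ebef7734d7abc8eff09e181758abe30248c5e4b9c,
0x834ca8d50d8432e449c4eaa0c4d8526840b46b5a69edf177b21be1d743c655b094e6b87878d79c97383c14ea3860d23a4d3bb019b180c73b2620efbe374,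
0xcbc309ec518e5bb5575d8bae173a1bf2a18f853343e90d6e9611a,
0xc9e80a79e11d1e3e9e23f90f5908a51a821bb5d096ea8428d611e,
0x168a7786e7305b1a787416fc9466f2447ccd,
0x3f1a2256d586cb598dabab981663c12750b8de70e5ff957538f3673d15b1c,
0x463f467932fa711617df472023d741cfc252b258a814,
0xcb57a43956020aad6acba557498baf6392dbb8d40893c4bc771d6ebab8d1e35c55ad0a2e7aad97dd688bbb15633c83386de03bcc06,
0x69b85820909269c4a1a53e0b4d38c6c9bc2c954e22b01c06653afc82f6468bf47e1bf9a6a781e8d7469a4260,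
0xda5f53a7c5d016c09bbf4501e87f4465b0cef41444cf,
0x6c009d2f42bdb56dfdab85be07b9ef361e3,
0xba20d4af745b30c2680683c9ebb83c6a033091a8dbd4599f2825471727f5a5b18e5a4e5be5cbc1ab61a53e,
0x6d9497c1a60d57262a58ce518e7593bdcd4,
0x54fc260d0ddef0a76210c2a5815d129746429c8233aaa42ab1d5829fdc0367c3e5fc0eaf0d22a5023500327b96bd37586,
0x19028af393e477c2136e05e08f21628dd20a,
0x13054a2fc8b849bb82f4448a4f8c359d84bb7f75e2d4b,
0xdd755430ea10d5b58c344b0c35b95f6958a8852d470,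
0xdd04be4fa85f7968a9579d386b46d531efe03d457856,
0x67abe1637de0cdff061b72ca5606d391f0a8b648f75c,
0xbd09c00c695de6a59eda0b4055a61314bc2b8ed55570c1273a5d8,
0x4c5f6659203a0b23ef0b7203d70fb7713fe69d8f9c4a86ded8026ee53bf0734de9a0a79825a604fa24ba33c82fc61e3182faef085,
0x1a41f299ad1cea19262f20eb319f3598209fea3b6720,
0x5f377e682b5e8afbc9ea5093e740ab1375ab6172a5c7,
0xbdc55e669dc76ae74afeb395edad1152983cf8222b46,
0xdaa92a67d480b717d5ec2e1c2ca4e22959944c1ecae8,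
0x1003095f6bf6e23f85b6828bcf060905534be9add930748108faaa3477ccbad5119453147ed429bb8254a5764549865bcce299bf34a75c9c3386,
0x1722d3ef3d9deb56649af6dc2f4d60ec93e5,
0x338da12b0cc7655915bb09334b67ff86858dd4a432c401ed3d05d38642fdd7,
0x22f3aad66ce521debb8ed46e891e537a100,
0xcf868632d5e5e7a9d27ef912b3c70e54f9ef1e6edb5694e1b7b3a,
0xadb1952c9000fac6249ca36f3d2931ff39b8293bb5b9,
0x1195ebcaeadeff306a3f7bbeecb47c364439ed14800b5560654f253a028e89f8dd4357ab4789b1ee7e25d468c8d160830c09f70ac755a8ad1f980e7fc0e144ad9c4621f52cfa17885b6db73,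
0x11fedd5d9fbb5d417dd08bcb88cab9f4ab0d7aabb9846,
0x20c5a09513431faf899e3b5ed88,
0x7f86c2b20fc90ccd6f4a46ec5c00a589bcbc8c87de9979b2498815b7bb3322,
0x11104ee0c096dc6735586598ac694e9a324d2b1ccba,
0xc6c36df9a3a31549afb210abe3e9d5d803c1edd738c95e0a6c154,
0x8105382b0e4d8580aac1b6691b0f373c5d4,
0xcdf3611d3ddbd50234d3d33bccf4ae00699a15d6f5e0,
0xa65f355c89af89f7c83c6727385266756e3f1ddf135a0ca15a1ce,
0x2398dcc63d66dbbcccce02d2c2218bdb7e5d9b0e4ae9dfa98696fa2dd4e27aa07c5702b23132b83ebb3fe34910ca5b6c1871e54306eb89bf1f14ed9b6cbf676b66af01170de68,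
0x1201096385e92a67d4bcd856c5be18c66e7a,
0x11c50c73012ee0c64f8e252782ea86648a6416df9b917,
0x5e7a41b3e09063d01b9d83ebc010a8036d71b7875da,
0xe2868dc8285eb65799f8a14cf528c4877b5fdb535dbc,
0x12d738d8f2c18cb46830c80ade6dbd3031f376fc4c963,
0xbe52f96f0809b69166da3f45e32171ed87397a54ef46b8ec3ca1f,
0x6f7d49900bbe3238b385ce316440360f262b25a160b22f8251bd49ec993f83670a78e74,
0x3c9618cc02d2699998eaf8014cc9dd3990d871cb208d27257aecc6783c488c7a8922e3f550c724bc9c35faefccd5e88e9d9665f2d6a31ee68baa766c375,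
0xe28599dd95e38b5054b2d374f9a224928969b28a7383,
0x205f05ea2d97a86738401ccedf1,
0x73c4a21870050dc5f2951f36762cfa6a010052d31ce0,
0xa947fecdef60c9499252d7659eed1f2d7b1b29762b6b016ea7a53,
0xa9f899967daa3c7b66d41ab505e32a1bc4f,
0xc2f5b089babffb9672c808147501e28d8ba490ac36d3f4c177875],
[0x134886d02c90411c429a53c1d0ba4574c4f9eb8b07f63fbafa3fbc,
0x277b17b0246c593fed,
0x2776ca60e72fa4caae92e7d5371,
0x151008157b967cd9bd7aaac01a5,
0x313dcba61d3c487a53ab9402d88,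
0x1bedf60cda2b483add1756248b4e91e31f8594ee667805951f6d,
0x1228a794608d5ee15471575ff39419338a0a5b4fed8,
0x30dd6777ff4c76e4861e3700b12,
0x1194f59b777ca84e03f02ee6daa47d3e80a481fc2c0c1820c22,
0x974f10be729ee772f022da70322ad56f8be1e6f7ab83839845f80,
0x10f83b1cbf943f572c27a2ddcbf0aebff960c83941c9462f9fb9345c8af454277339da7eed5cc05e183368cab8a73c8b4d4d930a0bd118bf4654611e0dc10,
0x1a03fce38f1e613734baed46766dd848c58f,
0x11113a2a14d5229b79a8646f7fa293d35031a4f4deecc,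
0x1ddbc42f16014eb5fa709a31d17,
0x930087f581319336850e66c6a35c8eeb65b9caf65d8350a8cd028,
0xc60616e53a638cec91e876ec6e70cc78cec97c478da9,
0x2e595d92413c218685d3832c0c2,
0x3b85b718153bb06c3b73ddae44f203cde796f4ff83cd3a79fbbeffca5ada,
0x30dd24a56d9493aa6a6a42a0e58,
0x150b6790dff11cedeaeff60dee9,
0x5d36d6437ae833a69796df3f3d9c53372579bb43436630949e31a1dafbba,
0x313e397bcb5e9c15c74a99a9ce4,
0x2d5025ac472ed8468098d1dd360,
0x25ba4b62689f70926ef3f0938770279b446d,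
0x7c89cb3da66e1912d72b2e9f2932fc2f9fd8eae8070d10d5f90,
0x15dbbc6f98499baf35c13570d00662b8a9ce4bcf4d12bf2f51ae00,
0x150e75fa64caf5a63ffc99d1739,
0x11c76b4e514174f99e503d9e13bfc1fa3adf,
0x2571480de5b4b256cf79ab66d09a7588fe2a,
0x74cc6bfba2b184b85270b16f0307fdb03c9c158d83ed5f0e37cc307f95f0,
0x195bdb52a0f34615b9ea3034471759be9067fba0279ef6c590e9b5444036e482e9dc11d0c16b1b0af800784245267cf617f69a0c12313cd6c9c92ce2f10bc,
0x9b59e39cd8b6d11b83b6bc895d2399007a0978e2e39e461ba94b8,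
0xaa91bd365d0eb6901ed5a7e3bb4ab24e39362d2bb32b,
0x11652259abb52985efc7ef34b777278127b97eac88a4,
0xaaa4c624d38f76954c90e8bd5769c515b2dc41840e3b,
0xc7027d25a902af4187063749740ca8dde4d56cd6b5ef9c1239e80,
0x1a99127cbc072a08812097fb1eaf9f5b77ddcb713c1b0,
0xcac8f1fe12b31d856b1a2a333f3145232095ff6e1e85,
0xa3298afa0c835e9a30cf239f30d2ab36756c941e334a65b863c83eaab9319af91eaae54227eeb6af4ecca9e85d49bb12ddb2d214392a6a500f161ee80116c7b351abd83680b29d,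
0x137864f393184796c6f5592a953a31d86b2c808cf3930,
0x106a046f6d6915c022392eb2bcd0d3025855736e593257445c9a4,
0x11b5d23b9a850dcf3b0ccec8d32bee5573a37fecfa332e7fc32c4,
0x10841e46e26f980f35821e75ed924c072529b3792ac2c6905cae691dcf8c0e0,
0x1be5b402d53c8d009b22b39127b19ade8377b0d195ef0,
0x1ca13af1ea2714dee4721618e1bf8b955da51568e6551,
0xa760beeda05a9859e1f187a1192b64ae1cb6b9bb7184c94b2c49905b9c0136d349e81f1cf76bcd49c7861f8cf53306ef7b919320d083a820fe933f9c9c5dd6c57030fef8e67252,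
0xb94fbad5c3508fae982d08f2e669d7628c987f2f0f3a,
0x30d628f25477bf8880568f003fb,
0x192ba29e8e3344dac7f5c974cd8672393de3,
0x23f0229629aeffe557d15f29a1d6b0bad14dc392441dcd1e3fa47d299fa,
0x9129cc245a5b0826f7d3158a35d8de3d8b889ff45b8a3d55ea2376b5ef2898c2ed44f115b9b225f4,
0x83e1eaeaf09b170aef48a55a1483afa523a4214ea7ac5d1c9c776fd4a8b2d9c4ae32c7e674c751b2f9b3186f77660eab84730f25c7cc52c77c16c3c739d459f3e13f22bcdcc49885b27d128,
0x20d076ca02abdd1961d9bb6784297fc0c844,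
0xa7eca2c8dc4ab8bc618ce51ebf3af6ea5b19d032c364,
0x7f485510f6c6fe9b5fae90489ba62f40a0f2229bf596ee6fec4bec6f7ab48d7227fbf31,
0x3cba191e82d4269a12,
0x23f0214d55eef20f2c1bf48dce2c6b7ed481a9081c73b2123e3c373d6d8,
0x2ed77e05de1200dee44493054c7d0fb334a8bc49a0cc61115410eabde00a1d4dbfceb357a900b07423ac018ccaa1fe25124c46caadb9099d14a7d186b4ef06bf22a7,
0x69b073c55c108542dfb96092e69a56f3ea1b91168410dca2e5c21159b8814c104d5c5aa571d3023eeb0c88ab41588015e0c4f37a1b0d7e02b0e29a03e36a09fcbdac737541ed0fb4ad3d9e45bb43dee33a36853d392ec327715ab01d7a48a8c018f0996ef6b330d157a3b97f1f99f5a12eb90e2ec870052376a3a7b2e,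
0x234780fae232b7816526281739c267854431,
0xcd4b27187862bd4a3a5657d589cb08d0e46,
0x46aa05dd2a961580391d25dfec8683b440f7271d3cd5e02094e0e750bfeae13bc1dc15d6cc6f7cfe6d5c49590fdcbfca675de31ba10925bc24b6a3f9639f0853691,
0x20a3df1bfefafe426eeece7eb5692feb6abe,
0xec225b54b97e7c6815e90f043f8d67790a602ea8b23f0375da960586f61f6c9b309b4a,
0x6514c0419da96dab3c85111895652cc6fe954d1e325a343e716ddd77328c72fea849b91,
0xae2ee7e0033e3c0e7b4cc13a35f4bd7bafdc3e0a885e09a93d4f8e8cb32bce,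
0xac3cd5d3f7b98d218b15d4550ab5e916264d11866fd356970afca,
0x1371c7973c02fd1ac474a1233f2f2e70e078ecc60bd6fe3ba5094c,
0x50d943458346d7b1e60e0218be1c2d768c96507f0e5695c41e2c7591e3a7d50417938444d82691cab14420f65,
0x108c38a32f020fb3a07dd4e7ef084cc47d328cf7237b3,
0x6495971c68fb581649057816dc52bdf8444e0ce223dcc800a687c60db7459e,
0x3cca647effade0320dae0581696dcb2c7ddc1ea8e07d20783d2e4a891a5b5aeb1a4be5fba2e52f0a,
0x138e35ecf0a04239fe42eeed879779c6c0af,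
0x287671525c79f861d2a4028dea815ba1fafff61da1947a26bee6dd919cb5b95c05a0dec390851a0f1d146b,
0xc69bca305d9df8f050cc590c6f4a68d50bfc2cc1271f2c6dd8c35,
0x36c3388288e70275693cf44f98ae5afb01cc5c761e1036bfb93f1271e5b935c86d8cd64acda9c4c5c2a06f710,
0x1abfe6ab0d1eda02e9b2fd249d95d2f9e8529ae8add0b6dbe9367acc331dd2840af05a6fc1e7fa49c3a15850c710a263d2432dc853e4884d4a15,
0x226fb5da04f7044d1151db496e3152bb2fffe88e8ee6c572193cf824e8c713aeb5aa40389ec70358dc3ad2d45354d279f723fe4aa155065e4f57d9bb9ba3250804b422e96855e6130d52d662975a9ed30b1e45e73a48e0d4ae7b3a1c583328236b1dfb830e7554318d43e8b6a1f5aec2a8323ab64c48921f31e2ef64,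
0x221bbcaf14ad07cbc85d4abf8e9db9b1e246,
0x2d350d56f6a4a1fc2fafaca06b932465ae154df502852b21b4da4a89686fd07828a5125de22bfa85f935257564ddb86d5e,
0x1723dc081396e17d9837467f4485ea7913f8baaa17d0c,
0x152a10919e8d18589fd84c2177bda379a01e,
0x10ddbd765feca3e656559d918fc8f6caf0bf40210a764,
0x11178e41f459ff5118f8377d79c7376e66d1c6b50bdc2,
0x150a2049d95bea118199063807a6d51b9ae4f245dc66c03d01b473,
0x1733ea5f209b79a0e9ea1a993cbacf79ded9,
0xce9a39231deeb20f3d1c3259e87b7d16596af1a26886f484460745ab572ed64c863f,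
0x3048c0147b96798614b5f4aa7e6,
0x3048b53eb803f9bfe53c5dade3d,
0x88426f012d8d6c98fd9e923fa6db57c90464a58a2477bfe8c2b,
0xbfb25431ae166a1ff45a34b659e261302e243b403a3fd6e750ef9,
0x6f373a8dda264c8bfa3ac4462a344b7603b2124957155a24bbf273fb8753ac1fc3a5942ec28643538e8737179493795fef07cd7bf238926018beeef3254704683517,
0x9d8627b6bcb4249510f26291e2be51cfc1ee62821b1c30fbaf1eb7e7770c68,
0x1387ab0f3ba3e84d2ee6742d79e72c8182ac,
0x1112955be54f702fb6a092019bd75588734eb6755e3ae,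
0x27e8382a73ec850c8b5b0e7276e,
0x1174b4443c6a6df72e72321df9ce43c22,
0x39caef138f5f6193de0785ebf21291a57a0002a6a35ee731af2e04479bda37e33a910eb0475af21b4d02bdfb9801cb33dd558e86f671a7bf9aa7dab3b45,
0x7fde67ae9ab9041b195b036a1c2d2c25b5410726e97fd763ecbfcacad782cea0dbdb68731a51987da5072624872670ac414d6519ce3faebe52b48503df264578a03f95c6031efcba722e1224ef49d6030c488ae9b2236bf287439a1d56174f5077c7d51aa932fbd2a10ccf06f000b9fa7b3be84edec23f4be993c7b72,
0xcaccb98f91fe48a92bee3cb0f02ceb550e2,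
0x1b0b14d8adab3b034fc35e1c461c432d3750e14af322f,
0x108c13ab878e1af490ac32196c8068af0294b15f87fca,
0xeeaa82b81c6a13de87e82f0847c2f81394033ac66b4e2d58e7399dfab01549,
0x2644929c3d0f9f979665baf9e53ca5cf56757a9bf22308b5044509ccafb14aedc8007bb524e821cd2d5dc54191dca4b2aa61645bb25ac318e0,
0x5d4d2da5fa6cdb80ca6d64033d698f6579a8cec7e692f019af46dec60c6bd2752e88fc6,
0xb8ce8c912dc5ed6dc31c0c0db1ee1e0daabbd87bbfaed3fa59fa91a4cb620bbd89c3d1cb9f93688,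
0x13d7ff4c4f695a785e25220b65cb8967a85982f6e230f1afaee480,
0x139ae0af97582c5cfd2330714ced293c275380b8f29b99e0122c2a,
0xd267e582b9e37fd2e464d0053c1ccdddd5cc8a56f872be2fde4ad1a523dfe2c0546256c848933e842a430b,
0x172aa79a0daaee7165f41c89ffe4e51844af2cca628a4,
0xa9f17455e8a41d7598fdef162cdb92d8eeb175c2cbb7aae3f68cfa9c0e95281154c75f02ebc6311a208f18,
0xf3652e4e42be2f7c21555a8d912345d48d6a089fc083,
0x56add0325a0c405f8b4cb6ed982cf6f1ac4e0db2e43386cfc5132dc6c81820eef44a75bec4acea4f326207a56,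
0x13b25416fbd4f25588ba0df455b48d3446535f50a60b13c8a37d1fe6e46591d84434c897d0cbfca1904076a10aa51afa1ffb248b515c8c6af1f0,
0x2063460536e98c73921ca6228bdf2346f7805da02ab0d4db9ccd254a50e661c20281c8582890b6fbfe67603670057ffc7a,
0x3a4c9c94897eff49c0ca3cd310f6facb1e7d4d825903576cad22bbd64967fdf4d5b9c0fa1aea8ae6c17505e10,
0x1779f2e1ec0c4e710f05a77e9a7f552366ecfed8776c5,
0x217f141a999c1f2e2d779da73c8979c329407137d2d7858e65d7685d61a2910ee9d893c1c4ada68f928a5f43004f604f04,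
0x98635a1ea89798c047d2bd813d552a2545bebdfcbda090e0f443f5b67454f84f081225516076cdb7899188a680303846ba0623e9e81bdafe0b,
0x52ead901dd5695fa9e60c4ad6c7304025f80609d48e13db7b47d323fd02729c075cc4c1076d67c06ba31e4259b91eec6125d9d609a3221aa851037fc51f7eb3145162f9dba76ad29f2c9f7de25922ab24c9bac318044a59052e76e8e0f8e2adc4d96e36d144a296ea7065188a3cdf289335887f9f04c8befbece9e40,
0x22ac11397e757fe60a7e3c78fb840b147b69,
0x54f09dab2706a2568bb532d2dd67f82fd86,
0xca5138c5fdd41e7ba71f74f45f9a0c6738ac33376926,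
0x3c9f662bda0b579fab1445a86f2cabf8d91f08b92e78d4c2900dcca3aeaa1d70a77562b8f051d7f3796051b73d00c18f0bcdbcb38,
0x303b9ebbf1b27f97f5164e0127649d834654642150709eab4b9e60ecf4385ac51c87235a8c810953f06c4618cf4aeeee50,
0x282d584f539151778d3bd993530e11c9e01c82504cce8930830b550ff6e1e1,
0x158f489f3a84aeddfcf35728df902c1dca32,
0x412dec57db63f3fd119b75422f441122dcc8ccb5c63b,
0xffe0f51afc7d508a07fe19da807e44113ebd0f39a719,
0x2158446608286ae18313ab93fff6c3a15bfc,
0x15164add08460942303bb4c9615,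
0x1ec4adc1f1c8d33c51ed9eb3289ee4ce0b3aa79e2c4be04440d,
0x598f1e30f7210b833420488d49b112034496dcb6e81f640e8b336585f3959d68445a3bc42ad3db79a12094f2809d93dccdb1ffd3d94584c69f087c14a68,
0xca2f21b0281b5b1532560ce4c42801c635de301cc192,
0x1cabafc4886f218c7e28c77f81061ef8b863ce8be8089b05d5cf0b97e602933bfcc7d01f3e18be46b860cc1c3c740a0b91e60ba90edac2ec4b30bf7fd564280c4728ba,
0x103b8be2315dd88c21f8b9092cbae02513fa05f99120d,
0x14cb15b3060f2ff7233beb267e5e59929174fbab5e77d9eb52146b7b432387ce1ce30efedcecebcb47ec94e72bef71c9a7d2b70cb70d060db7e2fe0b59d7e,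
0xc349bac5febf80e3e147d054361c25b70a01f58b89fe5cef850c79cb87461154ecfceb97240608b3c58a79006bb8fd5782a7f8ca2207964928434be037e40c11b3b6c13994ad5b4c87bcbeb5c83ba6a458866d83080bff8fbe8ef1ec8b5ce8debb264daf8289527989297a4b1d47401eb7a900865ce1a729816b33a08,
0x50e60b8ac2e314ddd20e666a6414551f8d8e6721f6e3,
0x3f9a3c2543a697f6cc33069fc3a273c23f1d41c46b92afbe50b92,
0x1a8693fdb20934bdac57373af8f33e0514221a258b7ee8b7f85d815fb5d76d69eb5fc3794f0fcde79f9188a1e61d49757f3e7a214ecce9a98625122a89fad,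
0x255cc7d27d6bf01281da1ee8e093a7d67cd4,
0x15f2ced482e06697dbe9c26ca682fea83cf4ee49ad1e62df12946ecae4eb722c153b19e490342a286b0ed721c6d1133e997f0a19f34aa9f9d8a2,
0xf3849992bce9ec539b48f2fbe141f706399bde285b8a,
0x111e69e9cf938e73dc325a9db2fd9aeab21bc9f71474a,
0x1563eec594c84b5c2ee0442fe17721e3087ab1a39c83b9c001235f,
0x1b73cb5bc85f03ea46,
0x6e59e0ee4bdc912,
0x429511317dcd070882ae10f37f640cf4fa678229e3,
0x3ca0674f2ce946b8bf344a04c24193f61b3ee0273fdcade507d4656ba8e9f2f73ed597d765301a584f0fcd5dc4f0eea79205714d8bf9865a7377b690f9f,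
0x30d7228290a52b47a7a1caadcf0,
0xbb8a7fdb2e1b70c110362f7155be5bfee2400c4584240db360270,
0x266b3b650fb5351272d4000ab7e28a9ee6af96f95548,
0x1c34dd31f380cb36811d5cb60a9381e04b31a5b140d9e,
0x29c10d82e6ec6b754cf2f9b0413a418a223360a92c42b72724e69c9b8e3fe4fe67496694a318b00e6602e1194de7c4a91afd80fdcec,
0xd16125e3a3af27511c28559053fc78ca4128003bfc0bc04bc831f,
0xf47f516b29c8c3bd4fe6833b9b3d6b765d01565276083d9c288d3c9c23023c929d2071b3eeb28bb692e7f07b6efa1dace1d3e2bb0,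
0x7d2c8d077df500dea0644259ca1f6988a57710ff3f5e94beba5f80d3ea459d28bb20dc81e09b9e1c88b46f6ceb053600da9ff8a7746dd8e660395ef86252737dd8b2e7db77e6ae3eed4c2ba75b45ae9660b034787d11ef91022038469caa875f6f64108f8a5aa1b7999edb2bd8bbe3e219476ea5a9929468dc3695f45,
0x101c21821bc3597bd193a200cd0a3f684fa4b712b4f8e,
0x53202755a3ecb9da80009a54f7225f8592a05cb56448,
0x5dff243f8d763d4c40945ebf1e2ad3cff0e156fa4532,
0x101bd3cc202cc79fcf2c008a00ad4c4772930ed88c0cf,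
0x30bc612e9e5d08103268ca459b62401e021eea7b47bb4d2f2dd61c3a5f0639d86fdd7cf239009fd0d7a1035e3f49d2ddcb7d34e5c,
0x2009fc71b8fa38edc66a57056a45bf923a456ba7a93cd747af01b9b610770fe257087f9f7c4edf66fca75e676f964bf382,
0x83160432429876ae84d87d273eb8ff252f2086201e3f7429f9389,
0x540e0ff5554d8e220857edb39b412e10fba7eceb976c65870243344b9bc4fa5365c75b1282dd3d444ff09bc11643dbf443fe46be5a60339cd7879248772816534453a,
0x111048ae335929897cb67e2b4849543eaf85f933304d9,
0x78db6a1321e2a5c9b4d9b00b34fcdae3d70,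
0x1f2d07e3d3895fb3c1c08e93466ba4160108,
0x30d75ea563f9df00f532ac91b43,
0xa27939ae3157207626fefe1d27232d2291970a46d8,
0xc472196d29695e6aee351610cc78f675bb9353111a8c28f7c8174,
0x26f4fd3fbc9a8c6c5c87ed2344d6ba4fb9ab493f1241a1172fdd0ae9df4457c97b1d99205da79137b35ac37103e68e0d41b3c3aa6cbbfa8bdbc9c71bc6900,
0xba7c78eab6ab8f47f91a541c7c64b7945e43a275b9d070ea460a9,
0x309f338e694bfcbffda7c15a5bc,
0x172e0909ed9912ad3a918ea0ebb,
0x967d8b21b14986e3b61e3242af883367c041efd3fee8cb1f4383216f1c23,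
0x19fb5ea412dd3bd65c72433425734711e4f2d9a0c3790edc540d4e15cd905717cf22383ef95cb0bbe4a5cd37f1fc5024870fba8ed306e0123dc9ef191cd96e03d661cc78aab29e6efb0d101,
0x18f58ca7efc2f4ea0c3d920c8466dd83e8bac77ea6e9c,
0x30dbe4b1c68950760585edb573f,
0x150e5b7b7e909b67cb17187a77a,
0x74cc6c0997f0374f04508a7580b0730ece3b302fd8d7ace66e36d566cbd2,
0x1285aa2a052fa1f06fee300469596d3782d4cc27f945353b3645ff,
0x91e3d38343a322981f9d0f2e3b64ed3bc1a1d607c747654cdaf1d6fb9143fe3bd9f902ff77b46d17a174ef831df6a4b2cc027bc7866eecc386a099c185cc,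
0x227ba7f15c12fbe6b7f1989f55725ec4ed0cd3acb79e2b3099d9961952de169ddfc295a3e30cff274714c7d2636c6871b8,
0x891ce039b77cb09ac648700d96cde6de487bdcbe57d96cf923e15,
0x1339ae24a70e93d9286f5eb91fb3d46cb1482829c33f82fadd620a,
0xeeb8e91448f87e735958033d9f7bd9f9074a65d39bba8e010347ca8f1c09e83ac94cc8c0e182cb7ed4c4e3b327448fca5f575a6371202be1a6b16740bfc,
0x997ddcd44c2d62b7a88559b3ed0c5cc1483f3cd26c4489394e39dd066b48e311ddb5be09050f480d3b490033caaf4216bf2a335b7696c639f42b33d69f8e4c90414e,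
0x8a492088b266ed3ce7987a60ed990af0b151ca2479d8ad3cbf146fc369ee3c8b1ebbcc6179ffe5fdfc27a986f6ce51e0749ab224b5637928547733399babdb36e55baaf895192a178aa50d9ef93ea2f495179f9b62d9a9af083c0e39d6dd9dad874464d68470a764a5b424f1c25647626fdfb527b26ad2a64a08e59c,
0x163f882189d0a47ef549b6a7e2e3f07a9113,
0x1645ea55d63a66bb0e743e7daab16e398d27,
0x1371917935515cd8458852549aa67c592bb2a44a03f8f7dbb54457310dbdb6ad5099cc3f9b030d2b40cb73495cda856d07,
0x16957d0182c34152226a7d503bf66e577a61895b7235207de7a95c272a3630da89484222e60ea572,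
0x916831ce8c292bd6e660ab599508b258c83140f3c1001e61f267b60ecf44f0,
0x2b59a6a91c6ae7de439286c9f5adf311370b4c2253c8c6b5eaa0d48d06f60982163e32f,
0x152171f4b308d00826cef9312a6834a89f0bd7e62145e1ad154295bec8993091e1cac4a450efea4373f8ec8ceefa9be3727b118acbfa7401bf60,
0x2d8670d80e80da3ae7fa7abf601eb63d11649a8751edee0ac32a4aa7d2e34bb23ab572391d90909d218072ea9a7365297ab75f23d62a79948bdf2f6f7a8b8138e430d0f17fb7c5f716f91793257747d4baf46796f13dfaf7f20351a742c38e7397fdba00623be49b94db145dd7c9129ba3f2f32e27253a9ca750cb3b8,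
0xed262a6b17e192e32a4e8145b09e7418e77a3e125d282396142b174ceed7888ed970a9f46513439554bf5ab4375dde7177f346ae1216c33b982e409e7b30,
0x8dab63736c74c2a524843eb950de7f344c8,
0x87922cff8c5a51406d21ede4ddcc302d822043e829e4df71176a3,
0x56030cca2f9d098b6c253f7daa6d839685ed063c87a7922f1f7f290a6aeb1da5e43a691c67459a1be40a124904b6c706b4,
0x11104f0d4e04eec7055cc4e7c1f33e7506c4c9dbf5107,
0x148bb1bdc7d82e04fcb09b85574afed072c3e07ea81a7,
0x95fec6271c85455d90ec6fa47f369fa09f0,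
0x76e0f0d2936106c974fd82712a64e53aa3147ddae88df9a9df01cef013af06,
0x11a17a040f2a0e0722c78f3ecea42f4c1d43a80d125cf,
0x1f143022ec4936606472385f5531bf08cb28d5833c1411f358d038c82e15d99801aa88029aefe60b1cfd9dd75dc3d51546e6be07afc349970e4e9dff828,
0x17d679bc364de7a1224356550fdf625741a3188e46169,
0x1901831bff96711a385f300f4fb71949e71a46729d874,
0x26f7884223e9951e45,
0x313a19040c8c2dac99878b9add1,
0x7682968be4d5a71c71e6b53b70b35a99c71adf160c,
0x1e3db77ce10c1a73142a2398400,
0x4a8a02860915e7ad09d9130d22928397300e93f5546c10ab1e13d2acc332a6,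
0x3e9af005e8da6ade1614a5cc2256b860ea800b3480c65e87e1950ad7fa0f0275af24ea33ec25d4fe4f00488e67778e12473b61c433ebb2c0d16c4b50a6102fec95ad7350c257f58cd3f60cb1ad732f9a,
0x285d13170c77f65af7d862c7ff790e28be0bee810c92e454548c1e9cb8c6ea461e65384e2e93f607e2b48e2ea57ab870b60f53a21f1bdc9ff9e5d87cc57ccaa610773f3e76d729fb5d4ad271cf3306b35aa243026ceaaad28c3374855a8f62a2e13431dbe66f209e98b8706ca750f5b92b8793999a2e58553fdba83ac,
0xa0992cf6241cf21abb3f4848d7b58f035dc,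
0x21507e2932b138d13b14681764f5c44a9ca15886c80e030091c0258ba7b7cc65da71fbf4638cd51454fe97e4d0aec66612317e9f2efa06284545b038eef80,
0x196a17ef92b99a3587e2fccbaf127c84bbd01da3c6bcac9e8f0c06d65d62319497924cae9ffeffff413c93fe1fc69a763ffc5518a1c52b0c13052e95bb3bc7a9888086,
0xc71e8cbf19a2edb53ab478641a426e9b60557949f888b1af85c72,
0x771bf87e12ecb0529e6fa7ab0e80954d43c7883666b38423a02ade08b55153574f7b596,
0x1322bee6f8b50f64aeaaea4ad6e24a3e964ccf13801abf7e90441eefea537d1e8d5541fc4617d5082a3168493ca0524ca3c2e4d4322cf2586b654a67cf9b0ee491c1554c1b67616,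
0x76c1208d4484fad568f89d935af8f958a8c19c6f3756b58118e7ee89ef1bc5,
0x3ed3a2393b01dcc44c99acad6a8b5ccabde77894d6cbf8ecdb8fa,
0x15dd6eb9c462364aea36da008889764312e09dc65cc5b8a3e1f18e,
0x7af15eee83ab15ad8574f796c1a63633e04226422ad62d8477e06f628f4623dec421b7796aecbbad95d1d72f2307f3834efb0b1e3f2d4a5eabde23bc1015,
0x1117ce66004400109ea5a3a4effefb83a73377d1ec184,
0x1539840c59f844ed1fd58f193f2d3fdaecdb8d9b5c89dafb94ec76,
0xced48ba64fa7b997359795d6991fe25fdd08dd5dfa8f90a420d91,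
0x132eb3897bae392a5b4217a88c2c989fe8d65f6a16785a86342545192b9e0958c8e0727983bdf74b5347b86dc693228aaac143ba12c920d41400,
0x30df8a76b7db87589fe666d29f0,
0xefb4a4c0a613a214918caf8cf5c87a4073c433d48b109b139e19f,
0x11ccb716da927824dacdd834d5eafcd7a07ac117f6c7e45edb77d6,
0x18192f423b23b5d5bb85f90234,
0x30d5e9f9d0ca099266418785f63,
0x13d3ee170bbe5a2391ad4cbd34d742fd883ddfd6652a2216bd68ac,
0x1b6b9000aaabee5264aad31104,
0x52bf8dc9fb1f60a81165a0fc0d774b1e65d44978bed1d5d7643e40bdaa00ce3119b2b1cd2ee87976cb170fd2e,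
0x472d88fd7bc849a84fbef6fc80a87325f27c86fabbbf067d9674793b64626370e4b37041cb423cf12ef256638bac53aff01e4d15b9172a9a17ea94596972949ad6e4b6b4daf9c866cec7bcc30fa09f0e,
0x5dfdb41d4f522ce19d6d55c5afd3ad548fb9fb13075c1a87583d84dcd292d6924f0d2fa12d70aceababd1534dfe1094dd0c05cc8248f9d9b5a4fb5e1d6735d141633a59823de2cc6cf0dd78dad05a6455c0d25d6212d892861e2fe5f71678107d7fab9032fb80bbf5bb538200420c2d9f236c00d8830d360af8a686c,
0x14dd28f50e60a94cbae25a3320189393867a,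
0x1564fcf80919ecec9d0882bf17610e2280503a3b92cca47dbafa7303cd053257e02e8022b083851e2fe6bed374c7cea03344b21b11e913cad5c06a1d175a,
0x151002d4d7fd712d506453d3055,
0x14c3df8ca535b10a93e98abf56821722e7aa,
0x2903ae12525904f86c1c5708f331755262eb32f92532a8e2bb90a21abc002218536265b62f2fdd32b87fc6ee7ff0bf4c1fe5f231c45,
0x15a245a5d15cea0cc9db9c12fdbc84c164107aa52cd413630f2540,
0x25772fe0c123b8b8a80a3bee73,
0x8ca7ae1854ca1f578baabd710de04175aa1a13b055fae972b0,
0x27e4a1f60d56de123f185018d4b,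
0x25776c3311a6e3327c2c6ccf1d06157a6cb4,
0x1cb15a307ce54a42f814036c0b13f763dcb97dd21eaae,
0x3efc269406020503da,
0x13850fadd5eace89117b5575,
0xc48935b39d750c144ba7869dd571e1fcf7cc6969f06f1087d2a98bc634fa,
0xf2b10ed9c1f4c65a9490ea02db7e26902317965769137c9037c71b311e7478c5b05f204da01965baff676bd7eab1d1d9516088935c0f7b9a6e8c65173a8af0c3a8a50],
[0x5c039b342d79f00670f62d9d9c698c8685685416d75a77cd95d62413d5a3d5fa273ed525b0908f217b99eee8dc9953a796229be28556ce0523f45b232fc5e2e5f2b97600dfd39c8de2c7360352619519b70a5e235c274c7c4e6a34a8b101f9ae7a1d163714b89a50d468af57668d157ba2bdf1525f62a402fb578a2e8,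
0x80a475a0ce5e481fb630589f01feb401953481e0b9cdd634aa50d1c43de1131821c1dff814bd015f41466d0481663605a9b60841fe9d832396e6ad6b1ba368db58a9cb7eaab2eebd4693057a92700bbde2b25cf02dc4d4037d3060c59e38594bed8c6b1d003bf95d94444de6265812efdba9c274f936e283820f1b3c060f65ffdb88443094c,
0x2e6469614303908b3dd013c1d2c1b2efa8eb,
0x22e5beb64a98f39a87d6209770a9555e1de4,
0x322bf9f1d4a0bdbe3ed1b1a6236fc9f245c2,
0xaa68f1232bb97f77a0c9233d7a963c23d238eb180c9148c210c540184425f90c67ed9b396c5e8b5607f46f5d29b9033a204956a8ed07e627caab783a96,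
0x20d4b263a717ee10cc4377eed69f4240b6a73a3ff4f38,
0x27ac41e1dd9834862bf6ce7f304,
0x3059a34edd7e7e0621d10a5914caeb59a303a1dd2d3479dc938,
0x12484b0f7468bc05cba304dfcbb5a5c8fbc3d57249e26,
0x6fc50c8a3d57d2899bcb8a5a5b3c814f4a893bb2acd220dac7142d3a63d006bdde9241babb401d0b45737936e08e0b95c5eea0ec18b9566b0a,
0x23fcc6a957f4400f4f1ee8a0900776401f29,
0x31840189b033fe531aa27781cf5987a049c4,
0x19ae7e29c3ce5332e6158075096557c171051cc13695e,
0x721d3930fc2249500acbb466aa02f48c9fe93f50e41a006a6dd4bc7a1831159641c4f596735bd1b5379b8ac6744f97d7be,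
0x1d9089f2cb17ad69c3b04eb6c9b9894ae7f886b1929fa353c7da04,
0x20d33a816e01840af82930c648713850870a750826779,
0x219aa7d191415753b8fa21dbdadfa4600f4d,
0xe32fe1ed15d425e152ec1f89f06c11b87f16999386767a982ee39,
0x255b3d8ac60ecad58d381d65c7a9203f2e08ca4b15f4a,
0x25907f99bbc744ff22cd8cd4fcf,
0x132abd0b3c42ad3460d6bce4b6ce2d9e380d3fe9c5ff5,
0x128844f4c6e641538c77b6f339b05b58cb841cad95691,
0x1a86b75a00ae3add2b920054f665bb9180ed58cf8ef64,
0x1079d5859edab4e8106665678e06fd40575162eb49a1022e77f49b,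
0x10ab4b67568ca00f59d971bc0bd,
0x3b85b723c171cec7e28cb1ed016aea2d396660db487b0ed3ec77f0c9411c,
0xb5c4bfefd9eb37e20d7ea744ebe3106db40d4b9d23a6,
0x2ebe0665edc2bb7f21edbeefc29,
0x59d854558e5b5d5467f597b400b5c92274f8dd8bbb03ef9526077290f74,
0x1149988728e01acc483f0b9b1d0ce3364ee117e0ff50648c16ad25,
0x4de7af8f866a1cbd66f7cb79bc45ed4b78510715104256659c8225306d03962f1239672be0b9ed34633e445db5d0479f392c801c7b76e77ef0c24f0bbb24afd7403ccd33a8eea385a1b0df05ddf06960dd43ebf60,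
0x5475ebc07e1722548b92e541e1d9b349fa71b0cb4893dca99d4c3cd64ba44a73d792069e034361be,
0x18a840d13c68205b2557503dc53b1bca5dbed97305911,
0x1950f6507fdfc6f005c205851949d0a2712c5d44940aafc6512b49,
0xb46e15cdea636ceea607f0cf18166a8b22e3f2ee705e4dfdb65c7aceb19219,
0x1a86b750f70c692de33f4b3be77f0f5053b5cb9de2637,
0x1381f25cd97944fcc55b0b073c2811979131d8de68175,
0x3211af60d7458c8b148df339c2b411cb548c,
0x2384f92128b38eb673db705875ddfb8de971,
0xa418f3b46ba85eaad4a6780eae486e50d17b610491ca59c3ad3,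
0x500852310ace8e93c59f16fc43e34bcd2636679560d6e1a6a1231e040c36ffb11c834ef10de72623f344dd53418d869fe0a236cd04cc5447fa0a74522ad344778cd6,
0x1a324162af9a7d8fc1012c974417ec38ac794fba34d22,
0x24606de9f3d91987d8ffea45e5a10d5fe7cb06e7d83,
0xc04b53ccbbdef5c7ba3058309586f89676dad1f1b4e9ee63b57c8b43f34956ed42dd265ecdb92e0e0274d97bd6959e8,
0x11d746669788e898efb376e7b925703d46b85329a5ac057cabecd6,
0x81ecdf3911eb0de8501763f6dc489d33c402b544bdf45a56288e0,
0x197a3f8e308969ca57aee3ed7316f961aec0,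
0xed74da2e71e879a310d82d1c876ef924ee056af57138d5a34d12b7167921d4cea4da0704624b9cc340c35d5070011902bd2936df7e65d97db1a00f329d,
0x23892545982937f194dfc95f0fa48bfe0fe28f8df31b7,
0x18a9778d22aabbdef88e9b78626a7447f283b08cbf179,
0x16073e63f2fc9eea51a32f61d18d0f8f0ad7ff5f2572c1c3ebf0b1f5744cb5a2c573d68e589d9a4a3e26b0870a5d1180bb65617b184b15a7ce76,
0x3a19de22821ae987b377542afc567be6dd0d72e614b3f6349e0f4247fd98f222dc238b110c40e82,
0x9c382d3177c36bdef58fb0257b781507ee150950bbc2,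
0x27ac435942acd677c4acbf15af2,
0x1750457c4f21bea57b057ed34f0e6a3338ecf5bb2244d,
0xd7a0c8a92c5e2222697e2ae1294594f4692480aed081c7fcd86a9250a99,
0x2cdf4e1f8bc0149befcc556fdc633e3a281772c48340022c951576cf41cec437381a8aaa3005e1b9bda45bd294e09428e9f78ce78c2e5475f93f80dc307,
0x230d850f1bd2f0a4bcb87ee7454b1e49632a0135d8694,
0x23d327904cf030be73d4e7cfba927e0209aafd96b8a98,
0x1ccdfe67d7dc12d4459b49efb4487c61faaa6512db5a1dacbaaa8c,
0x218d70cc257b06ce3a71220bbc4a811a5e3c,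
0x25141970b79880014c9701bf5d150c85135f90d1dfdb20f5377a8860622fe5a299a3645e9d65aa11ae74084c0547af5468418f8c51ef3048075d96e38e912,
0x1abc1c304aa76adf882efb8617214d87f9fe8cc872ee6,
0x1a640dd7313873598462809a4eb7f4e26bd90f47e34e,
0x31757aecae3a561ee75af2eebc3afd5938dbbe147b0b24e2b4022c7d4e892dd3354a7162d0edae9c420ab37f0,
0x22add8e7bc89901b2e6883c78a2f63ee8361b7cafba26,
0x2d2e45a7153060767de75e5975da139e9c8b,
0x256023195c5b3d5f488f59b726fd3c48d2d9f2501a9b5,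
0x1e48f9dac43dcfebe37e96011fa77c290f0b446ae8bd7,
0x41b493f918e8df1cd4145683b1d,
0xe6203f086d03ff1a669a263c7be9f6c9d6cb22d8cb2f4f428ce62,
0x66d21e337a17fcf86bcf2b4e7aa67612f0d08ef0d9c7bdbd79d35fa81a98e5922517dd42da8970e0027fe0512d5e18da0cc7a20fa,
0x1e358c91e34db98b8eb9e52a18c83b940cf4573da6853,
0x255c0b6422d96bd7bec99a02c49d3c63c50c2cd4848c,
0x2b0873949b3ad0bae64142cec6558c285afdbd3ee86b54714116658b09916d6683c24566e7d55f3dc1487b5c9236c2833ea836fe4284ccea0c92,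
0x414fe9eaf17f2b4f3108112f7c2,
0x1bcbaff1fdfb29edc21cba37d723f8cabc966ddc743b5143123f02,
0x41b8a186c595f47d81fbc8445a0,
0xb79efa77a68d159838a088b168763db230d77deab14a6f5fe5f6,
0xb6602e75a47894d4c541aedbf2c208f69ead462cfc90775ba7d134c8d8a2fa1372713661f14fc7abcc7d8c245ab9a129f403f1477c0b7d096c82fbb2a47bead539bbf87cff35c2,
0x2ee781c353ea8691783f1f2e94d,
0x4481bf64d0a688966124eeabc4b79991a24005d602bab199a31442788705,
0x2b258f3ff951521e5fdba30449cdf0d3285081db88b19926894e8209b223e2c74464f863d1ba81388c7028ab746ce2ac92bbb219628d75a3d4b4,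
0xe72874e20e4eb481ffab610a5c1a779157e5193e4aa820674953c,
0x40bd948f29ee66e876586379c80,
0x1bfdbc114e1374ee4db1695e718d270b43f1222d0d5bbdd4cea9cd,
0xe0e37e3f09bfa6553217223a6be46884b1f944e1acac477a548c0742d4423355f921680,
0x14b9db68fbd49034fa7eb3df6aead5a33c724606347a5,
0x21d5ec5c12e5d99c3c21dbf93655a6c875dfcc2488b5204a08cd411af8d45e00b3e9e6f6536c6831c5733524c0522e1e199a820e347aed18f2827616ae96,
0x1ee3aebe36bbeede95922a3cba0856b117f566a5f0b4,
0x27afe8abb6e6ee694772f301f03,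
0x1b8c078e2aa14f016ea2495f099c892bcf173d4b6d5bb37155c5e3ea9a501974fb7ba,
0x165989f055b6371d14a2173495865b4667ccf92337bde,
0x2588e456bdd373cfe1399e06cdf,
0x2fc958ed817961bca7d6c53c1bd9fb1729e5,
0x2d6b7a4fb4d0ea21b1ff6019072c74b0d81c92c1509f97c9990,
0x23cce6cca331caa44e7bddb5cb89146df37c45b3ae900,
0x19b6d1c5b4b7df3d9853d7fbbed0312e187aee1cebecc2ede2e0d7e7071e31ac7dc4b0fc786dc684080870020dde9a2fb9e14f530f8577002063192f51dbcc42eec7cbc477c94bb34618c0ea58cf5b52,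
0x23eb0924a4960905cb06763e1acad63672d26b26da8f,
0x26337d7d3dd1c128ceb7be662dd147d3648a3871d4ebf8ade6f1a998fe2292dd5b3ae9d5d3af18606ca3ea1bbc1ec5eea90986b4b48c2c68f883668883a2bbb6faff1,
0x197a3f8e30e6dff91eaec4641199973fc55b,
0xda96ac8880fd68a341d9d4ed198c0a3b2cced6021a3b,
0x1b05a8801eeb9d2ecd8f43cf920e9e3395d5f90bc980dcfa28b54e,
0x78ad3abb67993e72321d01806878bd94d6c62cf9797979a24b1e7,
0x19ab1d1f22a760954a2535bdb70c242eaa5348af37286,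
0x366843f4981fa496558d83824dcf21da63755cb8efab1f8100708ef2c697990fd89e0285d1e0a319883c0b365da12f1b528d154c31a102fbf4056e136fa38ae8804b538614970,
0x22947146b8ff51fb8036f4467546f98f872c2d77a17816e6f8936046abe19f1874d737ca4ea6c082b204a2c9a74459bb78aec90bbe85216e4bf364208b41e7c7343e8f57d550f96349deeda53cfe277a3138fcd70e89e4be65bc4519bea0dd53c0009582379c8bf9978c1108a81de4ee194f72675486a4fb74af69080,
0x2f8855c304433a875c7457bfe32d806d02f6,
0x2535ab8612769ed036930b358eb78837bd93f1c114fa7,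
0x1ac4d47b5b481cc321e4db7916974661b47cd162b1547,
0x41b650df0d26f4197116cbc54da,
0x2ea701242386a0b266aca5394f64deaa010c6e128efbcebd464d8,
0x318aea1136c448f12f4004cb3d78fcbba05d,
0x18b516ea963b4c41b412b62989a4cf771720b9ed1a94235c6dd9eff21d33,
0x1360068c654cc4e4bbaef83168a,
0x4c30280561dd4ff4a120b3540c2fc3f8c8be9e7b24bfa9f3872,
0x322da27ef39abb3c0b49a79835ba950b754d,
0x1194f59d6530ab5d731a20c603b4214ab12e7f7be6692b0af06,
0x4195107fb94f860bd9f44ff4910,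
0x2fc94d4c4c1354141174713ac6b4ebe899acfc624c,
0x24bb8b02f35ad3203553d37726cff9d7e39dfd9cf0506,
0x1a1e154a16a13de56350072f261387d6a4c5fa31f206,
0xa7ea5e7b9a34d104eb55fa7969935d2847c8cb7d19ad,
0x407fcbd0e5c87b8f3c0947780e32455db189fbf339a1,
0x1336b02d21555e259b941070e2fd9a474b73fc613befa,
0x2afbb737b6d916536bc0a8d2b26673704ad776fea35cbd6f68e1e8a09511b121ff51a0d05b35540b4ada34b48a17645eb6c45176c9c3d15ee1575867f45130c52f689757e9ded,
0xe818fff122d1c6c65a24fbff5a26c2b23b5385d0f466a8295886b,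
0x418f3f45841cbfddb24639f18ea,
0x4c30280b5a06eaf222eead753cd02bb100cbc6aee7f23726e6e,
0x2190ba25faf3bb0c2472dde6e1f68bccb4b0,
0x20d290fce6c199affc8a5c88a16ff3a7c11b25206155b,
0x4b6594aaa52ef9f13df058b38c9161f371dd288a0c489adfed0edd96ad11614e2e823f10355a8262053eb94d569006c89baae52f6eab91a76e,
0x23f4469fa815e288613cfc85dd1463836771,
0x37e9c079ed99a0c296a1ab6032a,
0xc7da71c3fbb812467e41ce4873d350e706d960fd132d52b222a162e99e4de0,
0x77056fe1d67ab57cbe434ca86e32d129e682399ef9898421bcd46e95b7d6cc0354af8e332d97c9ad10293105070730fd5c,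
0x19e9a91bcd5ab3b23f190d93d827d2d2ce437053a4e80,
0x22a0e2e71e6e35859c0fd338a7b5c5241f983a8e10938,
0xb46cb02a695fdf52f67f72183a3b14e15f988c55fdad,
0x23f79c6f0da8cd00754b3bd5486b88185f74ce236a8d3,
0x1b70b62684a8eba84d12ced7d8e196311e9834ddc1b88cc34fbf2b,
0x5181324e23da3050784953b36b0114afe5e0ca43474f4da4ae0fd5e29d90518edfe50fa1f3ade1a632592aae9f6ab657468e4be13f2e2e26c9cd3f9888ec94a3b1464,
0x2ee7f7064f4beb1f52b62a61e7e,
0x111d1f60e4b226cbdb3b346a4951a19edf73b6589c5970b0108b12,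
0x2637d445d3676aba496119d25d28e12e5e4ad75782cc3,
0xeb55f95c41bec9afc74fe444febc95d1c1cbb4d06c5fe307da6c7,
0x2bd70e214a96a0397aab6a196aa,
0x11219ffce7097d421fbd8d0649eb20e2cde4405b30d2e78ab56917,
0x1a9285a43456fabd295d0cf22e9639e29fbbce496aada5ab4c011a,
0xda646f1287b020c7ea5315c42067aeadb2938f67496b,
0x231b9f817142197fcf31a8ae66c2f8e48a74c721b226a47867527c208925b969b6327342b29788db5b0b56d47e1989c3730cb819d4d172db6d786f4256c8ce65eea5ce,
0x1385647a6f820fda7d9aab2d8a5aab0df988e2aa68ee5,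
0x48f644f2042c4ef1a6,
0x31a11fbaaa40511236c15d7347f6f7b9a568,
0x6bd0657c8de16729a72d3e22ddc406f47c8c08cc99466084815bcbf8784,
0x25c6eb3077f5a8826e85fdaeb0aaca3ea875866af9213,
0x2e70eb9db4568ab19819acd7198ef0de3ca7eb5c3cff4c52ee31277c74fcce76ce136eee2c97f9db6392d5b70b6b4d0f9bc11b0a53b93ad4a34db0bcd06d1,
0x13405a2c0b62781cfd11b2bae86208a3f05e5e0d87204aef1005b74149b2a890b6ca209e52eb0660072b16d6,
0x79e2c9886c4372611f9aad17e871e83991101f95ae74f453754d9f8aaa7ee9d2d118ef2085e45ae3ef2f2aa50,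
0x21a87ec1c4765593bb3de7376bc7c652be36,
0x23d34cf3a44ae1d5394c2328812a5c0f6df8030ecc74a,
0x1e674702d4927acff85364dd60cd27826460,
0x3f06c2bb707fd09d11bee261ec4,
0x955e0a17e0f06ebb66e860b57e634ee472013240b96e95f768dc1d2cb0a5,
0x4cfdc5754d44f5149edc7bab29289095c2c12de1ff8e04cdab6d8202d4d141dee3a6b7118ad4037e5022ffd3b7c9d476dd0000e5b1cec9d1d5,
0x3927b9e5427a61163cdefd0f53b,
0x1d331b0d655d9c95b3c4c3f2ff6388200a9708bfd6989a02480d0c79a8e2,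
0x22c34692534fd85dc5793d97dd7afdb4f6b3a4380688e,
0x7b841aead485617157e5dfac563da384917,
0x414f95753dec444c5f9b767aeee,
0x1d361a9d6f6cdbc29d1a7742ce59a70f2bf94cdc38312e3aed2770,
0xfe1ea71c63f200eaa8df5f03c3ed83947920a94ed54b69febe68b,
0xe7fd0dcf00b4419fc11b9101e2173fc5dbf2b5e3de4f7c1464ff4,
0x1d41d374c5f823ea143bf341cf97517fb9f6d21997e3003cbcfb97,
0x1aad86f37f1ed62014b7e33a49dcc4c497fbb68b64ab1,
0x430cf6f31910de0aa8f88d537961a32012b70a2794b779916d7c9fd70b5a31437065244d964f4458be5749aa4341f06b21ba517e238a1bb59f4987392ccd21bb4664,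
0x14d469cfa7321e92e62a5c5bd960344ce32b329a24903,
0xb0a35d58c77089dec80b91f5975e227a6bddebf526d87fb2ff29f,
0xa78d1ce8daa0c83f9bb83d3f0a18abe1839e2533ab084907300ce,
0xb0a35d58e517f8c5ec3e91dff62b0f5764979ca4862e336323dd8,
0x30f5b1542c50d39794,
0xc77ee66e9ad8555a72399a3d036ef0f0,
0x12ec7bef94bf1cc9a00c56c4530b10ff0c1276f990923be0e94fb9ea486ca19,
0x10f2a650f0bdb39c4789a9f321837560c41d8bb9292ac3b8049fb53204b4dffeb3df55f95b4363315a8a53f645429cc790c20b3e37ea3c8acf1d89d1e5b40c11ef51f0f47d320acc6a91ccc86da1bec677211a7a,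
0x1875d4c2ade4314c27b85392cd462f22862b9917f33f0a9f3923fdb9054833d41bdd9648b40972f5d981e69becd2608f0872161bf8846b9d75ffdfd9eff152ce7159aa,
0x15add8b4b00926fd50d12fc87a8fa425b8a7138dbd3f4,
0xd2ef1983451601ebd46ea4837adbb8612d93e3fc658b9aff8be8a27653b495f47f25b41cddd90096,
0x217e8acb2e4d5046ce67a4159628ef2c8e819671c4fa2,
0x1042a5137a98e35b664e02b542ac4696cf6b782604eee5b86135467d864c3791f75a42667da90470121ecaae7019212da607fb42a12ac7c00c1db89d2fe980ec525178a4f1521a70b5153c71,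
0x2b397915eb92555b7312ab754e488b8a68fe,
0x269e1428f243d1e9f36afa2c70d837d316e4,
0x26a0cbe46d5d49083394019e61f55a4b3187,
0x12d3c5331785100a5972539512548dd1c38cdd98c3fc6,
0x3c6f1524a62e84dff2,
0x27a5ef25f0353cd583ee4e209a9,
0xaeda5af0dbfabba009352d9765ae685f0f1cee422f04a5d37c8255b60b0063,
0x4155f262f3c0d74a2b6d0455287,
0x1bcd1e58633b8fa315cda04f26a967f3eb427ef1622867cca39c57,
0x625d17cbdd6fe175de574317b84edea84813f9656399cb1bd7b2031ca535bd2094562d56fca90f20d66cd03db2d8dc7d236e0f2377fd727c4e27c96e9d66,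
0x3550a8b1bd0bc490beb7b3bea9d9ff3ac7d6be6fa31d,
0x178bce244f05a70bb0ee519d7efdde57e59a2bdc0bb84a5f74f032,
0x144a7c410982df7219a066879a6a3e5c6d6a0343ff9897094828b527afc3810ffdb691b326bffdf4aa83aff71517bc9f559a7f636e1de04d4224e85fe793e5ee324eff,
0x19cdccce8bc27e010e820fe6920f507e1477d672d2d08,
0x2bcf9b9cb46f7794cbc7638382969b5ef221,
0xa418f612750d82982e2970bda5bb7c248021f45d4bafc1ab70,
0x2334680508847b8a54c4f9a886ba6603c5be18c8eeca4dbd86301e0dcbb208aff7b538f6abe991f08b0816ff0be3643b99d1c7a3527e3175855c0b6c144c8a8c20629308fe13c9780820564e017c50c9c217e59d,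
0x1b5f317c97d7b8e25995da4bb7dcc4e125a9c7fec5b9d9e44e145c8f8a66cd5a83cc13d9f2b0f9d3f26e8329672e552ef2641f524f8160df33f46e064225b0d011595a7b6901442f1f0b958c74b8308eccf807882d5b9d4f7e69a6ed95b8d37bf5db5c1b996e6637f197624f3f666a13b9ae6a284a470b4bd5006bb39,
0xcf7677d21cd82c603aa52a9cd64c937eebd256062d42,
0x12db93e6dda2cd49361014768d06b44982a23428a7f12,
0x2650b2498b29b3348536d1634f8cf7afe961d6e2f2c8e,
0x67adae9f0ef605d7f342cb128dc55f05d3c9d0345ce3,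
0xf97cd285d3a451adf16a58484c6c59e4dbd5f6053294f921194561e96bd4dea586dc03c0d89e8d308d36bb745845fb1e0e5a71c23196e808c584d0f29396329e87836637c5e6,
0x708cff779864ecd6a1f9a4bc3c2031f668b,
0x83642cc1cab25ebcc8f6b43aacac827eb3644ee5a6cbc5515620cf6bd22530923933ece07445c1c0da8cb31ec,
0x291d7b8aa27de15afa7bea7c78ba9c6413657743d9f1a013a37e6b19f956fc35f9fa4103e34f368df05acbf9ef54cd2fe5302678de4,
0x135ec32d9780928877d1655a5ec,
0x255c89e6cebb76bbc7804acdd0de621818bc2edb2438f03b65d,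
0x68c6c164195452df4803ea8178b56db0a89486c3733d9313219516819bfc20d200483071375ad1088de4f62dcf464963c0960613a6422f89afb3ebd875a1dcb074a1e,
0x878a07a19d403fec6404e94161f23b60bbfc7ecf192dc15094c3a4ab5cba9f222bba55162a0894dba857c0515f33c6fbebd30ee4bad90bfa7e0,
0x2729b5b6a8c7f73ad23b720404cdb7c05c49d6bf5f1a5720f2cd8b3dfead4e8c7c45faef9561fd413394f03a8927284e59d8e8dcb8f3c83d2418d4c4ac3fd3a2da925b289662f84e725e5eac5711a4570700b3de03521d2df9a20f217bd8925f2eca1334acce9b2fccf1d7c478cf89ad75955437af05a1c23212a6ba,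
0x1adf10ba4193a4134c5f2d58d068d60fb94c0b3c03ef5b36da3a0e,
0x2d1a6878c2b0123c0a6b44f643cd997185ee12258f7a605038146e43fb36b665f41981c16d137af98982899aa24ebd04add5732d28e6f3853bfad77182612,
0x1b406c947fad73d448f4ffcb9193a37c85911460e5a17f8d5c4376,
0x76de31c9a77f053678febdeefbb878260b9c52e873acc01405da6db6fa9dacbd6b3ef99fffcae7b734165f37653384c4209294c2,
0x12d602c5ee3526fa7c0f71cbca22a638fe4b90bb55317,
0xd74172cb48b697db9b1b57771c8a5cf540aca00b456f4a72d77e2,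
0x215762247c61e1a645881068606edbb4f35d6928d35362b49b55b68188905a2f3c260cec86c1b01b368dd72e1f35a092,
0x8a6ed11af67418bf12484d63122ddf745aa4ceb74f714fae1f209ec07ec1527c52493280845ab66f4d744e191,
0xcf09b053e6421df110a327eb69e7cd952a7db04b41e1,
0x23cf0a02e92498f9ffcfb0b054c9a2501477be98699d4,
0xfc9ce8e08c35b4f34da42c51e14a6c4fc888b06cf0b90edfa06e389c4f0ac2c2225617f,
0x141475b8876490b215ed524391336bb5dae058f68c62e39f1ebbdc,
0x2220a89cd7b1cbf99864d86d178b54cd257b3e4e848964de42ade10559b1f68c5f6701654b56f330d1d7ec637dc373051e13fd338ee69443aef5a5aad712150d493e,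
0x418b73c5f4ddcef1918fdb08ef908ffe841639eda1010f2633620b51959733ffea28905a7c609c45bf43cd2df179e9432,
0x324dd683d3e6fd33bd3bbe836a6c1c546e83,
0x9efac2568ea952070056c3e65e1a677ddce87cfc4dbf2f5c354549ce464e2aedde96ad6b84151,
0xdee7fb7e937b86014893f67d14b5642fe0741d992e0688746bc34126c0642b,
0x24f8de5dd5ab57ba8002686020d3fee3973622bfccd4be1289d38f3e8fcb140a32706a6eb51c76a,
0x78ec1bc09435dd20b3c719ecac51e7e5b3ec396b07cceef859379a1ce1cf6e,
0x50c62931373bc84a73481edadd053456a95c2678f9147742e23dde5865b867,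
0xc67f4ed84359007a32b03b89613bf1659f8dd929ba158fe59f7565833ca4dcde0278c51ebb610402a29d27310ba9c3e,
0x4f6bf94d72d5bb2897d5214c75fcbe434447589f00226585f86c9,
0x1c24ad610b758b78baac14a0fb40ed8137d5593fe056c104f2c8e9,
0x1bef187de1931790eea24fabaa06cb3f618c2a0ce8e82d655303d6390a0ad95d3b96c2ba0c109ac927ec9d08d8509130fdfe97282,
0x19270af408d809d9de1c6a6b93b2bb5f4a953d522d71cdc0a7de2b,
0x1bbc74ddbaf85326333864bbdae480ee728b92d0c6080,
0x127a9e918f22790553af941f8476e2e988dc7550b6dec00210a58f91069accf97b1a9cb11688940ef9de71c05145770c0a,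
0x5e2b15a38c4edf64b9e949cb44ddf688672d4b20c239b0e7d5af79bd38968a0d09163b3c01f129ce4aa994cd8fbab07d65e647c38505c56da3e11339b198e09de09994716266cdb7a0e6dc65c8b9dc2e016d43ecad153adf31043ee04b96bab8364f74492cde4a3ff0c51e77cbaf095a53f3a63fe0c57bc,
0x89f37859c881d1da80466905e8a21ab7a0d3596f0b6d,
0x81f2bcac35f1123081435c8fd373c23d18b8e8d11d6d7f6fd0f88,
0x2524af52f5bf5b78b69ddf5b815eea74c712b1e49fee8,
0x13e0bca17d17df01aa2ad7959bd3c74280e90c1ab849c087b6c674466d1273359d5b9bd09541880b57408bad14b75d7341c75bf47ca,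
0x41540be69ae67c4291d7e696549,
0x59d853315859ae3d5113e42908d33a0ba05633b21ba1d781580a4b78bd2,
0x12da80408b5b75c72e550fb1d17c4bf715d58d2c87e96],
[0x235e175c8437ad419ec2435e9764f7eb2e6cddec2d66c31c30ad6bdf2f6b0e670531a3009464c67e8ad5314bd1d582b5de605abd04dd4135333bd1f9427efa07670b70,
0xdff71195ee00c8f7986e8f2adcc072a0573666b626367cdcdcbdb1b86588f80e7a75e0f420eebea19d3899f0513991fc7311ea79f99eac8f20444f19bee3a31fcc5fde89a161a52b6909859102d1796d8f0d5d0d3e750d2cf206c3a5afd465868999526ba55fa77e8798b73bfbd641edc3423f310180069bdbf629c36,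
0x2f7b3ebae20f851290d9adfc1cf44208dd05da7eae7bf658f5d00d7113535f1e8e9269f15cfe73084af6103f23b3060eaa,
0x2c5f652a68e5a2d78d85551d022fb7cc0afb04dde087f,
0x55c4e7edffe9f3e4fc19972040d8b17ea62cd6ec4b60ec380861f736aec9056522286b4fa211c609533e32c638a17a382ef41eb9d72,
0x9e55b8b5b9219c8220549d2e1f97ce1facd094cd97e0564eddf13523fd518bbc2c6ca7abe285631446d3285a3afc320943fbc97a21c4419189cd876e994bb8f6c286dca5442d656d8c32a6d63054d86cad622fc459f0e92495beaa32a9c02f89d71ce5a1b46537378da8f0c0070c1530197393561d661f01494e520d7,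
0xa9180ebfa613c563ec502201385c4f69f8e4eacdff1096fa4aa42,
0x1a9891e35cc8795afe16d9c1496d8a14784e269eb4232d07f43dc183ff3ad29,
0x2c4fd335d5cd35090c7a64fa64f825d029df4ad3938d2,
0x3d5c258349a580e39b11be794f22f2bd1e16,
0x22e4b4c94f497a7b109f6b9d506432e37705fcde3deee440b61a60,
0x2598d9aa7fd6ba4fbe52dd71a53beb436b65b5a4ecc9d,
0x9c5def5d9b4a274920b8ec6e1bb3507d2e452af56438d6419de6b,
0xed42a92cc16fffc6dbd89570e8e02a406016aae944fb,
0x21ff7859ed58eaf7c1a744d295c962554f4c801f33c883974c2969,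
0xa9180ebfa5c47736eb4aa188e59546763cf1dc2d0af08e97e0635,
0x2cf7d522411e22f69724dc943e441a919cdae4262955c91a2ade5f200a59a18db4575a233c8cc2fd8e8a36efc2c2baef1f81b7788f35c80995abe2febdc69ee58c93,
0x1c9755aade451eb6485bd978fc3731048cbfe6781d6d8,
0x2f91883a87a5344c9736eec5891848a075b71b2584ccb,
0x1c46dc4e2c8efcd7a2569c01b915aea7dc4c9517250c2,
0xdad7444fdb66770d75292602f66b6ec6054a85d3e6de4bd3ac5fe,
0x51c62efd224575e0f2126f1a0f9,
0x3b414b517f1638e572090cceabd6533a6c5a5c14e4,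
0x26bfe66ca2b859ecdb146f1737f1160992437677ff210a4128fd01256beb678541fa7f0af91f2eb21e5e949be49a82703d620743cd4319ad1bc6f5f8713a2e02e107d4,
0xf02f9cf558ee3b6b6a36c58ef5d74b21afc606d49131d2343323e,
0xf87eff36305ca37d11ad62023375b1aa7ff6d42f825b64ac4840f,
0x1807582ac79ef0d0fdb4bf54ff507d54d28dd3da7f8fb7072fa6d4,
0xe1e362cfe3748ca45c1f5e780c101623075c6382296ecd48f3170243e85b09a15b6e1b8,
0x1c4717c58d59b00ec8fed203cd2a30506c4c0755388eb,
0xbcd7da88a34ff4491f737275cd423eebcd85fbdd841f3fc01b3d0bb0ffb12023f580369914ac8bddc455fdbdb64033f9e934fda6b0a0babcba4ab285e4137f3241b6385c3d1a870f4a7a696,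
0x23ded0017cd5b31ded05fff295b,
0x2918a3d1b629a5bc7ad91a55b161153ea0dc035f74,
0x3ecfb2302f611f9dd94ea1422ff,
0x5dc51f5972d965aa04a54cc012a5a027606bc20724628f89be,
0x1f061c14f0a8daa84aac078ade095f8be93774bfaa29116fcaa3e0c2557c8246fd691f4c1094212f3b087bac5cc85d6467e7beea36c70952ed66f5a875f7b36d15b1ee,
0xc340de777cf62095758912479c1f414c98e5c831565ab425f4d84dcbf7f1a9690277ac3e0335e3db482a757eb5f9231113e303d17037afe47a8f999f90f9207b8a5163ccaac36fef360f510b84cdb3846ab58d27d5286770a2cfa4fcceb94236f227499969665556754d00206572372a4203401b28c22ee66c3c6b775,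
0x15b9f40586305c3995d1b17ad2f2e097014693fb960b7404aca89870c8366a0,
0x1d33ae192739dc5224d68857c39a7d181a81e4d96062e,
0x3a57cb5afdd8e5a3b38ba9e7f2aed74ad385,
0x27facf298766a5e58bff91a484e,
0x44dd79ae56a2fd5952a108bd11c39d33cb6df91f2f8f8a46451291f5cde0,
0x15d943cfc2ab4219776eec6fcdfb33ec2209a0711ab0de27b4e754,
0x14df61ac73062cf81dbaa1e62b557ec48ef12bc5991cf69c704702,
0x2f741365c93f1ff9c5e33e785104d92ffb7817efc27d1,
0x2f385558ef4ce5cdac1f829387d2c46adf8e,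
0x51ca1e47746a56c3518f8b395ea,
0x2d79cacb2a2e6a89621ca639b2b521e8a14d0306ef576,
0x14f70d52a6baf91f50a4d849b8397737334e3133604ca,
0x20a9b39fa6395ff65202a577b68748562e1054f7902bd1cfd6bfe7,
0x23e227d78689b70b2d2f6535d4ab9dff91ad5b0f88d40,
0x2dc3b4cdf0d758d68ab00efb25d6c75bbb599dbbde2ecdaedef376b4c98bdf7372aa25a2ea25e8566da116b9de720a206d92ae339527be57e6cfd18dbf5f1be3ffe480f08ce90fb9a88a6b,
0xc8413b3ee641a8c705ef3ac3e9b273d5aaa19dfbfc6f9d1f4ffe6c7dd646dba4e402fa46540cf03e37f061517fc71c869bbb46de69f82d5a157996f887bfc56ab2b47eefcef6ed82a944b6a,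
0x791427219091dc146d8a5c9a6bb417aa144c90e6830b7dcee309d968d790ed2aa78b6d9a91d370ed7de2fe4343b6b7326da1bde44ae4b2b6256ed581c9e0984672ccd70d6667e418c77dee30d1cc58c2ace991630174ec5eace39410add4e91c6ed5d3c96cacfb3b2b148a6f1a78eb3270cf2b743025ff5d59ddcb6a2,
0x3e12f1e52ae88e388e343535656608da706c,
0x76de321f00f6f9452401455cfbfec2fcfbe995cb70c23a60785cbfc9a702571c859b88772d53e1169a862cb9a9b6b628a978f4b4,
0x1058e322cca50fbbf77597e8ba09ab405899fd891df590c3188fccd4ca5f9c5828939034,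
0x92e30c8d5ff9fcfc93f891e5f7b23ce668deb79cb31a2ebe9847e3100e020ff32bd8bbe,
0x633cf743793854c7cd1ae70ffbabb5353122fa19a0b27f6878e2f4737b91d4,
0x5c8db4b4b9bd2bc594ba356d552f97f144dac1385eef138eac5008cf5559699136fd97bb0b444b67,
0x11492424541b672a99289f49bb7c1d4acfb42557157fb2f0677ffb5f98dd174f8af6dac1169a04838d9fd24ebc399ccf95657998b6238236dca58160c59a29dfe6f4f33f19ad3fa025a5b9127fa461b107aa53ec33640f7436e4eb3fab17ea1bc1ab55d1266d36dfab7d5c26079b96a5bb58e60c48ff64d6813db24,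
0x2b828fc9141cbfb05142f86d7fe75976ae237a485ddde,
0x18a3bcfa41d4ec9efc5c9b87e82d1b4ac613,
0x1d280e741f9686a36e0f9735d267ce206ecb5b3aa0abd40ed9df9819b8112166b6fb795b6b9996b5604f1c51928edbbce00de929665f1526a,
0xbf832fbdb3943cb2c8b01fede8fabbbdca9832888fe7,
0x3c871f90d2d89cf3e77bf7fd01de15cac4841ff5047d7c567d5165028f78f2372c7481018575527cce1a083f89f182c4064a9016c9478d3e73,
0x51c7f5dc4a5ba3c41116c202c61,
0x87b693aceef2278fa2431d8a104297fa1fa0b7e599,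
0x226cfabb70a83434de37bfbbb6456b7144158cf26ab8f87fbd3c9b,
0x5230c34c4cbb81d65bba9e5a461,
0xd7a0c8daa76b8a08e7fff6c7dc7c10446df9bef152221b639d0562d0c29,
0x27387cfd5841bb13353116b9d6ef4e5e02f4624c502a9a80641eda4672ae909ab8c33c1507e909195006c415616311d7a8a3efca778ae639639b,
0x1beaf88a531c9a9a4aad3d61cc3c0be93274903726ac72692fd45d,
0x23e320b6d5e9044a1573b6dd7602cfecdf1892dce394c,
0x14e9bee948671ac7b64abfcf96a35f5b8903b86b66f283a2c10c15fb6b41447,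
0x1c962c884d9ca114b0034736145626b2e55f93b068945,
0x4c1e5dbdfd8c1f186f6a6e5930f,
0x2f35e8d20e1d1ebc8bb6242e7181f89dbe4c13a1b6eaecc493a,
0x2d819974f3b88bf6e7f46bda6baa012bf73b4d12809f5,
0x39aeaa8ba893785ee271e8540b116b4b2b6bd65a17922b5e8c6096701edae86536ac74552627e2a7769ddc5ed4a7682e1cb6097b7d01cbd095dc43783c250dcaed74,
0x127b75733f19f8080514bd6718ef35f17f9b51627f3adbb0ebe3b1f219a4ad43d02e96a55cd4bb402e7969bbe48be0a67a9c939f87170fe0f387ad722593e478a736badcbf6b2e8d0a46d51a31fbcde6fb41044e28563cbeb27af95d595fc84c0215dd3ac8af2a90ad22f7f941db77d30ab33afd0da4e52b1367fd1ced,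
0x166228939c66eb2aaaa6a4577f080cda4d3f32003d098c0590242d,
0x4d5c879f3be99cebb55064996b29f08e68c2b34c2f65923e85a8f701cd965d3a25385e0a6586f04fa9e50e4c5019eac48427e3265cc1b9fc67a,
0x74544828bec2a3a8fea13399fe95c3c4815d765c9819a8f1b12916e1e0651dd4c58ed5e721a5d4ffbe6bc126fde37523c9,
0x1d11f880d9335570d4840d8e772cb6571947ee0c684c7,
0x2db4d1401bef06f3778a01c9648359eeb85a7b36544426a486790503303fe11c84eca5a3ff408b015744e91215f875064793c594513dea70aeb6,
0x115a6d3634e6f0930992a0f5c13fa69e59521b3f0d249319327270e82d8d695fc1da6cd8f18ec8e0276faed5a528069fe4f56bcb1e2e2fd38734495f4bed0c86389067518331b01892774fc849364ac6b4c67ec89dacc1f08db833af335e32fabdf25b69cd9cb24d69cfc662bfdedde0c085c99d3c4776382eb32f9b,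
0x30239b976cf6b61c17220a7569f1a8e5ea48f97fb1795,
0x13249633776b906a0909ec6b666579adc9681dec8bdf4f24ad5e736746d6507e325e95fd477b0777f005c1bdd959f315c5ef9dc65b95adc59241260eb36bf35cbe21b0,
0x23e6acbfd728b73f6c4a15f03d8fecad9ab9deb887e24,
0x56d7b2919cee51d99983ac48711d24f6cff202fcb11a5412d01d1df46f85c37331ec8ac1a053893c64fbbbd493a10a2,
0x17507d2c2a34267e21f9a1b5fa29a52548cb4305b43ca5525f5d2d,
0x27ae5f1b7004e4a8049b3481c4601c57f025,
0x1fe02da903c0e7a10fd756c5de36f2bcafe94a6e85afc8f1ea84e376e647833f06aec7c79dabf368e1d0597d7167c8f25d0a24c0eabc72458366,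
0x856134902b6d4cce349d514861a06dd162adc5bca7889726c9fd93b66e5abbab3076079fda9a1bd2a0abf2637d814ee182,
0x2391da158b9afaac8a211343680d8c19760c428684b1661e261f1a,
0x24392ec20ca016420fb7a2d7dc24ae9ae8e8a121b2fa58f4f64cbd,
0x21189c26e21919c5753013265d6421a1d247cd7916b8add64da81c,
0x2bedf5df71916ac05f4be07eaa1287193acfb9571cd96e450a2f4dadfb0a20a642d9282b9a9434c59587add0be694a30d3139557b5e8cb0d52d91bec2cf4e,
0x5d176dd295fa4e5d38df882902419ad7734987d05dd9b8816583447d9d7e53bf70a8aed9b8fe3067ced7d88,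
0x460a057450e6e8e0fc93e9c542d51afc0a56c3a0b270f9d13d0c3a9150539985ef5148db898b55f3b0c7936c6,
0x371922f7624c5a4c4ceb482fae614171778f931724572294c3e63d403e2a902c9627e0a795abdf2d2c1b41bcbcff04c5a34bcf7108dfdd9886e39165127492aa1c816ce9582cf8208e81dd6b2d6ea70540a33e9858eb86a6b94299065691bdad844bd94a424d524b53b38373fafb98a39605af98d1cc62e635635350,
0x23e1f2bf9e86104e5365551e97ffc4ab05cd8daed0b8a,
0x1fe77fa7e083478cc311d004b47eb42aca96c261a11ebe1cf4f34e586db3ba4f814064f6f461b534e75aafc58a5cc8dcd35020e9e41,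
0x2d7f576fdc62cc7a1879fe67274361acb498cd68aab89,
0x39fcbce1613f0b7c550161feaf47cb6cbf18,
0x15696a6c5b242d729d5feac59a9d65b58afc8c8091ec76f0e0fa07e835e77548b1d2a4f6b1c79d6f2ca697dbf7facd5c7dca7774c847d0660d,
0x11f83f4d1030d369effd7bcf66ace5541758,
0xb031243be984ae8f3ed751049e1a147be9d703b20e982cc8fccba661f6da9d34dd7731006a45a92d78a17e9b4f03b2889d8c73d76464e3b57b85441e1c0d5ed6ffa82,
0x642d755648d7ffe78e4e2b10f38a35098d6c1bcc2d1747a166e0edd426c81e6a6090e96b8db0575a0aa49db06b1ece23ec,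
0x5117443b46ce7c6ba19da7cc9fe,
0x9906b1449f2bf27f58ba369a7f8eb5917f9f8528bfbc189a74d4e0ff037aa1,
0x3c8472f9d338e984f9be01ff2890c284567f,
0x253554821d0f4cc6fc10b642d47d01af8a69,
0x1fd2ab85ce19e5063f4df272366399e8b965a39f8021d,
0x15ee13dfa5fed938fea18043c0c53b2f622a722d196a93e9c9f742ce05f6b9d7feeed115ecf1ebe9015ea47db96cd2c56d42b979003586f274,
0x115b6046dc4481b9cdce7af7566ccb0fd719f5047dc0bf2feaedfe,
0x93f520fc5ff064631dd1f31e5159771fe8a44d70ff15e0fa27186,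
0x9cfb6072c8f4aa2cfc02258e66529561b2602b4178a018025564121acc2c50,
0x3e7be2fbfb751ab10dec89a99a508eaac0c3,
0x2432e20647cdb6c369c14ebd5fbcdfee6d19d2f08823c,
0x360694d505057567eee3c5463ee,
0x7aa79667b63c425d2743f754553efa6f8aeeb9b3ef298392fb4af07a88494d,
0x869c51d20413a1cf8190b6187b0e831e6a1e9292ba6a89ce307df796623ccaeb4d7f5c7c2c5db51229b8d665b1049585ff0583ced121cd8e74048b399654800b048b5e190cce55e20094ad1,
0x3d6a8081025147ae584db1cf1eebe735e400ac5db03ad017366f89dc574a660f4ff7fc93b8fc2003,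
0xe268a2163e5888df4b9e9590d183e5bac05c31d07fc036a76a873395f2f8ab,
0x4d46e98a3b801364023bdafbf9a,
0x6bd063d0eb34aa3aaa0757d1057a3480e78f37b2693bff0b3b6d9c8c5e2,
0x2324e1cff9c9bd4f51c293745c0379536003e271461e79692702488296755de52c2d04537b3d2ca2147e46230474816f7019cf58201850443017decb614de,
0x68edfcf00db20fa16b281c26b4a76bf3a6fc59c8b73cff8da3808e06713c0c90c69578a68464359d97bdacd16462e38e0cef8a2ac15136273b8bc1d6a031ad4dca575e79434f77b9fc260ea614181cbca04902f6db8a704f77ed9475270a3ae3166a571a6bc121cbd0a77b8e6dd294248d41a92df6f4a9d4eb1cfaf9,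
0x28e6f5e72271a9d2df2b6e23a881084799c6,
0x271c4835bac45e54c604aad4245370eed6dfeec0f188cada0aa93ce0744d6087dbb576dc5a94ca57a68fd7be34f983a8df90392035cfb1c676f2f9de30,
0x5f6d96a9f544e6dc795d6e2d353e4e06a1eb091d4989b754b6a0e5ded7775004f7a3cb7e8b012a6ada1c752d8,
0x4b7d93161aaacf80c3e86c473d2ee578d002a3f22efac3fb805df78add408903709735834b98e27a7d8ef5432d52ea2d239927154b3ac11b83a1678b67ec7ec86ea16,
0x23bca4ac44dc1bc5156f8a320886186beb2b544c1315,
0x1cdca1291e8ce89b9a936ec50a3e9b85abb267a62aa96,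
0x142ce1af0352d131ea439a1ffafbcd7778f7a5abcd9eab992edc5c6dc5e45ee29a8cfd2824ef40c82d0def5ae01a6a3b9eda6d8b9aec2c8067e2b339781c1,
0x150e7a6abd8f0ecf2d99121b7cd1ab025884adebd5ab7,
0x31d0b7ce78ea3223ba4d6883f575c36f809c03e1a32d0749684,
0x51ecddbbf69aee1a55,
0x316a2daf6c6a41fa903b5e379532af086b849471f40baa20e922d4d187cb,
0x24cf693c2b0b475d9fdd07bcc3d0c75712ef5325b34917a2beeacc43a34c15e514757524e1b032372ec3a5424d380bfd63ff36c319a45d43a3d4948448bfd4eb9b330e0b8fe0886,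
0x1eacd2906353d90b13640b382c3bcabd9f2003e1932814cd1acf69dad892b54e02ca7fd51ec1965f19de2cf1982adee86cb86112de5f76a72b370685e1e6e837313f9e,
0x3ed90b8b3bf11a81d8e5fa58b7b,
0x1c191ecdec6cf4a2bdfd39b05e99954d691e587ce2d5b52e067507212c2b341,
0x3cec36a1d52bfecc73458992ade1414b8121,
0x36013e9fd4d959ded2850d29542,
0x8b3097e76cbcff186dcc28401d69d81fc01cbcd013703d5e9b7,
0x430a83a030b3770510f256e5854a67823416c45395e63cf3c556ff1c666d6481e8a0767a7a750f97,
0x147165cba912b2b55d560e38670,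
0x2c8616d7a0244fe7c161e51811c429c125e2d435b36d6,
0x381aa40369a9a59c51db60c3b6c,
0x3ecb728312025e7cd5d921cfd2f,
0x950d1efec332d73c92e0a5055177dd06ecfbe0ec6557cac3bd498a45a87e,
0x7ea1f3a7fc8b936004fe2800963b18564fb707e09296d7e179297d055712f43d22978133c0acef7ad37cc2382ea47e961fb8af7ec65c688dd5dee38aa9988fe9ca8367349be3d64b17f3eda,
0x1e7417fff7326af311e7f77927e8ffa0dcebc43dd7ef83c3f99b0431390d6b59c593a0ee05809426147742bf5b844fdbba3fa6504993bd72b32a5ca81fd3689c019dbcbcbbd928d7fad58c8139b7fc2dd2ccce5fab87bece91b4f618c886d7d5621e161b0d52b3c6312f886813dcfb4c133f22696847a8cef31c72dd5,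
0x1d2f5f01f7a35840a91ee9a51ec70a5de68bbd6ceae92,
0x4ed0103f7d7010d2e870c65d21e,
0x5231477dbec90e6ee0a66807fcb308e7777dae2ee5,
0x22de31995e85d076c64d24108d633ee2304f5f4f2cf9e9ec7ca0e9,
0x2ab355148a3ce040a35e5ec0b91eb84064a578c8cf62c,
0x1a91621aa1675948d9d694739a45738ebf23396e439288516dab078ac580b76,
0x2e3ea22eac8788a97a8d20d9a0c8c9d80b8a,
0x24fa728be873cf41f2482fabc8848555d25793ff5caa2,
0xc4e133d8de16b4ca983aa19ff69687c3fc6473f676,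
0x522cf8bad33eb3c7f74b3df73c0,
0xe4a18b9929cf637df6b99ee526d9063695b596f681b9,
0x209373c5e371c3b8d5b48ee8e1bd76bccec98a2ceb5a7725c90bf4,
0xafabe16e80d496f039d080ffc09f13841f64fe9b0a37106cce9debb5343c63476f316e74fa67a8b3,
0x4f2cc368f2dfd6ec2c924a2d81c69e9c8a,
0x48ceef51e44e72ed484b66e6ca2201f43214848d5855471e765ef9207d1dc43a55171870ebca539b23e49595fa45b6185703d9a999b8eacbd185ae1d070,
0x235448074e8b274e80e3ab7ae30b3ab345cccbb2d5896,
0x2e2be6104173c7bedc1fb1c528ac31191470,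
0x1ea482a4d6ce7cab2b0f0f47747dcd9f21c36e0c190e6554f3d83c10d8dd458db285ef63d83bb3d42a857a89b5b9c34a9e59937e4b48cf6452f82526e838e91b030357add9b5e07,
0x1f2148536afed09ff5c01a041eac09730c78a82b40e8e,
0x2ec446c8799c0b7ca8,
0x9f98bcc77e0abc55f7c5ea20e87fb047,
0x8d72aef9e5d5ccc84ad6855609aacdebf3875a34e49b70b95299c844ddd8db,
0x16fef45ad7206f51832bacfd98d1225c23176d8eaa9731feb94c558ea6b5cea32c0599af81081e3a3864162fe7e56930e83f27eec31e710505f97e72ddd7ea11c665db73bd328b578ad0261c,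
0x20d5e312c02dd9688b9fd5be87237257b9d364a9cc2aa73de0d544,
0x1a51013a91ae948472783b0d41e6ab116bb0cd6a3e1a781fafac6a,
0xbd26b90df895dfbc0251b1990bf07e751c3e567c882c8b3166169159433daf,
0xc0fbbe0b4b8c46c900c30ec2d84cc3df02b70caac157,
0x3e12b92ad463d7ddfad979c635d710646618c49b516f1b60489f40d222a11d09b36df14c0704054f4bf82c727b3bb20a9701d3e0b3e17248b4992f001bec7d186fdae2a1f00c2bb1642a09fa515963091cc15f1c0,
0x1ce6020ed2cc0872f0c926f6973d52e0b221776b9d74ea2e85b74c0d6809702d2d5a2445f529ba2f7e4247ec591131a5aae02c98a70ea0330a02de2f06c2a,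
0x21fef05937fcb1321136104fd0e9e98894008fba1dcb6711124031,
0x12dd8bf5b6c833eb922384a46fddb7813e3ca6445d211,
0x109f2f093f808a6dfc2bf6c71d361ea608788494ebe3fa5da92ab29c3d050f6,
0x52c87e49dee6fead0d944463c1670776d3285ee7e6ff3aec5b1c8e91f8711374786096b4157eb4b889deebdfecca7258e8850c9a589c91d3d765f2febfb03f2fa59a22bce2e18e,
0xb48e1414812755c9944697b58f673ab52d6a6286e5dc98fe342125554c5a0d0f1f0951f9b662717259e220468435602f78ff703c40869b5e455bd2ff56f0845b8053abb0d6b2f55346840ea7b7c942a44f1b766a44ae3a1fc010a07e495fdfaf02124b7e13b2834318662ebe70bce52c14f0ee469f7b5b1e79bfe5a24,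
0x8e8c5b0aa93cbc91948bb80fe6f623f6c98ce932082cc0c1e4d84ef997d437bc19fe37994aac753e6458b42be861e06db501b70b88c186f87e6482e07a4ba05cdaea1d8a2a4d7d44e8e8fb28898623b4f790612f314ac85e5fc379f192047a4461bbf9212717d1967a7c50f29bcdde9e034bf1130fe89b43cc3adc27aca6faa7c01e60cbfc0,
0x3c52fc6a8fe8c1aded89eadb1a1,
0x2823f963d4f68c78fd508114ebd912b0033cfa3b00,
0x38caac2cf9609b0139bc1fbb1caf9e8ea4fc,
0x2393ab417e8324c2099f021dea7757e18fbb88a3c228d740eb0d8b,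
0x1d44c808ccb6ec9d0c79426ae4f6ac04a05ead1a223b3b93bd921ed7e4086d1f84577,
0x14c878c6ffb5b31042083a71a4b93f5c49137c8799f1bdfa5b7e18,
0x105986477e9cb6ff110fcd93430efffa9d1cc0800fb53c7e469b01,
0x51f468096d6ce7908f799f681ed96fbcff0b0274b025c9e58fcc86b01d661d9be147cd9,
0x3ef09781a9b0bb6e01a208907bd08529ecdf,
0x18854bad6f926f0a0ffc9b4c438a9c04e0830c8e2ef18cd9d9326296fa55,
0x858c3d2e854598c9569355e52907d3e7098419e844f570aeebac1,
0x656700812ad3cb3f306eb66e3346c57884a50a605bdaf6c6025d71a3fd8927ff5207a0bc74adec9ad35bd8d3ff0ffbd5971449e41c5b8d4b32ba167ea688744f33bd4c3f32073fb7e52f61c99afec435b17f1e665e716e3152861d4f1d3437f9858287ac9177e2181c2ccb46ef9cf8ce3e738255976f7f64ad5b4f2e2,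
0x3a90526f25f39da0c0884457601f6eae831613531e11869445b95ffeda3973bc2cea29853fd33aa7f07425e229ef7115e984e8306e2eb80d7c31d348963f8,
0x1eb4ea4bceb0596a4fe0e3316ae14f4adb645a6a589a006517dddfd9f9085a,
0xf77670beec883f222cf10795c40af7e6a3c5beae22b57500d6759a32463f2,
0x85ebd272a46cace37d59d388d884414885a656426aee7e22b9ea6,
0x1506ccec4b11afda868d077200c21ef615f7,
0x2c5e240d3bfa6b65c46a7dead731b3a4ec188ac60c8d9,
0xe68264ba20cb8dfa65ba780a40bdfa3f1d1b527197b04616606af87adab867f1129193504bcdc10e,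
0x5d9abc58f1bcb12232bd67001b786da5b0d4599f6ab225a1460564977a181571b5904a5,
0x2e6850a1c02e32464f3a2b19ebcef36683c0,
0x40520878918d9dce210563ff2ce0f6456c8432c7d6d0401af691e86adedff710d328cec0e9c8ea9e,
0x38520fecc8aef2d20627b1cbfd9e7a34b684,
0x1d331b08be73a9f1168260dcef0698328d4ad716fe496a959eda9564b55b,
0x14489239fe3653894731e5b5996472f752e2d1c6368c3ed8520e788a885080770353cf742a01483,
0x1f73e4ee81f787fa479fc0c211e07fd587e864f9966a7eb03da049a231f77bb8f4661739b659d4d17af06dac09e4c8263c92ab5aa80,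
0x1585aa72e6ed55c65dd2229c29ae9ac5cb7b5f85813589d905952a5f501427cdc511cba47c2d2268d42659e5,
0x8e0e88d340431a102a383830aa1fc43b65c73d17cb891e082558c427e10dd1298cf3675638f353e58c62c3482ada5ffc,
0x6c43411c407905686df63de5c4c2119424c3db106d1c3ed7bfa0965eb6af22851e91b2d382a657ea98b8c4bc65980f439e29d30ff895b34924f9ca5907e5fd8ed4a373f744c4e5be14c3324e7a5d811d65a0722f5f37e5ac6177b818fee8e40abc081d87d2e489c0ff6292c1df8f5964b068b64ea72fc80,
0x2ad6900e325170b1141bec6f5c87dd413eb584a4c9e97,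
0x362a41ea856915e5486f09be0830f3e8f1598278f47787215403699b3acc8ea40e6aa4609481ca2d44765fc2a3d08fad7def54d100edc1a279305551674b11b369a3ad6b6f6e,
0x9adb24725d9c6bf81f6b5dfbf8746be5a155bb244a26039ea185382fe2be3f7cb73ec97,
0x4f1acd8c812a29a7bd1af5e7227295ce7946cb24d8dba5e6cbcac52daec0373d9ad14d4,
0xa89c4fbcd895d0b2954d68dd8d11e02e77b9cfddcadbd371c68fa3e4de8753698fc750418531874f3684dbd178ed58cf8415ab3da329b364a90a1e7d25fac4bfdbb8c3f3d57501f52c19916ffa3e95fd4afb6671cc61ac75e53e8b79f43c1896db0f0ba18df8a086a3d22ca45bf4a03f6ec3edd27e4dcab,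
0x4e3f92bdabe4f74cc82dd225277,
0x3eb17e069c3ea2160eaf92365f72a640aa74,
0x23dc089a7ef19f20805e2ef200e,
0xb0790ffb0692dad9c0cbb1970a4aa62101abef32df288236412cb0ec16415b9a538f0,
0x761ddfd7bd36d4059ebef39f0230958c729df038055a,
0x2f31cc9860d06e5992bf677fcc1666d0246360c20bc,
0x6ca3561be93e4419f06a359a0b046707d20d7f6017ad7c2c961791bf0d79d98b5fa400ad61ea6270fb3fe19,
0x11a848debc6d06d8cf7bcac4bc0cc6a625ce71a313f74b18ad5ba876daf81d3,
0xd88c34c182a56c177a34e1a3aff8129e0b0ce76f800e1c303ed4b5145d5ccf41f984462,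
0x1b2bb767c1c7d4c4cb976914eaf8082cf88bb225cb4b48a6c65dd387947fee2793a69351b7ea6dc6bdf0d000c848f8500ecf9618168dec317e2757849ac188c52a33949865d2ce79d30c98bbf31c4521da53fdee9d93cba68dcf26676cc8e1c0ce76592b05d3bef5b3f3a15ffd914bf,
0xf89ad5a7a8a16df06aafbdc4c49fc27226b053d83c57e2eb5249e,
0x22556020433fe87c3514a986241d7a7e298994fe3151f,
0x23cf3f61007a5ce9bf9e11853f79476a4d6,
0x721cfc863fed8d9a2203f29c3844b186a5af335339b3d0664df0610839c985dcf64eb58611b0d96cb84573cae42bd22f24fab3a6,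
0x18d647c47c1b88b5cc6cdc88c4d543d0ac4beaf25dea292e8515995fd045550,
0x55a024e9d5ad56c2741a6e16fc566ad66d778127f790043d1264e8ad1286a896249267c77569b2261eb49fa94,
0x84d0758dde4998b44897683b54e36a8c327d50a6c81e368ef2a450034008609947ac9013d90859e6cdfeddab12e5ef4ce8b28ee22,
0x1aea7128827103c66fbd88a92226a3a555ce82e4c3643,
0x38c9771991d7da2d625bef01ffd108bf3fdf,
0x1c873f55bb3182c176352f5f801e7dde19906bd22166a87edf725717439abd1cecf013a06b16e197ef473eed22854ad25e13b920,
0x4f17008fcca2bb62269ac362e9ec6733b751cd374c7139825c3c9403c9484c35ffec8b0c2fb180c85c0fcb2978c62039,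
0x406e2e936ade43b39e037613fee81b9164a5c290a5afd14271e9280480382c,
0x6186e758144f448161a1d43bd6853f689d762af0a099ef63ba74bc243ca664d3654c6540f8790cb8b1c2f61366ffe407fa,
0x304ca6c63e42331ec729a94d6fa31a834c385777c0353dd48fbb6e21d7057f16b9b5afa,
0x11fda135dca782b21e0e07412754504d236d603b243c19fa3e76344105e68a7c1779780835c8a0c820327b31ce1967e04d484dd8f1c6b2b2468576f07d3ea9e4ab4ad4f72834e5cecf1ca28b439799d3647320cd254149ab13a94e7e2fb974a4c080b581c189943745715bbf78a6b9e9d50947dcaa1c9745a5535ab00,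
0x2e15cd45fd7fd438491bd36c354537d3bed,
0x2f06de30984dae8faa97ca6d8f3570b9cb25804e361de,
0x2c7192e6fe8c3874b5c8abd77c6fc693e3c1b7a369f65,
0x1128e2968ac106b5555e5cc62a695a4b0cbbbc5ff5c2e0db992b6129bbc4794,
0x10986a17fcd1dfdcea3daed3db836777ea98a0fcdced5ffb8bc134b6e57583d8a8906db2ffdc339af2cfabe4974ff753ff34e06e240a8c4b518e6437666728751810,
0x4eaf49170b392f8a74697debf8a5bbf804592f4c2c65edd6c8f23a82ab985b7ca825eb7,
0x38c34c0d79750c043787456a0f71a8af9c82],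
[0x4c1ae91e5181f4135a7d36fa4afacff18eb2878dbf82b7892982eaf6b42bd000c967662085b4fb94,
0x9e519380d81a57e99f889bbbc256ac23d43965de73a1c710a51a4,
0x1eee9eb8cff5d229f87d24c7613c505a51366f5af12afe38c67f183cbd70509,
0x1daf6cfa5c438fd4d1d95acb2cff2169a40a07463263e26a60adc0,
0x1170fefadfcb852a660d754fd73f977c017ca9aa62dbf0f779b875e99b9f1f7417c30697,
0x1609a79464ef8300ac91b6038a7fa39545bc625e779830124f0319d571961c6,
0x83a0f6ff639035a01759dfea4c32059773c3f0075828b85d1cb14fcb73961982b2794c6,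
0x42c8dd93050bc8dd5f1bbaa60e8615b6bff3144ed347b2643e9977c5bcb5dadc4869df9c3b8edb2f5edb8055b07655c84d,
0xc40d28181b55ac0ed664df6a217849ff42a856678733bcc73538c6c4a8cd2f5dea6e2c0cf3b4f687bd9b311905d8a321f5f6ac2d5be3432f76d0c1c4f01ba49ccb7a622d1f8f0ffe17da6997b5b318111e27e40512870cb963f7f9938d64aef505557c44aa35d7e1e99b6458ee1c66,
0x344dedc6022574e7f97e46d39cbca3d917d1,
0x2c0d5bc15f9216a3bcd1b6b178216067e4a8,
0x1213142a6803870facddf13eb710d1141ee6,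
0x1d5639c5c0e2330ff85471f07a59a496e98a55b2ce73dab21c3b81,
0x3792406af83f542c5de5238d7d223f1d352db2487bfe30b5ea9a8505f34d227ca58b229e80ed2bb9d40e6d4a86c8081bd960a6975,
0x57639848e9636f1e0882d8f0c923759dce473ec5231b4a82ca01c78c4db1642e6cc53ef8de5fa5a641765d533,
0xd51faa4f452ba4485705f83dbdfee49594671c832f8976780558250a0fd89e,
0x2ae2507d8952a7ec8019cac688750ce8cb81566712afbc5301277aeb2da20a7fa91acbf38323c1b49337077f2676fa306eac4b5e2b9f77af14c9c9a4ca0d83fb2d86115c5c4621a35c38416f30cef880a41f97a10eb81074c9b0c1ad274a0778f3dc9b7f87c,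
0x38b422ea14ae98e4aaf660312184fbcab88b3a0764120,
0x2e1a56ba2170e5af8f87ff32d2afb05a425c39e76c2ce,
0x344c32635454fb253785ce21b34da986d789,
0x348611878eaf807006bd2b0c6d8171d85600435c59e542e04a94c34e62255066c6918cfd793f7025ce6156c1861f0bf584295ceba1c431ec0862de139e62c37a9c12dec63254,
0x11380f1509cd289089842af1d95695b44a76230c9dae9c26f0ea798bc2ea572,
0xc637b8d2e7ad07d1f5a99d3d59d370489d9a3595deb78ecf79aebf8f863bab6e5c8fa281627c89ea,
0x64ec127900224eda94c094061478858ee98d8f9051fbfa9c5043446af2d1d92424aab15418650cea,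
0x6d69b73f7730aa89b423560eb6e824598ef9fcdcd2310771fb1b37d667d7fd208ce6380bb474b212,
0xb2c82391d22a62187d8d5fb8dd4d531913b08ec3f34a48431d704340e693ceef3fb7fb18676a3582,
0x6358ad29cf85e1f4de3c6831e7dbc470acedf8401516b98e58f85bc7cafaca67b1888df6b504c23f46020ddea8395cd6e85cb355a2435d4b1a1965fbe25cf737274085844755dc63083174333ec91028438d30e9633b99e59c43c651fb776da19c59418221c83fd2552bcb8e86845a27d5361db68709de298e388e300,
0x18dc1b0389451af746e00c001c9d2629618af55a71fdbe5e7c5abfd4fd6823be8666fb14,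
0x353343bf8588898ca33ac08dfafd05220c56962506516,
0x62a51195eae9e5de0f1f9479df0,
0xad35ffb13860e4348351ea9c2ab29502450754c2fbc7,
0x11284752920f68a12fe70133c8262fe43116fd50b4900fc6ff3db9601c99e01,
0x35300ab28e8fa4649e9673b6dd08da91c4b6dc2cb95d6,
0x1f428c1fc9ef091cf60ff86897b454df5a481219288239dcce50ec62076215d,
0x1df4259634b23df94d167f69d5328713bd26e8afd9692,
0xea31e09f5203119d417c56ece61c06f0ac5c2ea689736c08a5298acff9de0e37e2e4ef7c68f3765adf438dc58,
0x1b63ea0f553ee5e62a106359d3fd98c458d790ba45c6230cdb761967270f6ce8304fedb3cfbed7cb442ceb434f8c63b2c758b7dced3c43424ca16eb828f5ac49bbcf931da6b96,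
0x1e5f54bf12042b418bbff789c777da4b4daa6a3ede7b2f3df2e491a395903f877e0e13631fe2f4a966f6e6ab06b186d8863cf43b2885455a252d,
0xdbedc71137c78fbff3ac9185a44b0c8f93926f8f31da6b98d690ecee51fd2f8eca3f29d883433e04a226e9a77c965129ad34078e0f0b3e90bb5d3bdd62d9c1c72ad07d43711f9a2d436b437aa371389d6b30c3608cf0542814c193a54524cea1c7edaaf0ac2e2da22bcde451c716d8,
0x3af91ca6f3480987a89451caa37105b1c322dcc8995d89dcf367361df130e8011b5315c3a9bc045014c7f4169d9d08314c0de3bfff5a2388f4b7bc6c8a86191bfc237f1e9fb2158e8057c4498dbdd9d88cd34aa5a6f0ae0ef08fac7b3f024647fdb976171f1a42274251840194f4315345f3145cc5eb40e0e0af94bb273b4063536f0ff2f10,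
0x342db3d5600324b3e0a9e8d21261dbeeb40f3cf3b1866,
0x29da0bc2426338c2cc95f38ae3ba304cbe68f59e88e9f6478c2a01068c3f7e4d5e0037baee19417a192f117f22f18d2a3ec1622ee36,
0x1fd4d1a8d39c46911d117f989fd11ff83724d461d823ac2d89d1f499fa9c8f3,
0x116f896da2b5b921fbfbec694ab0874d49c4aa048eebf8fcd757c6d40ff5cf6323f9ec1df2fca55b0,
0x20545b1121a1fa9d07f04ec666ebab9959e85fec9bf17,
0x10c05891380b2af8a41ed8ab084cd2999bf69ed6f615d,
0x44f2e4770ac96d5820440e80bbd844f79210,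
0x13fa7cfcc8b62aba565e25955f19b55de460601ab17517624970c4,
0x4b21998bc91552af065e99554e7f39270cb4,
0x21b2d6d5807227eeadf930d62a19ce8d1c05500ca959c880789,
0x1e1d93baa4d3e2f744b5c5e5779d92709c63313501355a8c979d9efcc16db17f6ed4de8ed0c34510f34658bd16aebc0c6a956fb1c86bf9acbc0f9a9052830c354cb91d,
0x268e23731b9d5102a48f4be7a632159c451425ac372b80eecc33562382d2a4accbacd2ccf11c98cff3296f4dfea08368d11745916c89571b330fa2669119b939d91830517a76cffc09d8596a7b474af991b7cef5578c3b248caed7f98fc9082cc3dd9faf82b4ccef50fbe31bb3bf5d0d04db80c33275d6e1cea802e4,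
0x34db42d3270d3f6cbc42384db040d86002c9b82172b24,
0x3b0ac40ac9f477c6df37fcb807a9060be244,
0x363b7295c167d2648cbd0ba48a980aa87e7a03c21b7b53d120db4bd44fe3066ec81b2bcfe51b946cf84fd813fc92d4c40e,
0x253c00ec9c3921492084fd9e57859f4f7529,
0x4a6fbd5866d76ba104f444f81d2aaac4d38e9224c5ab484fc92892db22332f61df81251227aa0b5b1e144eca6a7c63c,
0x479d095627702daf4f67d530b6a278c453fe,
0x450f65a728360b53e11044336f45b292a91b6e97e45ed0dd10234b637ede368eddd763315fd767331d1489a12,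
0x4b6ad5b674ffd21a5db7709dcdd4837d5c61d1f7c0e1d2b50fa0156959f1d718047398785b4f41909e36e2ac39f9acf37df0bb382aa,
0x26c5f269e186d9f9e784471c982464a3ab85a151203cd,
0x4737b11c023e12c0a196730db2bbd4cf0ead,
0x11e5838cfb4d74221b5f84fe6bb739520847e09bf25c126e023ec7ae675687a0a59822f10592480700abcc65a16958b794e789622bb41d52879af1f3165,
0x17e9083cc650a695e19ffc4d4098800970ee1c41abe4cc88b78b58fe76096570c42d6d424684f877649d8c49c0f7869bbc16d72763eb2e11916cc1f1806e2cbacd2b715e5222faab515ab2c9bd00d97956be533232fc62d58ab15f607ac33c8bf932f53f8c8f0f516933423ddaf171908848220d1fbf5f3d72535439de,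
0xe03e2f364c8b8af38260095f9ef8dd33e74a0587bfd0d6c4810b55213ff87b88423673d51bdc4a85fe636f09d49edf36f7fd9c467c1f225ddd340a61b4cbb23413008be7fa2169ea4813102a83aba1726a5aafe530eacb8d685a0e5185cbc6341e0ff2919ca9dbd8e26d0f2daafdedbaf2b108704aa5ff61c99671cf128fae02af146a43609,
0x2372acf8cf27a96107b8494f13aff3be52be0e269867e223c00f0a,
0x10bf0f2ac2cedc8243bdcc9c891a33c4e17594027e69a,
0x2824ffccbaa97fc55ec84e106989854299ea4c90eb21102bc92a70,
0x283bdd9cc9f085be30c18f51f60f558c28d6662c1c8fa,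
0xe060641ffa77f9f53322e942983eaae7e28eb56ac9200b569abf5534d6a095f9794fe0f22a5aa0e38cff1c22cb909e4a5228bee538a7c3eb1f2e696d16d374644da,
0x29e3a0cfb43e8c00b73ebe1eea756812284123b7453b5,
0x7e0066b668a60c4a04cae32c9a457e111f119cfc15ff8fba643caa985b99fff460f96acf77d6cb9ad7d50a1782b9549901,
0x34dc06a7701fc750ceefa7e63d99161d6d6a2480f0c0d,
0x8b8d26ca4c0cb8b9620595d184b750fe85ce2bb561819f2ae696a76d0a6b70de4afb4c2aba9be959a034b3d97188c73,
0x363f0e8cf6c2dfcefbcf5f6bb25b9442b26b9659ea1da,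
0x362f06d6711d1d1948573e753bde2a0a3d59113da8b4e,
0x1bf243fa87943ff2a8334bc96a6b1ea48ef30cb1f98dab920a26c4b6bb69ea8e7fe25c61cd76141a078304be97c26d4faaed673ea,
0xedba0ba51e072e50512d2b182f273de3a6150d12fbbb,
0x301b03189e032a017cf9ffb2e6f4b285bc1fcbf599540977605217a418f3ddb55da86ee0691849a32901e8c05a292ec4de,
0xccd59c7697b6e02cb988ba0cbf611eac758cdfe897cd968d4a4115abc414a633d1740ef,
0x2799f4bf9d758df7553014acfadbf6392d1,
0x46811339ddb4a57e0879ab2e7e4,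
0x345543e7d7b7e6babdc3f8c3412225bf269973fb65743dd187d,
0x3993480737b3f5a4721f059bc11ade6cb3fcf338e9427,
0x444f7f0c7a859ce62d,
0x8c3e0fc4a7c8512213f65b4a3edca9b48268efaf75d5c78e239,
0x3aaa6c1d5a8aba8b171cc3ffc7c0a673a609250ac7c02da61dbb0c208401c67faac69311a93fc82d41621a51fc21cf78822b2a8e2311eb35ca5eff9cb3,
0x5724b2ab71c2472065d7d320c7d2dbe6aca97743a138457c68879b218e47b2f0628eba67a84d8ea789a309ebb,
0x3618f5c53313ecd6f218b06d24d02e5c86e45f987d12f,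
0x3206b70009e0f2945458b3a9a6dc353680542293a91887ead88d94a178f85da76f64a6a51d7d9d32dbbc7c315d6490df54da34892716b334828a,
0x2fdccbd0aa8cf22264cc9aceb5353edc473f51ca77e650c8c9c48791b0899a590630ee302a63019bd75a1efb44dfc6932b,
0x65946df0ce07dbf4ba2fa29265148b8dd52937e6c0219dfae8151d9bc4b9c8d04e87cc5295a13fed5660a579ed2b9853e31306df6279eec19b3ad76b67e5671e6499fa7001543cf6cf70f2c369ea03075d86a0be6c2ce68e8141faf6e536fe48887e4c4122832e0c98243b7fdaa5566030ea1b40bf1ba09f822b14954,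
0x34966a5cb678ff8e7aad8775589057b74a3ddf1dcbaaf810893b709d3cc13a7b920a628cbbde03a0de8813bb6b0704b5b91bfd235c6,
0x1e311377939e41e4b0a4da0664f265d6eb49f36e4c87936b85b4c1,
0xae9405b09575a6b06863f8983d69d4357f82b8f38a9f5378f70ff6562866c7,
0x1226cba0fc57f62e5b749c7c7f856d8fe11ab24a1d3b690d8405f1aed3cf617adf19d4d6fe3a5a9f7,
0x73b96af707912f9df113321d9220b7881f664b4b0f7e7c134a7f035595dbbc9bab9049613eee68ac,
0x19b548fd17d9603eb94682778ee9669960f1f489301ca0f8e0c171aa6bbadfd,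
0x122bc97178a87053b67066569541c10fb898af4feb474e5ceb33542b49d96f021b512348a9e87471a,
0x199ea072f6fec3fea501b11fc3cb0de7b8f5b6dd15c4135b366fc3f1404201848fc14c6212163193896a36133f6b3ff37e6168040399b4cd1f5f0102ddc53e5b8ccbc2bc5a73aacc0cbd631ad88f3a9a66299f01569de905f8efd17dbe9082c0b8f3b58b4529a61aa5a15a273f0f1f1c8edcb766fd71bfb5b,
0x98d597abb75af197d8775860e12fcfc9ebcd90a2bd09a40392372d68421a81a38fe9ed9ec7bad583,
0x270fc633a51c9a5b23d3debcac66c1213eaf8ec1a523b756885cc4610d0c782752bcd0f418f78a6c0010f692b586eb2af0aa2937e9c,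
0x14922d757cc82c628466d2cddac1d5805bfe9e652f8309523b3ecf1f04e269f9f563b68518d8ee693f870a86bd4c6d30764f925f7cd147a893d7f1a4ab430476df213b4049d5391b6188dc3dff5afb2173dc6db289abe302eed48125fda4da1600222d6fbe8171ca2d0106da0fc88882be20e6a1cfc6629ef55922238,
0x80178f97cd2f15443b6d73a4864df1fe2c15a4e8fd75b25a48fe4c077eda77cdbdfc7c360c40daaa2e74ea5fd,
0x181f5c555dfe05903983ce47c0e51ed20de88d829638f5d10ec99de9a449bc9,
0xa2691384652ac95b91de3d5af94c6172bcad2ce704df3b1c0498607d9e153e0b91103a9,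
0x1a2096ace84368d22f08ee121dbca8e37b977f753d65f,
0xda0feced77d90aac3685a5c7727320a05d56874ccbd8,
0x15c866674f26b190f27d4ec02d2ddc7416668c1c0ae931b7da49e8148cca2f4138c8eb2fb32d56ce0944ca9e3c42cb141ce6c42a3fa37861c027f0a03a921,
0x10d024149ee549da52a5141d7bd260a2011244c05e87d9b3d06fe42a23b0489c44141c0e49b36a016690222605648828a4190dc49df53938feebcbb256d4004df9d09e7fe3ad29ce7b17cc1372eb56daa3dce0f52019950cca551675ee368997cfea52b57457de40a921f307914446c9c03f28048d583214cb223e1b,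
0x5ebc4057f8ebe9ae91d70f47692,
0x1b862a2a219a290de92df7250ff44940948f55972c9ce,
0x59653737231514e33ce6e5d113e24a4fdf4155362a85043a26045c2e62d2f018c3465181afc5ce0ee43a4bac06dda53c86b5189a891cff6700607f65c,
0xabd69d5752e535a255e06ec6cda5437a5069ff80043344c6b2ac8b2b7e92592bd44f6c1e906f37b,
0xb980a6e8348fd434180170cb3e71892a207540d15d33bf7f444eaa2fb27edc,
0xe0ab6c808b04838e97c3d8ccce5e4ba92de909508049411dd4942abbecf951407803f4bfaaf4d6bf,
0x10df94b3a1f07cd525000930638d6fa8e2e95686610fe,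
0xece2985fbd25440671eab7e47c44f62739c48b9d585c73ec47620d173ecf0b67cf5da9e4e70cc,
0x800a4c810d84b495952afc42c41434b7ab8273492c698a3b312c1c2cfc574efc57fa333b5864dac1bc3c8e5e2,
0xf8969891d6df36de7fa9bc308c4af542dbc4bd8418af3546d973af0eb9a5698b2e59f175192d61d6c0bb85966111373b85eb19c82e22a3b5a7f0fbac711dc6e678708c637deaa3236b3c420d2893bce809d85701ea35f8d6130dc8b283e0c0b91e776cb9d9b0b7ff1c90001493d16db04f2ac60,
0x17706c5d1f44a3f9c3777dfea5fc93f5290156c9eb4c0,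
0x179b49710cced8403a29161ef23f56e39b99bae481ec2,
0x284299e320a776fcf1477645ea4e2e4c3889007d3a8848bbe5474ebcd2e376c56b198c1570a96d543a53d5745702695841eabb2acbdb39d654dd0e98a6debb57290b6881b5d287af5a73,
0xe2c4a05d92fb9994ac6058c8140e7dfcb9ee5f4e65354f90172b30684e48863892743f681e3d4015,
0x15bfe57d4dc50f250b7c6088e6f1bb85ffee6a89f0d4f,
0x6ccdc0069f98f269ebea8ce27892874ae97979a9a4672df963bebdc2a2265ff916f80b4107e0fda21f3ed98649cc3d2bba3fdf7db88,
0x3a117290a0209c400d24ae3b24ca3b183bd8f7a8a0c258bb9bd42f9cfef8527c07b5f031c518f94d49e9b55f55c144dddfdd01aa5234677da3097c93e54be,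
0x130aaf03308340a253e6aea4ab583190056a2999f76cb6f65621b13a054e484972bdfe035ae935b0e99c76a40c50c26794783a398fd6e08ee58c422ce1799d46e5a312434013b1029f84798f3035ec9e0de7407bc171836ab814cb0a344a58f29b3e9f188130a8b278f6b95bc0856b7f3b642bf27c944d3766eec9d8bd,
0x6ee5fe7fb03a90003809b2a26a053a1b7654e30621f452f0708316e3fde39b654ebdebb,
0xe06fc7a603866b56ed8dcfc28011d14868fc35c1db4aa24e8bc841a780e7f9e60bf4a9f9502a088b78f577c7d,
0x289b3ccf4f6a0077a2794f80d8888e05c6192d9bdc5d98182d05c3a5e4be17c88cfeb7accb49ebbc93645cb54ea9a22dd1,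
0x1c3a9e74f816558038bf07e2c02059378024374193884237880bf3,
0x468e461262deb458679186f6516d405796c39622097852fa45b86fbf417b12c370d36063701fec0be03e77e0d,
0x9d84dbd32868f1eecc0213e6b71f051bb5ee66926e5667b06423066971d356034ffbc0a06edf40c224980ccd1,
0xc737df841b1424432f9c93c1568b42a616d265938d92b61acac3f6cb5ef488abbc1bf120dd1c1351,
0x16dd1c99e2a285e2425606a89d239e30b9bd0df1f8721c6e1ab9a6f6fbea58c7a12781243a6f752806eda45ceb63d454b7fdacf70faf5ecf747596acaeeb895a9b8526bb10df67efbb1ae24f4afe084bbded899cba8be2bc7c6143f39f2c5cb70228bdb7d6e29bb8964b7892f1bed98f1f686adad93cc66cc386c1e69a,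
0x5d9acf303a48f98a61bd4b490437d3f5c18567c86b9e1e06b4a0b952aa415fa66b490dab93bbb00743b64261e265e9ad52c65c4c3526f480eacf1d262699b7adef869651c3042,
0x2a23d3bff4135b14f75c3fa83d5cd646dcd4,
0x474a0177920980c3ba1f0f6b07acabcf53776539753df5861449f2a927f8c678495a2332d042bba80b92f776d2713b268c,
0x688f4d744f46aecf38d01fea907ed5de2be4e162d66fa7886a3f0772c9917c7eb663e605e945afd934d870bf11ac8a802904a57aa48,
0x6a7dc64536be759c8346545754c1ed4b3db52326002ccf6504fe045e95a1d661c3e1653a6cb6f177bb2ae26c8,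
0x22ece80fb13a0170f3f724029ba2326aab29d6da3811be97b24ff6,
0x1a1f7f2dae3ae3f746b0f2c1dc5a51dd640f0eef28a49,
0x6699338070265d7a14ba6f7e5d289cc09387b82f3fcaccf77970b75a5962c114d98598f28a0af3bb1a32553d0f17fdfd0adb401660,
0x4d0438fe474fbe97912294dfbc3e47f6ef2cdf8d1fe39676d49708571af3bc48749ba627c3e1a5,
0x2c26ecee1bb8b5019c999cf3ea39c0ab6d171c064e184255f112075b67241c9e32c5909cef1f352126c306d29fb85218de6cda51d973c27c25c4ee8a2aa0050a4c9c5239e1be6dec77cb4f84967f7bf6e5ae4c2e9dd0589b03cfb8117f90a30bd3cb464242b73a8776bb3bf32c26c68a82bb1101efc3bf25fc8008e3a,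
0xaf31788bc8edf186adc0774a1f0ff483c336b6f6db5c97b5da4ad9e14a4369928c2f4cea72d3ea7f705f7b2ee4ccdeb42119cb7ff6e32a78f6683aa2870ce6b7542c97ebf7fea6a9fa70325ac081e9c0ed75b66238d683ddd371938af9bd901dfd5b05081c7a38736cd89d936c2597f17e46777dcd87310e0a75ec5ac352ff6a076d995700,
0x2029f2c65a3084e526564551c80c2149a8e6c53fbed448332380f7,
0x450addcae2ef58a5f504582e772a27784b59,
0x4d4df9857ebb0e5ab65f4f0d4b0a26706,
0x3de23543d84dd37ed6c75221e56d43a6b80fb0682530cccd97b0b3833cc13090ba49a07bbfff892499da9ce2652ca5341147e618606,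
0xb50f876acc463a29d349a1c82acda556e834cd1dcef6781ddd8ec0e9f3c3cd87107db7f20a8e601570a741177a95cc7610,
0x8a7be5cbb9b102612f7378c4db4f551942e53c7a6ec3565bb4dad735ea6529bf3c70bcdb5f786388,
0xcd8e2070a99c1012f2954b9fff1f18f6ab20269cafbb687e1d448,
0x3f89f401d7dcff1cb77646da3c60f1b48cd2cdc77364,
0xab9e455a3710acdadcf2037bbf2fece5876a7e3c4b22eba8342950e93204ae3705235facc6f9d8bf5aaccca50e1d5e038830136cc1ca62b2d38099b148a679cd6d3c653fbaf284744d836b0e597da021,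
0x7ee176a6c4d0e527d2be6ce22a0eb22cd4a2c8708a1420eab5d890dd0ff7d2d3cde8c7201100211c6e6207305ccc545ac1b6eb4bceff6f97c67b1b8c7d5c5186ead9519e02871c0eb99c4bb8ec88fc9369c74f0cbffc72804ce9e5e5d6b84e8fa6fd279e747777a38932be6cc780ca8031f5d50ec02d3aa1a732672c0,
0x7ab926f8c49379dafaac6c64026e6b6a49df758d2db8b9f8d4b135d7096b63eacfa80b59e3c9b0837d6e83da829db55a3ad1403fdec,
0x6aef2626728be5fd854d4f83c9ab5d90684fc2b2938069d940f707ed927f0d4cc9069e99e7e405182fc52d87,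
0x9bcaa7c81f470619ceda4f1adb9dd0ba214b36494c752dc4c8a0517a97ec58,
0x1f7248f456c96a72737d5cd350cae2bd5fe83ff097c5a6947f5160,
0x22fc2f2df355f853941125b6f8259262ca3c4921f1c2c404966bca07c0c7602b344b65a5e55787d21be5084f8cc3c0e930b8e14cc2a,
0x4826b716c851ef5c4e35a0377221bae54e84,
0x282f0b906e81730a7e5bd3f551fa18ceb6062d8cd8e92,
0x2cd36fe9a1e9e6a4c72d4b07cee9af412010bb6a0f4240a65c151bb92e27a6d0e5740a8b69077c9ac83a58724d2e9407bb,
0x137214e9fd927412800dee399b4d3650c02a353e292ecd13d9d97088eab12c51580f7613149cbd8d6da688c04d172a8fd416777ab7f1c4d8c623108ea4678e5ef3d18e8f0402454f8a76b28845430e04783769e47962f0667c3587db92d7e43605d549b1100ed1b4fbea1a9764bd397dbb3f4b16b1c02e4f2ab6200845,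
0x3e5b89888f91fa0bf1d00e7e11f842046566e6018ef97131bc60e1a723692b4d2407ec0b817512a52ebd2983dbfcb23cec1556df774,
0x46fbccc43aabfc4b34d958729fdaa7a871fa,
0x5aee85beff4e79a8d9e2fa10c6432ef04e5624dda81b0e9f590d2c08b76c282f7913109c39caff31adf0dc6669e35916b739dcbf6da,
0x1ce512bcd9512a3bac5e4d6355b4d49bc2f9e10ef603c6bba6d42037c7f7cad908e8ff059cc2d41d699dea4cb1443ae334294b6c6,
0x658db3eb9c089aeed1cd52a7bd815acbee74ca7bb79180022a72794d7a75f8272a5a265fdf157c79fc41247cb8d436528e0718832322fc8265fd98ed197fd3f899479217f0cc728063c1c6316a3117528806b08d355a3b3b692eb176390c4cc8b0ac64869eeaab7c7ddf3e591348aea3270c486d4bae4320c1ad83a,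
0x2e9dda868f1e6a6cd7082ac79c6081b2689761c46b954e67d5dea5282adf3527158de02082e27b08d82bb16588f81a9e7ec274c00861b8a4675c7452aa8cf59449fc41ada3cb19c9aebb8fd8f3a89dac01c931c874e70787bac76696367a5bb682af5afb3f5ef9a13fd2473fdc920e572674f95e20fb5658353f7ce06eafb48d6eb9dc7244,
0x380f329ce9b95d5cbbcb653359726d8014a51afb20cd4,
0x18bf0fc265c520fa7ba1606d131276a05a43fa5203500de75e1863,
0x2c19ec250fe9609a18a5661cb99404e77b419b29b61d453fd1f10f,
0x26e1f99b1b24db8f37fd15e244036bf3e181620bc3522,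
0xcd9c6c08d98e2cfa9fe8e4d39283b227a2407fd4573f7da5798ac,
0x349fde7bd733c2d8806fc6909bbe22a51a52cfd973958,
0x26853868179c86f26e739641e6437e5cd731081dafc97,
0x1556771d61484897a219874fcf8518ec9c1333474c73ba2678f3e636a5de78492ffb1689df28d8f9ad85589cd0c157966361e4a9b83ca18a52a042c0d398aaa5e5613cbc2ce2,
0xd4bbbcacc7c5dac1461ffab1311b587aaba2481477c3c15d309f683cbc67f821b8f11106cc26f61bec6ccee6f943f822,
0xcd664f1dbcc5da583649842036be7d9ae933f9e73faa2334e3204,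
0x2d4433b4f141a9122f0c1b9b7ba589bcf524ed0ad4404,
0x3c4d949645c916b67d359aca136fbde23905277f840c5f372657b5f8b8b02a41bcd71477bad31c97205adc2f31de035fa190f026ceb153ae48751c9b9ba5799e6e70bf,
0x324106e2f3bacd55a52bb1a4c7dbe8cbaca8,
0x47f3a25d554219e4d213b46aad484675ace4,
0x2ea5c7d55627e52bcfb57578c6c8a54bd3ec54a762b25,
0x47f52d21a4dfec3b7191c151a809a0e6bd4c,
0x4910ceeac51b606418e19178e6bb2b9da22b,
0x15fa3320ebc59b23a051538ec11fe3e231b30e679d019efe67b,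
0x490d8d2c42fb4b593d43232e801872c565b2,
0xd6153387613b98dcfbfaf76b6dc821fb10929ffdc,
0x37a88216e45a77e7bec60baddfe1d2588b0f,
0x250fa25133c6d8c07054f3055065e187a0865a2fed0c1502119432e8ee85,
0x32fdc3a5dd3fb9fbcb570bc984b55a29e7dc9782c991f42422f4b0fb56264592277dda0c17118228004e73f381330a610ea1f98b5c55b03fabbc3d2bddf667d033c138,
0xa92aa288ef807f1f65e6a3ad90f62767988fd8fb8a881683f14c5a72b5e400c6e08f47528ade79f7c8a102ba967d2dc293,
0xe655f2dc9e0d61f540ea53bb27041126ac1fc7bf15ee511861c1d2e0cbef763e9c0189996bb5122068de60492,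
0x358c5512011f5eed5f06c96f1761121ce8dd9531802f101dc120a29fdbb7ac2d48f2fc7bc7fd4d1e13e60b1f308e3323ad138ac3daf662d314504acaf54b9,
0x623ebd34069ea3501335d7c7aaf,
0xc65ce77695aca6dfd38b4a5c56b4bed423e07ae5e6d44b52531b17c57ff1a18c5af5910,
0x1244876b029b47c22dfe6b97dbe3e315a5072b2a596685e8a6e3792e7fb5b8,
0x4909bfd80a34fd279aad255c499625b4676d,
0x1ec4adeb7b4c1f3a8a58e9f647f8bf2da43ec043151dc575578,
0x357139f553560a9247879a9360e9f7364274b91b85247925c385e6aeabc3b2f2d0d13b12908d0f3c6fff8da8b4e0470726ad9128e9c4f2b6bd84,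
0x1b9370d1b955da3c814541f43c9d39457e02e156f6d7c88c0031eb64bdcd9064212384cc66b5b4360c994f4fbba5429a889d81a944aa76c85bbeadc76352,
0x2745651692ff0ac922c800ef8a45badd5a94b6b9e1674fec649ef9ee72e6cad1ca526d1dd8a8d08f76d5f41ae9282ea975701219e012ae13ad7f,
0x19ca7374b8eb3d7e58a3330ee9bc48ba2cd68cc0699f2,
0x2325f19a24e6aa2629ea5fd3c1e1f9e7599a2243482df58da9541f,
0x5d0874a597ac087e4e16df45cc3d2dffc4461f3c8335d63e4c1b8e04d4df3517f8e0addb79cf2e422d9b4b8a642173e2035716c458c28cdfe710e4a11f7b51a2f9eb834af48b8,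
0x66fdbd536f3af2da32c1b3e28ef2140512a629cfba1,
0x1c7acc9f99b700b16efa06e34e060ab88a66a601e9f5ec098603c,
0x63bc9fab28fc90003501f0a042f0cc0490c,
0x20f661041b537f8079d5d2f0263398624b2760255f50df96a0a752865b5cbb00300c675f107a84ad32b5f05c34a12fb8f8e5b104cbd87f54cab12921d227d9de5023a18fe0bd5fa,
0x7a65a2a33316c3d483efa5d55ab47cf5a450166163fbd277fcdb9fd999bb73c229daff70017b2851ae41ecb7f1955a9ca5a20e4c5e98214df5a380f63d4cbfe12fd131e38024255d6a34367cadd8b0ded827bb4047a4f17c8dcca5ddaf80b65b99cf0a71f2ed77da5a8f258d7b34d9fc22e7b1421d63e418e02bb6d60,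
0x31d6b1c1d7d31964cb8326492722de77e852,
0x1dcb596ad942b9a689cade02103191e5f3154cf4c13749eab24e99,
0x4b82eb540bc517f9a4b29399f48d62623585d45df740e64ac98a2fa2eee85914a2c38b1aa4efc20dd7b0ea5671610f4348012e8d17c,
0x28f9f3d59b3f9f4955103898c6763f2a3d742a28b594a6f56ef37100b240561e2af981742f3ebc1e9bbffec73,
0x80fa8d48758dc16fa389633e55a2e571eb38cf826d817858c07afa6a75a46e37cac278e5e81b44b9,
0x21e1c02851b323b0d627c7d25568175dc4e4e9ebbd0408af57a791793d5ca46baaf1863fb2fff33e16513be1e7d82c49cf13ec5589f6c280cc2b,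
0x198241810023fcd96153ef27b4c03067dc80aca3904bc2e311f0f647aa80ad9abe7b35d8a1503ebaf88c8e58f8a4f4e51b506310e87734d84b4019fb2af85150840102dba37d293a1327629652694fe071a6779f0bdd8b5ff4d870c2b0f64a2ca527f746e4b21efeaf672cab177c7ae6a9a33f7a7cfa582ec,
0x49f605aee31dbb7c55020d257a1d61597830f12f8a6168e39052ca1d7df10b0c3867ad9b0c2737abba3dead5b,
0x17d421f4115775e7ef83a958949539794bbf56fc40f3712674452b3be21635da8fe6d9af276b56aae44ecfca2c2f7b1f927c567f3964ed0a3f825c45ed6fd,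
0x6393149852b8ebe874b73952048a27d6f0c8077304bf74822dd7de29ca7c5e11c3720337bdbd8953e1a4eb529e1ec6f07288f2a8381d7861939ffa156051f0771641cd1603544529eb495dff6945504ea4812caf31a883c0f54d5c3747cc97fe64736b2ae3d28bc5c2fe0fb85278aafc4b90cfc1d46576310d19f05e,
0xdecc12d90083711a1046adbf73047ec9bb991c33712186c7402b1fb61454bdb18695614385613231c993bbe19,
0x32f2422cd8eb1496a6fc1c5c695ac3c213f328cafd7afbf4f4147f513e83d9ed07f8e6d967ac3d389713b90b22d44ec8b1ca9ead2e2487908dfb3c4e4764ef4046218e,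
0x62c380fbd807b8892b37428f0cf22b3d90243f64c9b5649de9cec156d4b228231a0cf20fa937961f72055122b33867ebf40fc02a32a7ec18d75d089cfeb0a3f044b63eae24ebe6ea6c38002d19423a086626691750f392efe2d7b125e05882ade5e373a20835be11e7be676556bb949787060,
0x60cca3014f97db1003014b6abd6a4e97ad5f0697c0a51450cd3e84f2c4e57880cf315499e754bc67e93f5c74e63740774,
0x83ab5d79ba77705b5b22d7b72c9d965d8c92201aea157e9842d9b9ede08b0a382c8168e122d9a4a6b18df14da9a58ea98,
0x83daa50a77f1fd5fff5b66aec768eb5228c720b1f4974ce52d9d63f9cfac217bded9c4560a6daee4efd79e59393383e251ee646048c,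
0x162da65e5df2c0740587aecbcd96c053fcd1eb6c71cc8a5571227ac9bb2dad5916c44d587f155271a912ac6a6c07b5b9e609c696190db328af9be2ec89063c1e37246b222089b2a02d5908eea8768fb27c10faa06340e31eb68454a4315e570a544325213e78c93fcac7b82c1a0dd15b7624520462d37986acd5db0f20,
0x38b1817d01bcffb9633b5b19e753114eb23116c50fbaa1fd7a54ccacbd5f4c5cfe370c38e5687f09b1649d99c610db9aa47fff20c49dc7b2e50ba096d7a669264ee829cacb57791b3bd5928a6d5da517221fbad10d75c9471e3d24fd730ef7919bf7ccfeb77cd94bc57e68bde252d7ac30a5633a4012c7d1c876bde4af7d020647494ab250,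
0x2607cccaf37b6ff0c97f91e36fefb40373cabeb0ba91fd01b2345f5e55db1881e4602fed172d0e4b3e53c6df86c166fed8433593576c37e21fa8a033c21c7c7b5cb0c7f1ab38997ea89c049875de0ba4338066aa2969347e9b0382fc62a2c4348c202976d17a1b566dab01c1e0c87edcb53a02c4070d74b6bde22307daf3e8e46f027bce65b5db93df939db72a650,
0x387afc71773fbf09133901f4a6c31816bc94254174767,
0xcbae37f71f6b0bb49bca048faeae1f3b92bb2a0a7ebd,
0x1d03bd03299a9b17af4bc86c61f6f47bc268594c72ef8b1556c121,
0x11c77dc480465884ec37da131aa1df508c76,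
0x3600c1700306f38561c73f39d97c0816a121275246555,
0x37bdf479f82869c84f333f348f1384e9deab3a9e7d056,
0x26bf35f08b158af583d9f434104f35b051bee587f6191,
0x135d4a8455b904bebe44336aca097c52b9f10ce86b0de4888fed1,
0x4aaa2ea370ed9973cc6439dfae865b4e7bdb,
0xdbf1a49ebdf6401f38d38569369f9d4b3ca97c1095fe,
0x25da485adb9a3aafaf1646c3c33c13f0aa784472e125a,
0x10ac16b09f69e631ef081f15c7e2149f729e1e6db4d257e4d393e1,
0x161adb74d50286b2b2241953bcd640469dea928000d993fc8c3edf8e77301edd613d9187f798bf23c43694a916a93eeb8a93587fc15f17a4b842c9367c9f18090706852bac41fd6bd660f48d13baffe4712b7366a8,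
0xaa052f745dc59355621f9211d2843457757819c21fa0a7bb862c88539d12ec735a68e8b43c9fcb82273205b95924f477e2,
0x2e489cbcaf0b6bea69cee2a0e209f4b4ebab34d0520a55c3928e83802d828dbbccd33a247e6ab7286dc673f8ad1f6bf8684af109979cdd807699,
0xab63a7c686cb38d959d734d7b601b0f5811053ba32781f68f5290f9df86d8efd6acbf8853a4be52d6493aa5521aee2fcf0,
0x3cadc6c35e5128004fa70edbf9e943f7e04dc5048732139bf20c3abc0cc62a72eb612f41cdc1502fe14a7714586c6aa768,
0x102f1cccd1258c808d81452066d44b38f4cd03b4b4c52aad7ec259b313518f27a1fa8a411afb6dd94717e8641397ea621e879aeb77a9acc0577d2c0d3cb3fd474aa690dc70a41353d8a476a9961e45cbdf7c522b3a1b5b5e3a37a4f1522ebfd52ac9e13fd89a2114763d8d4bcd3500f257680ad5638b681dc5f485e790,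
0x39825a51276750c408c3eaa107841a76a7f336e59abde,
0x1121cf1e7e461de62153bd6fed70cfc87e96,
0xecbc56af8fab7abd765c297b7c74ac098eb89c40d757,
0x27dcc36684626e7b6357a629e7b07b765d64b5c2e113e1749c40cd6ec9868ae64a606cb10ad7e9182edc4cbd9dbdd3a5f8ea0977f7d211ae6e,
0x49d0d874541e4d271c4302dcdb25d7d3f262f3ba4e3ed19835aee920ee547c3293f1e4bad28966f5e45703f6b4be4f246b2b2614e27bafbff42c],
[0x72c420ba0e730e2176ad6d9bfae,
0x2500a5812a50771c23db292068aa68a52e2a472e9cae8d20155933,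
0x16faa7b2f4a5cc6d79bf47bf85e703eaba8eb5832484bd2ec4c9e9d265e05e7af558f02f34d0e791b58675ed5356a405ba84087abecdd51fab40597349a664181e06d46966f1,
0x1bfa2b3000270332caf0439906f679d482eac60c12bc51ea550355b4a30e7b10a6bc50e960a9fc1d692679d744ec4c7e440eafdb3a5b0aae6ce608fbbd929e2b101c491d41bb2e30a87c711cc0d14853ee3571874dbe512580820078bb2102066219a7f60ce9c14d9e8732b09d678ad8eff57dee793b7f92b08bdfd3b0,
0x186e43add0bbfa03f4f91be1a5f7b0c91288cf73c1849ec9a013ca0978958cf3eef574c818debed26c9090dc7da05010281cb61702fbab7426c12bb64c906e0967638994f2ad6264051fee904142eadeffe5a7cb26c050d141e8bc5b768c0aebd0fda34ac92491438187c18e9bed2a27f6602d6a4ca96bf6933696790f,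
0x891a13c5e4737639aea4cf2da00f27616f87378b0a88815553dfba62274a89cc7beaafa0de8f570062863063a01e790462afce1563e815b75e929fa1102a405944d9d5c1b08bc73e7e74dd1338c608b3785c526d7d1c2cd4d99b347fc1ad738a9535f7b209171769b4edf0c653f1284b68b5a19a0cb87dd3269902b4933832832c170c47220,
0x7222029bdf801605bc8ecfa0480,
0x40929e57656d83332d0d2e2c89bfc368e9448a7c9538d,
0x1d277b6265014508447c46682a45e831db710e45adfc5b5a8ee637,
0x25eab57e592082cf390668934f4d7a6ea012512d9add5,
0x1875bf4327e9189c0c6b83fab70d5b3ce8f200b329759,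
0x4779beff0850f63737a6e81724dbd489dbd8,
0x2fc94d519e53c24f084fa5afce76f2482aaeb309e8,
0xc05b1f23c62970972540e73b4de749d8010b3e0a6012b7091a9f91d3600fe3,
0x731d9180aaef29181ae926201b2,
0x3d2abd9587aec0fdfe94f33d9e8dc97d58873ea039,
0x30cb79517537b63c6b79bad582927c3c66ffde48e60277d6a79222,
0xfad891d64de531bc3761a3228cc4ce39ea7248778df0cb29457d6,
0x72ba15eec5012fa17c7827ae5e3,
0xe9d6a968dbc3aa0adf9cc5d9f2a1cce7ad300aea8b39a762e3cac662dd52f4,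
0xdeb439ad36998d13c1c3b171dfdde0136ef56eab91a5daac028,
0x5e035ff1f87306476b966a7f23d,
0xfb90eae33c04dce4c5d2ddd8b07411fda67d10a18626b633a7e70205de2,
0x2d8db8fcec0ea5c1889e4ce9aa3a9e9907c0326ac875163ffd89d7e3fba3c00d074867c136133ec4fa2dba74afebfe461137d529f19e3d3b573596d358b7cda8c9e34d42d1fab04ed1e911359fb3ced4d53e4e08,
0x43541619a75e3bd4887f6d295d0e47d1db18f7484d413,
0x3054257bfe4582527e69697ce3c2fa9fe6a8e144747d7,
0x962e494c5c4f689747,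
0x2d6b7a91e11369662a22ec31f3b03999d0dbb77e977bee92c2e,
0x552c431a9ea199db4677b3b409a8b2e851d2,
0x3f5cda20dd7b4b1c80d0a7347fe23782300f,
0x6f33095f13571e0a1d9c10ff839,
0x37fbfc3f6f80b98a4165e4bf585,
0x2329eb339a51cc522cee6444854751a8b541d505969c4ac191f,
0x312e06b081e9432800205f2101998d0d24cc1c6dfdd47,
0x11d9b4fb30f47bd512f40a47a66f25be15298e4157729f6ddca596,
0x3558cfcd8bc8518e455f4ef51b7,
0x72fcd4ee43dd3df72c6ac59d0d1,
0xeeee8256a94de48a3e1aea725922ca62cf0d919ab5,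
0x39cb9bc064d6e80a6d5599e924c400a45e8396b4c3e699798752c1e9284f16463ce3e669499b3d8bdcd10e9154577afedf530cf8b1fb763060313b125d795797dc0d67638608b0812302f0,
0x11da60890fd698c3bb67da0813fd266eb71d28ee7feb576f4ade8d,
0x31075cadd5cffef32c92e7b9d56fe0a2862eed8b8b3c329e7fda29,
0x18758f3508bd938a9d8ec83bb551a156e1d86fc08c7e2776abac260518d971edce556dfc6c6431340a5660f528f472598f35f561b3cc1b9fa97704941c90b6a1bea2527e09c91801f51564ac,
0x176c42344e708a8aa7c1f2817882d86f79405c30e59c2,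
0x430be9bc17e2e333c12c4170b57cc733faaa36d7af27de7a2cc79768cc1189779953f8d62670de590be3017df4460ae59ecd028b21f72ab260d3fcd3c0,
0x543e1e357ed997da5976a56a4f0e30f66062,
0x1b722e5a2378cf8fe87df6993ccea38272ac58af64e6d121efe854,
0x414ae45247b92bdf96bd339164ab97209b7871868e87d,
0x16dd838f1afe21a1514f602a0416ca566691e7736f0bc7a4a7213fc8e781be0,
0x4778a6a493707ce44cc6a4bc5531fcf457d0,
0x432e112c55acd695b49b5be836ed5e07570b0653a707c,
0x38580d565aa02185395b5f99ee3d07fb2cb91f90b463cacc09e9ff69407ee5f3941593973f409bbf86430bd0d6b2832a3ae3faf0bb73ab750e6492eb3db993e914e0,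
0x605690c61811c0ad91a5bca5c34,
0x6f2eea5fbcde8f2cb94d68d8ad2,
0x791a854bd8c8373eb0feff572854bbe5ff6af2419fded130f0cc359b31d3,
0x1971d207d369fa01757ee4ba38afd0894b75379e5cfaa47fb32477,
0x4964ad66d29807197ba204478f2cf5858964,
0x4966877eff59e745d68621572f10004be157,
0x1c1399f51f3178f0e22c75ea12e183fd0e80fb9e68df6a1fa16ca7892adb,
0x227c4a9e90f6f32708dcb1b7f1aff918eb5e275dfd383,
0x44c92f8b0e7980d0a2101715df0,
0x7226a0c218ea50028737b62ad4b,
0x1e087557c6ca0e69d86e1ec2294bee3b3d63565c4ec51029af33d3,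
0x4345f06081778e5a9a0f01b7e74864325d41,
0x3fdbed0310586145f30b9030d423442ec546e6b4d5ba9,
0x5628dc213789cec1e60972b70a92fecc39e4,
0x2329eb5446288ead1937e675f867d0b4f2efe15b15ba071f421,
0x24c11f08a7dc6918365c86a56c89908399c71817984b07d5b81a9c,
0x373b810448d9f271837b5a62471782118afd358d30c67,
0x25b53bd13bfecd43a78cb1429e971991ce0ce6e7a8b0e382ab3977,
0x5c8d1a80bdb121e0078ec0caa09c0ccbb067441a184b66cc5570b1c692c7127de502d14b1e49c1d499f569ba0ec9f306c20d47c6be4f431c1e9305aa914b15d979239a28e7f1558781ed5e,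
0x3ddfba64d6aede6e58d254eb2d3bc6da0a30772868f76,
0x3036f262854fad52e537786e65851903292a5491ad831,
0x42d021aa3c9bf3fcf336498291305991202e8b9dba3ff,
0x2fedd0ea2664f57d0bf72ffbe089ad2540b2cf284521f978f80806,
0x18428bdd4fb957770b56a4e2abbc9ef00c7ddb98f1e4d403b06a6939001225841b57a2e5d207dc85f948a4f2c0342fcd135330b06ddfdde703fd49218c56e4a5afb27a1bcaaed02,
0x24fae5197f6f497695ea95119ceda3dbe7aa74e6c9d96470a4266c,
0x326a60f0bd926ab0f62ad446b98c857a61dee8846fe22d55479efd,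
0x3e559c10503ee4cc598b9f97206d1bba419f4833e473fad143ac7b0a27fec7d982de37c787d9b9f49103ab120061f139df9dcbfa50f638648f71d6a9a1f389ad2345f4,
0x2b3265698067fc7cca8875459add333d04b77ef09d356c8abc6620,
0x2623ab989dda5fa13b4139d32086e856d2ad29e7252db0198c1220,
0x19ca16577b80e10aa360b8e04d434d6188a33c7bb07d65ce49d671,
0x82d6ed6af1bffb481d6c3e5b6909bf1b0cbb43fb8aa9f490e6944cda7d32fd7a8718492193f2eeee305dbb3af99b5fef62d7d98889c18c3fa02f53cdaeffb2e1f81a92e876ca788fdc4b91f2274db0664d6ec03,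
0x41484be701142d264d8a03baf3e9ef7a5fe2dfb377159,
0x174ba3bea1f83a34defef67343bcee6fbf2626aa6a0cf,
0x36bfa530f35a9124515e1f3560869992592d,
0x476bc1da8c7db13f0ddd9a56ef90ebb75d45,
0x26eff92610ac1ec75d1cd981942b84f899c30be261107,
0x706b310412c0ff10155527c2a6e,
0xa418f4d7f340c0aeb25e9dbea9bd549e1f0759d86d23b6e7b1,
0xc6162ea2b14e8a7da96e502e994f3638f94a26d36ae96b6ae2b3b,
0x2b447548159d1a05316014b7bfeda7ed1eca0f73391b,
0x14ebffd3604ae13522ef59f43b08fd10c05fc96e4edda3fd6e5c9f,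
0xa07046cb5eacb04ff3999a13c0e10a2e29c4a3619491e773a89a4d09322a829a9512cdaf66a2a2df8477200a20e1912a5b01687c44f816838bd611894e6272efed697d8e96a53,
0x11d287e864509cea84dfd244e1751978ebc83393992801b0d01a4ce660419f0699b85ee1ddc77807ff05149e6e318e651887c42242066d0a2c35d1f3bfad22844f82b89ac82d863e07698f97f5996baa8b93ce08cc974b3508bd2c11f9ca77db6982c2e3feea55493ce1413b188e85b7e04c83ebdfbec8960f79f38188,
0x41486006c8264dba2d91c721d90b442c514a679144f44,
0xa8c825384b4e52c86d040f9c96620aa8440935cea5a1dc7a5b2f42646c8e9cf1cedcde4,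
0x7035260a051bbe54840ad46d85c,
0xbd5ad750e4573358860118663e6ddca2287652f58319,
0x7319b21095233dfafd8f4d564c2,
0x41a9fd4e5bebde44985e871c076897aee2d3fb7fd8da0,
0x48eb75a97875fa295f827779aaa,
0x7f77f445604cb5c934cfd96476bfec8d3182676455ca1067d14,
0x145f562ab33b8045087d67a8025ab426e6e2d5cb2e3608557ea0ec0d14d26e199777e4c051669fdba36a1a70c476b4791bebbe369410a017c275e95903fae7454812e2b566d621a771b49bb924f994e,
0x1b61f3dc16388d65795c1264b80347221dc5649a91b0fb5d097a9a,
0xf1a9ffa7fa2ce3d8f822633120156d72ee329d2bf20863e817751b328cd5d8d8e09a982f578d119a0590c53e6f60b3cba9cecfd1179c44d290401a009a02ea9a8fed0678f4a4d0,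
0x4095108040693351bb08a6c9ff8fd8a434eab4c919598,
0x41495539a52ec025f9383eff76f059719c14f3742bf51,
0x369f2eb29f431039cb0ca009aaa26734e893b1d592e05,
0x414841f73fa679445e2856bb71fd8b4b00ebbadf30021,
0x334cc15546d87c6f310796ac2183be33e93b44e94d1270c5e6adc1,
0x369f303a167e36f3cbf180d75ae1dffd8660f8014a475,
0x2c4c86889d9803751a29ea9af96b495300eaafd2e22901bfbbcf7dd9992625adf5a4878e79be25bea4b9663b4f1d330b6df1ee743d95ed89fe923268a1bf847f89da,
0x1bc9d09f8fcf46abac780cb272cc347ab1a8c3ca90a9ed5735d1008aabda95a,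
0x1fe905406304332c1df1171b1d97570fcb45,
0x1733768c237f779bc0b54f0a59fc0ceb303651ad821365182777fca35efb5a2d9a3c57bb1837672f6,
0x1eba258ef5cf97e166806c9f88dccc90932a368fb2fbb30f2f0b9521746c34e,
0xa58a885040b23cfd7d6e44b20204ea8b4aebfe40b4ab0252d0020bdc03b82a012b66d16c71ee6fb9a8a57fe63f2b069fe3a025850d7a02090ddb5a8d3e45816b2675fb936a72f2,
0x2a3e506ae9779b1355ff55c094675285030123325fc68b6276381e777aaa1f77ad74da022d0de26135d6dde239c1e4cc1f28f2e3ee0f1d0baaf76b96ddac8,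
0x6e3a41b75f18f2f638fb9613764,
0x1aeb4074396e3308138c699e56e559ea2cd0bfcd923574ce125406,
0x1289ba241fb0d4cc1e1aa570bbde0b094cc3603d1b495f30d57dc3729f5312bb01b5522a54a5eda77174ba2e6b55d64c6dd972a66d9bd277b7b92b086d594012556155aa116bc3be4f279030,
0x1877f27e7a94343769a84a65ab60f187c067ec3afe4ed,
0x590f2970d19413454d212cbc0c5,
0x37e3805b262d7a56d3ecd6f69023def30a4b,
0x7daa1d8b5786044115,
0x727894539b079625afd99f671b9,
0x7f77f44464a75497a545cfa594e00409507c405d309ed4eb89c,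
0x18b64bbc455d7c88411688a3d276ef9d4620d1b7db335969015b4549ce7e6ee24cbcc61de7f63670b26e4ce8ce91e94eebe71bea2dfcf233714826e200a46af87813437937b567f7adf10d81f4fb9ba,
0x11e85c8712532f0cb1d74caf80ab98311e9e4445ae82c304d5306f8a722887eedad02f5d75d49948cbc8f44dff80e8606429870f5ef78641ed94c0bf98d3945f367ae4b16b8f69ebd2997826a35815e5c459f9e768400bb93207f5d555e3ce48b70c57b73d4c1b6580b14436a3b791a11950896b4a339de4accca407d0,
0x49d880ac9f32cc060bffa87ab5cb5cdaf070e87f2edc,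
0x158f27049885c2db82653c695434c7339b16bd59941537fd6bf39462bdb37b75605d7df8,
0x1dfa8e471ef4fdeb166215bb9c93d0e534a56b0aaf77191224e5c954372da31244af68246e3f1b80578e19bf84ce096731fe6cf8b983650d240651fcbdac24cbc88,
0x5228ce8f7ca6a8a7bac02338af41f6ba1035,
0x261814248db0d3283e483dde8dd06aae16b9d8cbef5153a3688,
0x72b6e7fc6cf64e4223fa53bd5a4,
0x3355fd02cb3208a636def6ba17621b518b1f3ff4ebd4c,
0x23d103c938e86ccd03c41f82153645ddd189abd1643af,
0x19c26d3ad1034949171878eb547e0b4cc6c29e9c7328040e5297f8,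
0x9d92341e9b880ad4262315cbf725940d1910917ddbf026608ff387a1d906392c9e90177e70381612ae2bf6942abdeb19edd5c4b6d2dba3efdb52af88c48c3ebbde0f77f57dfa,
0x178704f45673c840115b03bc0ee659fcbeb4196b50213,
0x2758c1dc302815be512bb630a02194d5fecd671cb743825fb10c5fc41136be857463936bbe6f6aa7c52a8c06fcce75aba21a375dd62cb87cd91ae5eb2b5671ebf6b9843174c37da,
0x8fcf3be0c63b5693b697d518fc16f039044ebc59222eaf82d259a062ee4ddd7db1caba58dbc457e8b1aa2009,
0x946e4944f9effbd9c0872079c81f8b344521e666dd88a49a14a0d19542b3b22906be0c2fdc18c40287e24a5e972c9056ce,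
0x87429a923d369cfd32c6764253521f1c8cbb79e9dbf2af6898e64d3fb9352feda2710a0e3993c82f289bb41fd3e42469af461e8f326,
0x74c301b9f56559eb9355aff84b9026e32e18b2f097660009be9daedfeeb57a0d14d3e43823e0cd86dd63e66d7aa210ce6c52dbff8eedaaeb5a24b1148f224a2ffc6cac19d302d17f7e31c2524d3d910c804c5bc9d2543bbfb868916f1b1dd2c83b0f04a950ef659e7530a003d96f563dab1a36,
0xd19fb438974360ecb52451fea90bd9ab3c03b7d7213,
0x303e8aff2c07084d4654017569f19ecd92bd83ee927246501cbde62da94a3a01293195fbd3d10ae1d27d16c814fc764b81907fb7dafeaf5a5c9a6b191e382,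
0x1e313199dd71834ee12109036471e4efd5e50fe624793b74b28a3890f9322ba72efd1d95bf019a47c5f73c4d2d857d416c2ce1ed30507e56bbc5b067292100a36b162df4bd0e358,
0xa5de5697968cd41838506dae28a5bf7d98d440759b85df23301b2904b0f27114d8e9c0dfd94a4a5512e38ae5bfdd6175a3ca99eca6ac9bb965ef77678c1ab635ac492252799b8c2f48ec9d7f43d4b93a49f290ec5602d39a29d3923b37d8236d075b0fb397eb20cc0ffc9a96d7e3b24b186f064f41668d5d78bd3b40,
0x42c05449e0acb7d8771a504ad21782dacc8fac16782b14eed36754410102a52ab7c1850a9048785b932604c3d6d26aff0c6a1a7f717092d41b3efe199108270ad023f9d2c02ba5c5538411aafc720c251205030a455d7a5d6770769ea65e264ad5cd10bfdb4d1c0638185b603f1655ceae91d24e10a444f747dfd5cab02b08fc0a4705b9f0,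
0x1cf377e984970bd37234c5e88afcd8a3f7ab6a9aee1c4c0973d96f3ea0c02f6ec16feb86,
0x3fcdb4dca8b7afe31ee58e8cd7859721f7b2a049ce356fce7148e718f14f0f20593c750083d9f8aae97ae9543d23ea8cdd0764e68376424e566,
0x765cd4e1c5acf7cfff1b4e5e2355649b6e8d4328248ace09a3f8f3886b377a2ac6689c9928195ab601455edcdf3a57153ec36e31b7602c5aa31,
0x9c50d2501ed36fc966e87b220d93af08511407115ea93f0f878d2,
0x48c691848d8ac549e699d491e4a413c7b9e1,
0x192e3c46ad464b14295ee83848ecd0e37459061974f5b04378a7829dca32b4c09b01131f,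
0x1562656ab83219b0cd5a5ce7cc46ed85f71124aa1be44b79ce53e0163d2595ae70a85b61,
0x477ce79be7bf54348845d27738240c7de6f6,
0x75686b14c7c71ef73fd1dbaffab9f86797117e03f95748765e,
0x38c2e74ea82fcdf221487b9b058b97426d1d16f0d17cf,
0x3723fc25e1e7772602dbfde9dc348620c03a8448f587f2782ebe57966e70b721f3633cd15d74ecea4d7b220d7c310403699a7adb5d3f1d5d37d37e208f0461771728,
0x9af97ae34d03801ca011ee5f8ddba3f2d11ad6410d9d30983cc6ec6206d628c88426bd0b4267e0fc29da75782eb0273aff67473d2b1,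
0x8fc980fd6c5ec05f7bc5a3a59de25230dda6cfa0a469d637f8b95c9a88c00d8842ab685cd196589ebc0bf011c3555729fbfb88a4c81,
0x7d68bae626f77179cd,
0xa92bdc6f3dfe8e5e1d5a550e,
0x16effc1a142e4a4e44b54c943717ad860c9931fb64,
0x14148d1ac69a9e32e3e06090e8e75d38d7d61443b6d3,
0x6ea3ff0be6024142830ab3952c2f7bd9a4d8471f8fa83eb0547ffa78c66663d9065852d9929840b7e9ee1b543fb7acae303d552c3cec4ee63413ad23cbf3f79b7b64cec22ad54532c272d,
0x96a9fd6dbd3c2dcd2cf668ea99bca894c0fd9fe89c5e21477f84473cddf959096a586fa2c1dc5b9acd6e1354a1140a352ec540371525cc6fdb7e608bf288088b0668fa5faef1c752a347dca05aba661d65569318178441ff4a868bf29b45ffb80133ddd2b7e1482754ef9e2bf89bd0b6d0c9e4,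
0x2a5c65c4e4436e74eac55e8fd3cf5ebb615044d5c192b0c4e3589f468a4e266a532eddcef987b58be3f3d9b8fe1095c93794e40b2f2dcada7b10,
0x1402c2a8bd59eff47e286e377feb8936969e66549b5a31caf4673747480d2ddc06e50ed72c5300eaa9807818fcfaf406aa070447d1bed2be925cdf7364ec66d105ba740f23eae73c88634c98f9204f47ab76e804315bde2be633451f8523747165c201831f4a160dfcb09c5e89c38ad0b9748130,
0x107bd598812ef69a6b46e935c70b1929f10c1d2a1d43fdb5b6a11f0ca9d1e966ea087130b61b6758e40159d829,
0x1f840f1bbcc51e8e4b49b238e2ed47e776b59ebd4bc60609f5a93ad603ccd795fab2f59e2ceabe78c2797242a853d8321d197ec90c0,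
0x264a8d77bd8368bcb366713c24af9b750642480b0166ccda2a43c2d142858004c4f71b02ace89ac5c1682c35823ab88fdd,
0x7ac992cab875b23d88571f540a425d321010efa0755ce36f19c0cbf328b36db6430d69b210459ed0b8eb46092ff7298156c59defa538f90f28df29261d9bb339a330642ad614dc1bbc5f501001284da1ae135bad50ff2572265939a1ff2f8002e3aba0b2712929eafadadd067beddcc0c8645594ddf027ab0cb1f9284,
0x496a9f6bb4b632fdaef17c40b87a42d809fac7194d65596207bb5bd764bdcc04cfb0338e71e423abdf9e2e530,
0x25d52fbf5138fcf2ee90add905957eb158810d2d476a0f7007476b187886e01e5a60850286c4e710ed2fa7c73780d31a4f138abf53d30f44991f5d5978c70900b360ad97171b64661f2dcf12d1204b683e59f89e831d3185a,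
0x15c60323a7c92cd15b58354530e94049083416641bc274b18b8aa7b32ae75d42e82584f7f2d4f767daae425749c80371bb57ea0dd9b17bf62f95a38359c645e7a0033b186c68e6d771a65ff3e0c203e8c56ada292d1591e5b35725abe2a8d7be968cf0ebfbc22124510de83cc2bd2a85295cba56122adca0e15986d19172c0edebf6f847a9,
0x2fcf2bdb210a7d0e57de77bb391e0376e4039ba4ef22,
0xd6c81223508689adad203e18b16ba3d8b8bf51241bad35c72ddc9,
0x5334dd03e8f702db88f12115d30a05746536,
0x334a577a32cd153b46da247b3c847713ae082a073100846df36401,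
0x40fd0e6ce4fd8f7f26c93e4b3acd9ac8eda7cb297b1ef,
0x1e4e94e6db35601a058d593a0ac5af13f52c16160b40,
0x59efaa44acd6822de875ac3720a00d9485bbd7eadc335dade25c96fc3844def07405636dadc3ae4b7b40e7a73f26f8694e16ce5dd40d3e91d9f31d70c82c023fcda,
0x251f02a6ac39fecbcbadc55d6f93f555b08578b98fdfb357771199,
0x613a5714d4627f37fe0775a991673743895481d64a995b18092a115a160df127427926da9fc44980afe86976d3a6183f8c5c5cdfa466694ee41e,
0x64bab558623d20a1f5011fd348c1577d9e660d5682baadc8faf7d945f50d4664aeffb4e5919813bf75129282803797562b7c200ef90,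
0x66450f5d8ab1fb7a5f052583d548ba3bc464628de49c43308c25f992dafc30e6136ea4c642021c3d59e2231db823a8d97ac19216ed204ddbe53f284939d2127c59e602a669819b55b054006a3423a77a35c9adc1e3e376aa3855c328221b7b3d56b84035487113757cfe268f87ed20b69cae14201b1e2929b1f4a8926,
0x992b9f1183b1fbca481c26f2eb2c2d5e018dbc91245ce39953dc90cab92ba1972712f831a171632a6bf9360a6d6bb5da41b61d8adbe4a85d2b097965920af40279b83acb22aa78f61edc9299846fdb117243e59351697cc91fd608f1d5922a89e2db94d6bef5744076b4f5e44276b7f97d219f1557c73a78cc6712e095e585da8435ef05e26,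
0x211a91a7cae654c17ba17bc5919930f996c5c8153002c0ed8b41364b50b45f3a4656c5bf84a9f7cb0cf2c8f0a68a3fb8730480eaff8c4f2121a38c4da1dd4aa5c9097907d7b65fbf4e3cdfd3d3cf5a52cda9ffe0dea87f0e562c28d176e60614a42b27c414dc0f5045c8efee3d28994b2e30f54abcc062e23d34851225748c2ccd0cf2b5e3c95dd7438dab45cc5b4,
0x158fd2e5bf7895a2f6ce6acfe7294d19dece7feb6b165acd6b4d3293311f477c23efb476a119336a16835b60ffcaf2973c,
0xb90552fa8fe83ff599d3130501f0f36cb8ebb34c56fbed96e6f0a7e7f0be7e1a35e703479c014b98f4e572d42a8488d0decdb5849902c867946d7d7d03e460d95cbfc,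
0x6025343a9ee51adb3ed7d5766c4,
0x12352e5fe4078315420a1a0bcc11ee56bf10b71332b286c20e29fc,
0xb31b67f902a010732dc3f87c2c3c9d970a1cf0b2f79c6b5d3701cec9f24ab370c3338534fdf0eb600983ce6f0e3aa29b62649f1c3d,
0x79caa6a532f07266dbd435cf71830ef8f4ea451172654d03f1dd85ad7003c4b8a45dfcf930a779e1b8ace9c4107dc4bfa,
0x5fad95d34840b004bd8b5f8a8aab92f00d1fd032beb90c1e0b055ef87efc79d11a0d3b506f1a7dc0,
0xd4ea40c8b6b126986a99fba374b272779965d30f6106cff98eaeb17dee56217d3e22954b396c8bc614c458e33515cd5b22753560b24303cd116,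
0xda79b71f4701ac101a59a22fb84ad388c37b383e1d98e324fb690e9079e871eb30e53b7c19e617b99e8cc1394,
0x47695a79961b22c179ad066feee52b0286ca75337372d845117ebfd5b30bb511f7dd7ee33dda86e7c28693a889e4be3da00842b7e07346a2d53151f62d8,
0x1b11c201fd08303dc68e5f163787ae21087d80eaf6186c3ff05773320a3ec51ef62d1bff11151c7855cdc2fd7fc2a26a416f0b62b7ff330a56904a46c8cbf2346a1c3697b56ed1eca693a726160db82f85dfbccd01c602bc7927125e618b8cdb6aacdc74f5105bb11c08362ef5ea6c1f743e051c4a2fcb1f6,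
0x492c5a9cd1f24ce88ad10f0e4585dcf8cbeb500f110f0bf0842fe3074bd5b8e8a981d91ec23da320cebd7ae1c1219bfcf65171b0a2e,
0x1606388acf069891b8d528db03725ba58f498b616d04ad1bccfa1294e13ad011b64f99de4099b77a5c51f69bc743b479481ebd85e54acd37b16aaa6343e503a1f2eed1cd0789827785249c6692792b23095cd416911834edbf097cea48f34f530d62acaaaf4f4e7e4b2385ef629c5e84bf2f4b368c1718055,
0x1cf7ac7e50c14e45e6063fd71513dec6eb3687a4c43a5beed33a0cfd297c6471c370cb2014964660ca285caf604bed0a8bf6b255a0778b725accb9cc35048bb1e44219fe6eca40b4046ae87f57eebbd5e15fa69d83e35eae1cf17c1450977c7a2e5ca11aa95521cd92ef55e87b09af0c2c614a81,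
0x3c62bcd2f94ac2c72d064ca2d10f736e0b2508262554ef1f4cb876b8a78bf3f6c9c2de85b8f5bc4c54dc8b56fce43bf4e2308d0cc670f7330cd83abbc134c,
0x123c009ab1a39c62f738b9e51e0214113a5280cc572a6,
0x1098a2e4b0f970e5a88ae814c6d81151feb0e58530196d484647d1b690884dc5993cece923d5c5986e768ed5f4,
0x1d4d5426827562499ec0b6404ef97361f29fcd18fd36c07e5305d7,
0xeb26a711e7c36b99d103d9de15cd218fc379dc1c8629b7449d10cc9853501ae0698a7a4eed381f37,
0x2ee06f7f3c926d9d6830b15e4c84fba9b0666adbf6a8e048a5c47c4da29b5ab50786fa5d815506236716ec0814a1f37e81310a6eba507e62ef801a13949eadcbe1423f3b4f1b710,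
0x5286f4467845c384cff09f0324729d819744644826569dd3983beaf582f5105930a78731e927096484422d7dd60b2a4bd1711ba5d8bea8bc5b182fe38fef6e48eec25150575f207432c712e950bdf9ad8daeb7bc218df2197f7ceac12cc59effdf5e92d1fad03e21e10639161ce476abe206f3f0779c2d814816ec7a,
0xd90576934a2ced7a224dfcc774ff004fde3e01fb7f66ee5e5a110a9b158e9147ec0dd131dd5c7856b2b6ec22d902fe827c2de471d434d9651d578bfc9aaa0ee3ae88c45285f586670267b69546bce496abd49b0dc18566630eb2d3ee6e1f77f6672d1b8738e7b803323844f0cfb7c926c6412cedd61429add145aa68e245ffc705a80aa2e4,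
0x7c71a0c3a2a42b5c6040e61269b5af413164743086b8bd4619bcf9b840d603c278809562194369fc,
0x28af41072a0d72ea5f8366a2ad95c1b25510cb6b4d2738d69073aec7764e280d161229cd76c35cbb0fe90e6a4831797c7056b7a202c5ebb7e6cedfe013e3119cebab6efe7cb62e678d092f2fe2ec1a2318387adb4adca98ec83f338e5510cfaf721863b5dea2a4ae47e,
0x27d3fd0f7f9dc6c68132b583443488dc83b6,
0x13cb669cef6e8bba5e180df7a90f3133651a,
0x1928b8f28f2921587c6e6e6bcbf3093aade833d2b82780f92669f535ba3356d4efa58b86f6249ad32e53182f12700121ac59129332eb39429674,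
0x39698b1aa8ac9ff2feb03cdb7d9fc539de9e2e46c9d66ada8a01fe483d4c554a4c73caaa842a8717cc097e2901fbdb107c9ddbca0b83d3c0ab3ec761eadc2c7bce5ce3cefcdeda90a9e827d22135eee78732b44bbfd76adda8c6263cef4f739dc23906faf358a,
0x114e64c2d74e424190973f0d8adf5b4800d7298bce2243aeb9cc09,
0x2ef1a4b3874b21050f37e07298fff76fbdf2ca6bee6a4d48969b6b5cd54ff73052d8227553ad3ce1e76fa9e9fd58ab476ca8499b39ef916ceb0ec154e21682b49a6e252cfdecdbe5875551a3e307133a1d075fd6448c9461a11cf76f2e4a7611d87ac8874dc22582c3e,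
0x14f282e1bd50c690bf37fac5c57cb9998c9a4d89cf0153cfb16d0df399acef7b41ea65299da39b86af60b2b61b3659e7aee5ca4ab8036afc8134a622bbff2becb74411e29fe560436f347eb2931ad2ee34c90b096d02231165be4c8d58242cab734bd520bf4b93dca948d190e195bf393fe2ad7fdc79d83a8088f91f411f38421ba1dce36d,
0x12045123c3ff895a9ef161f917e6efdfb8180e58aa4b7542842773b64a4a6a31868292b35434a000cd4dc1d4abb30ffb8109e9e6971dbce52163af6dbcf1e9f210353e6a492bc8bf270710a39effc9a1750790f2dad80a4895fda4930c1a0bee35631ffdf08894bfa1086b76ad479bda91cc40d940bc2f609cba00ca85a63c33545c0c6107eb1491a3e292be2ae2,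
0x23ad0cd233f3b94419fbca046b51c664a387f20908fe3e7bedece858efc3e684456f99826423dfb758ed3e763d9e4bf67c807f8da23f776b7d03c4c01747601e63e6f58bd70a832945771e4142aed3236d844908537296638f401d8c5d78b31e65d969b175449f03d401149178293383453a04eb156dd23ae0afb75d7d55a3accf69c46f092f48c9be82ee05c7cba9b7e61ab47e826530]]

theorem checkCertificate_hasHam_nine : checkCertificate [0, 1, 2, 3, 4, 5, 6, 7, 8] [0, 9, 18, 27, 36, 45, 54, 63, 72] 9
  362880 52674448258
  [0x10340501405014050160400000000000000000000]
  hasHamCertificateNine 0x109c80 = true := by decide +kernel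

theorem secondWins_hasHam_nine {V : Type*} (hV : Nat.card V = 9) :
    SecondWins HasHam ∅ (edges V) :=
  secondWins_of_checkCertificate hasHam_mono (by norm_num) (by norm_num) hV
    (List.cons_ne_nil _ _) (List.forall_mem_singleton.2 ⟨by norm_num,
      validPattern_hasHam_of_isChain (a := 0) (t := [1, 2, 3, 4, 5, 6, 7, 8]) (by decide) (by decide)⟩)
    checkCertificate_hasHam_nine

theorem secondWins_hasHam (n : ℕ) (hn : 8 ≤ n) {V : Type*} (hV : Nat.card V = n) :
    SecondWins HasHam ∅ (edges V) := by
  induction n using Nat.strong_induction_on generalizing V with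
  | _ n ih =>
    obtain rfl | rfl | hn : n = 8 ∨ n = 9 ∨ 10 ≤ n := by omega
    · exact secondWins_hasHam_eight hV
    · exact secondWins_hasHam_nine hV
    · classical
      have : Finite V := Nat.finite_of_card_ne_zero (by omega)
      have := Fintype.ofFinite V
      have : Nontrivial V := Fintype.one_lt_card_iff_nontrivial.1 (by
        rw [← Nat.card_eq_fintype_card]; omega)
      obtain ⟨a, b, hab⟩ := exists_pair_ne V
      refine .of_reply hasHam_mono ⟨s(a, b), by simpa [edges] using hab⟩ fun e he => ?_
      induction e with
      | _ u x =>
        have hxu : x ≠ u := fun h => he (by simp [h])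
        obtain ⟨v, hv⟩ : ∃ v, v ∉ ({u, x} : Finset V) := by
          by_contra! h
          have h1 := Finset.card_le_card (fun w _ => h w : Finset.univ ⊆ ({u, x} : Finset V))
          rw [Finset.card_univ, ← Nat.card_eq_fintype_card, hV] at h1
          have := Finset.card_le_two (a := u) (b := x)
          omega
        simp only [Finset.mem_insert, Finset.mem_singleton, not_or] at hv
        have hcard : Nat.card {w : V // w ≠ u ∧ w ≠ v} = n - 2 := by
          have h1 : (Finset.univ.filter fun w : V => w ≠ u ∧ w ≠ v) = {u, v}ᶜ := by
            ext; simp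
          rw [Nat.card_eq_fintype_card, Fintype.card_subtype, h1, Finset.card_compl,
            Finset.card_pair (Ne.symm hv.1), ← Nat.card_eq_fintype_card, hV]
        refine ⟨{s(u, v)}, Set.subsingleton_singleton, ?_, ?_,
          (secondWins_hasHam_step (Ne.symm hv.1) hxu (Ne.symm hv.2) (by omega)
            (ih (n - 2) (by omega) (by omega) hcard)).mono hasHam_mono ?_ ?_⟩
        · rintro _ rfl
          exact .inr fun h => hv.1 (by simpa using h.symm)
        · intro h
          rcases Sym2.eq_iff.1 (Set.mem_singleton_iff.1 h) with ⟨-, h⟩ | ⟨h, -⟩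
          exacts [hv.2 h.symm, hv.1 h.symm]
        · exact Set.subset_union_right
        · rintro z ⟨hz, hz'⟩
          exact .inr ⟨hz, fun h => hz' (.inl h)⟩

theorem not_makerWins_of_lt_three {n : ℕ} (hn : n < 3) (first : Player) :
    ¬ MakerWins (hamiltonicityGame n) first := by
  refine not_makerWins_of_secondWins (P := fun _ => True) (fun _ _ _ h => h) (.done trivial) ?_
    first
  rintro S - W ⟨v, c, hc, -⟩ -
  have h1 := hc.length_eq
  have h2 := hc.isCycle.three_le_length
  rw [Fintype.card_fin] at h1
  omega

theorem makerWins_iff (n : ℕ) (first : Player) :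
    MakerWins (hamiltonicityGame n) first ↔ 8 ≤ n := by
  refine ⟨fun h => ?_, fun hn =>
    makerWins_of_hasHam (by omega) (secondWins_hasHam n hn (Nat.card_fin n)) first⟩
  by_contra hn
  rcases lt_or_ge n 3 with h3 | h3
  · exact not_makerWins_of_lt_three h3 first h
  · refine not_makerWins_of_noHam ?_ first h
    obtain rfl | rfl | rfl | rfl | rfl : n = 3 ∨ n = 4 ∨ n = 5 ∨ n = 6 ∨ n = 7 := by omega
    exacts [secondWins_noHam_three (Nat.card_fin _), secondWins_noHam_four (Nat.card_fin _),
      secondWins_noHam_five (Nat.card_fin _), secondWins_noHam_six (Nat.card_fin _),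
      secondWins_noHam_seven (Nat.card_fin _)]

end MakerBreaker

theorem theorem1 (n : ℕ) :
    (MakerBreaker.MakerWins (MakerBreaker.hamiltonicityGame n) MakerBreaker.Player.maker ↔
      8 ≤ n) ∧
    (MakerBreaker.MakerWins (MakerBreaker.hamiltonicityGame n) MakerBreaker.Player.breaker ↔
      8 ≤ n) :=
  ⟨MakerBreaker.makerWins_iff n .maker, MakerBreaker.makerWins_iff n .breaker⟩
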